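/- Let $(M,\omega)$ be a connected symplectic manifold of dimension $2n$ (Hausdorff, second countable, possibly with boundary or corners). Call $M$ closed if it is compact without boundary, and open otherwise (that is, noncompact or with non-empty boundary). A Hamiltonian is a smooth function $F:[0,1]\times M\to\mathbb R$, $F_t=F(t,\cdot)$; its Hamiltonian vector field is given by $dF_t=\omega(X_{F_t},\cdot)$. We say that $F$ generates $\phi$ if its flow $\phi_F^t$ is defined for $0\le t\le 1$ and $\phi_F^1=\phi$. The Hamiltonian $F$ is called normalized if * (closed $M$) $\int_M F_t\,\frac{\omega^n}{n!}=0$ for every $t\in[0,1]$; * (open $M$) $F$ has compact support in the interior of $M$: there is a compact set $K\subset \operatorname{Int}M$ with $F_t=0$ outside $K$ for every $t\in[0,1]$. The action spectrum of $F$ is $$\mathrm{Spec}(F)=\Big\{-\int_{D^2} w^*\omega-\int_0^1F(t,z(t))\,dt\Big\}\subset\mathbb R ,$$ where $z:[0,1]\to M$ runs over the contractible solutions of $\dot z(t)=X_{F_t}(z(t))$ with $z(0)=z(1)$, and $w$ runs over the discs $w:D^2\to M$ with $w(e^{2\pi i t})=z(t)$ (smooth in polar coordinates). Let $\{F^s\}_{s\in[0,1]}$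 be a smooth one-parameter family of Hamiltonians, i.e. $(s,t,x)\mapsto F^s(t,x)$ is smooth on $[0,1]\times[0,1]\times M$, such that every $F^s$ is normalized and generates the same Hamiltonian diffeomorphism $\phi$. If $c:[0,1]\to\mathbb R$ is a continuous function with $c(s)\in\mathrm{Spec}(F^s)$ for every $s\in[0,1]$, then $c$ is constant. -/

import Mathlib

open Set MeasureTheory
open scoped Manifold ContDiff Topology

noncomputable section

namespace HamiltonianSpectrum

/-- The coordinate expression, in the preferred chart at `x₀`, of a field of alternating
`2`-forms on the tangent spaces of a manifold: the pull-back of `Ω` by the inverse chart. -/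
def formInChart {n : ℕ} {H : Type*} [TopologicalSpace H]
    (I : ModelWithCorners ℝ (EuclideanSpace ℝ (Fin (2 * n))) H)
    {M : Type*} [TopologicalSpace M] [ChartedSpace H M]
    (Ω : (x : M) → TangentSpace I x [⋀^Fin 2]→L[ℝ] ℝ) (x₀ : M)
    (y : EuclideanSpace ℝ (Fin (2 * n))) : EuclideanSpace ℝ (Fin (2 * n)) [⋀^Fin 2]→L[ℝ] ℝ :=
  (Ω ((extChartAt I x₀).symm y)).compContinuousLinearMap
    (mfderivWithin 𝓘(ℝ, EuclideanSpace ℝ (Fin (2 * n))) I (extChartAt I x₀).symm (range I) y)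

/-- A symplectic form on a `2n`-dimensional manifold, possibly with boundary: a smooth, closed,
nondegenerate differential `2`-form. Smoothness and closedness are read in the charts. -/
structure SymplecticForm {n : ℕ} {H : Type*} [TopologicalSpace H]
    (I : ModelWithCorners ℝ (EuclideanSpace ℝ (Fin (2 * n))) H)
    (M : Type*) [TopologicalSpace M] [ChartedSpace H M] where
  /-- the value of the form at a point -/
  form : (x : M) → TangentSpace I x [⋀^Fin 2]→L[ℝ] ℝ
  smooth : ∀ x₀ : M, ContDiffOn ℝ ∞ (formInChart I form x₀) (extChartAt I x₀).target
  closed : ∀ x₀ : M, ∀ y ∈ (extChartAt I x₀).target,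
    extDerivWithin (formInChart I form x₀) (extChartAt I x₀).target y = 0
  nondegenerate : ∀ (x : M) (v : TangentSpace I x),
    (∀ w : TangentSpace I x, form x ![v, w] = 0) → v = 0

section

variable {n : ℕ} {H : Type*} [TopologicalSpace H]
  {I : ModelWithCorners ℝ (EuclideanSpace ℝ (Fin (2 * n))) H}
  {M : Type*} [TopologicalSpace M] [ChartedSpace H M]

/-- Nondegeneracy: every covector at `x` is `Ω(v, ·)` for a unique tangent vector `v`. -/
theorem SymplecticForm.existsUnique_dual (Ω : SymplecticForm I M) (x : M)
    (l : TangentSpace I x →L[ℝ] ℝ) :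
    ∃! v : TangentSpace I x, ∀ w : TangentSpace I x, Ω.form x ![v, w] = l w := by
  let V := EuclideanSpace ℝ (Fin (2 * n))
  let β : V [⋀^Fin 2]→L[ℝ] ℝ := Ω.form x
  have up₀ : ∀ v w z : V, Function.update ![v, w] 0 z = ![z, w] := by
    intro v w z
    funext i
    fin_cases i <;> rfl
  have up₁ : ∀ v w z : V, Function.update ![v, w] 1 z = ![v, z] := by
    intro v w z
    funext i
    fin_cases i <;> rfl
  have add₀ : ∀ v v' w : V, β ![v + v', w] = β ![v, w] + β ![v', w] := by
    intro v v' w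
    have h := β.map_update_add ![v, w] 0 v v'
    rwa [up₀, up₀, up₀] at h
  have smul₀ : ∀ (a : ℝ) (v w : V), β ![a • v, w] = a • β ![v, w] := by
    intro a v w
    have h := β.map_update_smul ![v, w] 0 a v
    rwa [up₀, up₀] at h
  have add₁ : ∀ v w w' : V, β ![v, w + w'] = β ![v, w] + β ![v, w'] := by
    intro v w w'
    have h := β.map_update_add ![v, w] 1 w w'
    rwa [up₁, up₁, up₁] at h
  have smul₁ : ∀ (a : ℝ) (v w : V), β ![v, a • w] = a • β ![v, w] := by
    intro a v w
    have h := β.map_update_smul ![v, w] 1 a w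
    rwa [up₁, up₁] at h
  let B : V →ₗ[ℝ] Module.Dual ℝ V :=
    LinearMap.mk₂ ℝ (fun v w => β ![v, w]) add₀ smul₀ add₁ smul₁
  have hinj : Function.Injective B := by
    rw [injective_iff_map_eq_zero]
    intro v hv
    exact Ω.nondegenerate x v (fun w => congrArg (fun g : Module.Dual ℝ V => g w) hv)
  have hsurj : Function.Surjective B :=
    (LinearMap.injective_iff_surjective_of_finrank_eq_finrank
      (Subspace.dual_finrank_eq (K := ℝ) (V := V)).symm).1 hinj
  let l' : V →L[ℝ] ℝ := l
  obtain ⟨v, hv⟩ := hsurj (l' : V →ₗ[ℝ] ℝ)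
  refine ⟨v, fun w => congrArg (fun g : Module.Dual ℝ V => g w) hv, fun v' hv' => hinj ?_⟩
  rw [hv]
  exact LinearMap.ext (fun w => hv' w)

/-- The Hamiltonian vector field `X_f` of `f`, determined by `df = Ω(X_f, ·)`. -/
def SymplecticForm.hamVectorField (Ω : SymplecticForm I M) (f : M → ℝ) (x : M) :
    TangentSpace I x :=
  (Ω.existsUnique_dual x (mfderiv I 𝓘(ℝ, ℝ) f x)).choose

theorem SymplecticForm.form_hamVectorField (Ω : SymplecticForm I M) (f : M → ℝ) (x : M)
    (w : TangentSpace I x) :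
    Ω.form x ![Ω.hamVectorField f x, w] = mfderiv I 𝓘(ℝ, ℝ) f x w :=
  (Ω.existsUnique_dual x (mfderiv I 𝓘(ℝ, ℝ) f x)).choose_spec.1 w

/-- `γ : [0,1] → M` solves Hamilton's equation `γ'(t) = X_{F_t}(γ(t))` of the time-dependent
Hamiltonian `F t x = F_t(x)`, `t ∈ [0,1]`. -/
def SymplecticForm.IsOrbit (Ω : SymplecticForm I M) (F : ℝ → M → ℝ) (γ : ℝ → M) : Prop :=
  ∀ t ∈ Icc (0 : ℝ) 1, HasMFDerivWithinAt 𝓘(ℝ, ℝ) I γ (Icc (0 : ℝ) 1) t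
    ((1 : ℝ →L[ℝ] ℝ).smulRight (Ω.hamVectorField (F t) (γ t)))

/-- `F ↦ φ`: the Hamiltonian flow of `F` is defined up to time `1`, and its time-one map is `φ`. -/
def SymplecticForm.Generates (Ω : SymplecticForm I M) (F : ℝ → M → ℝ) (φ : M → M) : Prop :=
  ∀ x : M, ∃ γ : ℝ → M, γ 0 = x ∧ γ 1 = φ x ∧ Ω.IsOrbit F γ

/-- The closed unit square. -/
def unitSquare : Set (ℝ × ℝ) := Icc (0 : ℝ) 1 ×ˢ Icc (0 : ℝ) 1

/-- `u` is a disc bounding the loop `z : [0,1] → M`, written in polar coordinates: the disc is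
`w(r e^{2πiτ}) = u(r, τ)` for `0 ≤ r, τ ≤ 1`, so that `u` is constant on `r = 0`, takes the same
values at `τ = 0` and `τ = 1`, and equals `z` on `r = 1`. The map is smooth in polar coordinates
(every smooth map from the closed unit disc is), which also allows `z` to have a corner at its
base point, as happens if the Hamiltonian does not extend periodically in time. -/
structure IsBoundingDisc (I : ModelWithCorners ℝ (EuclideanSpace ℝ (Fin (2 * n))) H)
    (u : ℝ × ℝ → M) (z : ℝ → M) : Prop where
  smooth : ContMDiffOn 𝓘(ℝ, ℝ × ℝ) I ∞ u unitSquare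
  center : ∀ τ ∈ Icc (0 : ℝ) 1, u (0, τ) = u (0, 0)
  periodic : ∀ r ∈ Icc (0 : ℝ) 1, u (r, 1) = u (r, 0)
  boundary : ∀ τ ∈ Icc (0 : ℝ) 1, u (1, τ) = z τ

/-- The symplectic area `∫ w^*Ω` of a disc `w(r e^{2πiτ}) = u(r, τ)`. -/
def SymplecticForm.area (Ω : SymplecticForm I M) (u : ℝ × ℝ → M) : ℝ :=
  ∫ p in unitSquare, Ω.form (u p)
    ![mfderivWithin 𝓘(ℝ, ℝ × ℝ) I u unitSquare p ((1, 0) : ℝ × ℝ),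
      mfderivWithin 𝓘(ℝ, ℝ × ℝ) I u unitSquare p ((0, 1) : ℝ × ℝ)]

/-- The action `𝒜_F(z, w) = - ∫ w^*Ω - ∫₀¹ F(t, z(t)) dt`. -/
def SymplecticForm.action (Ω : SymplecticForm I M) (F : ℝ → M → ℝ) (z : ℝ → M)
    (u : ℝ × ℝ → M) : ℝ :=
  - Ω.area u - ∫ t in (0 : ℝ)..1, F t (z t)

/-- The action spectrum `Spec(F)`: all values `𝒜_F(z, w)`, where `z` is a contractible one-periodic
orbit of `F` and `w` is a disc bounding `z`. -/
def SymplecticForm.spec (Ω : SymplecticForm I M) (F : ℝ → M → ℝ) : Set ℝ :=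
  {a | ∃ (z : ℝ → M) (u : ℝ × ℝ → M), Ω.IsOrbit F z ∧ z 0 = z 1 ∧ IsBoundingDisc I u z ∧
    a = Ω.action F z u}

/-- The Liouville measure `Ωⁿ/n!`. In a chart it is the measure with density `√(det (Ω_ij))`
(the absolute value of the Pfaffian) with respect to Lebesgue measure; the measures of the
single charts agree on overlaps, and the Liouville measure is the least measure above them all,
that is, the one which restricts to them. -/
def SymplecticForm.liouville [MeasurableSpace M] (Ω : SymplecticForm I M) : Measure M :=
  ⨆ x₀ : M, (((volume : Measure (EuclideanSpace ℝ (Fin (2 * n)))).restrict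
      (extChartAt I x₀).target).withDensity (fun y => ENNReal.ofReal (Real.sqrt
        (Matrix.of (fun i j : Fin (2 * n) => formInChart I Ω.form x₀ y
          ![EuclideanSpace.single i (1 : ℝ), EuclideanSpace.single j (1 : ℝ)])).det))).map
    (extChartAt I x₀).symm

/-- A closed manifold: compact without boundary. Every other manifold is called open. -/
def IsClosedManifold (I : ModelWithCorners ℝ (EuclideanSpace ℝ (Fin (2 * n))) H)
    (M : Type*) [TopologicalSpace M] [ChartedSpace H M] : Prop :=
  CompactSpace M ∧ I.boundary M = ∅

/-- Normalized Hamiltonians: if `M` is closed, every `F_t` has mean value zero with respect to the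
Liouville measure; if `M` is open (noncompact or with nonempty boundary), `F` has compact support
in the interior of `M`. -/
def SymplecticForm.IsNormalized [MeasurableSpace M] (Ω : SymplecticForm I M)
    (F : ℝ → M → ℝ) : Prop :=
  (IsClosedManifold I M → ∀ t ∈ Icc (0 : ℝ) 1, ∫ x, F t x ∂Ω.liouville = 0) ∧
  (¬ IsClosedManifold I M → ∃ K : Set M, IsCompact K ∧ K ⊆ I.interior M ∧
    ∀ t ∈ Icc (0 : ℝ) 1, ∀ x ∉ K, F t x = 0)

/-- A smooth one-parameter family `{F^s}` of time-dependent Hamiltonians, `F s t x = F^s(x, t)`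
with `s, t ∈ [0,1]`. -/
def IsSmoothFamily (I : ModelWithCorners ℝ (EuclideanSpace ℝ (Fin (2 * n))) H)
    (F : ℝ → ℝ → M → ℝ) : Prop :=
  ContMDiffOn (𝓘(ℝ, ℝ × ℝ).prod I) 𝓘(ℝ, ℝ) ∞
    (fun p : (ℝ × ℝ) × M => F p.1.1 p.1.2 p.2) (unitSquare ×ˢ univ)

end

end HamiltonianSpectrum

end

open Set MeasureTheory
open scoped Manifold ContDiff Topology

set_option maxSynthPendingDepth 3

/-! The union of all the spectra `Ω.spec (F s)`, `s ∈ [0,1]`, is a Lebesgue null set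
(`volume_iUnion_spec_eq_zero`). The image of `c` is an interval contained in it, so it is a point.

To see that the union is null, fix a parameter `s₀` and a disc `u₀` bounding a periodic orbit that
starts at an interior point `x₀`. Compare its action with that of nearby pairs `(s, u)`. By Stokes
the difference of areas is an integral over the boundary orbits only, so the action is a function of
`s` and of the initial point. Let `y` be the initial point in the chart at `x₀`. The relative action
of the orbit from `y`, closed or not, is smooth in `(s, y)`. Its differential is the first variation
formula `variation`: a primitive of the symplectic form at the initial point, minus the pull-back of
a primitive at the end point, minus `ds` times the integral of `∂_s H` along the orbit
(`hasFDerivAt_relAction`).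

Symmetry of the second derivative of the relative action is used twice. For fixed `s` it says that
the flow is symplectic (`bilinChart_flow_center`). For end time `1` the time-one map does not depend
on `s`, so the mixed derivative shows that the integral of `∂_s H` along orbits, `orbitDot`, is
locally constant in the initial point (`eventually_orbitDot_eq`). As `M` is connected it is
constant, and normalization makes it zero. On a closed manifold its mean vanishes, by Liouville's
theorem and differentiation of `∫ H_t = 0` in `s`. With nonempty boundary it vanishes at boundary
points. On a noncompact manifold without boundary it vanishes outside the supports, where Baire's
theorem supplies a locally common compact support for a dense set of parameters.

Therefore the relative action does not depend on `s` near `s₀`. After adding a term that vanishes at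
the fixed points of the time-one map, it becomes a smooth function `g` of `y` alone which is
critical at each of these fixed points and takes there the actions of the nearby discs. Sard's
theorem for real-valued functions makes the set of these actions null (`exists_null_of_interior`).
Orbits that start outside the interior are constant and nearby ones have equal action
(`exists_null_of_boundary`). The space of pairs `(s, u)` with the uniform topology on discs is
second countable, so countably many such neighbourhoods suffice (`volume_discAction_eq_zero`). -/

/-! ### Sard's theorem for real-valued functions. -/

theorem norm_sub_le_of_iteratedFDeriv_eq_zero {E : Type} [NormedAddCommGroup E] [NormedSpace ℝ E]
    (k : ℕ) : ∀ {F : Type} [NormedAddCommGroup F] [NormedSpace ℝ F] {f : E → F} {B : Set E} {K : ℝ}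
    (_ : IsOpen B) (_ : Convex ℝ B) (_ : ContDiffOn ℝ (k + 1 : ℕ) f B)
    (_ : ∀ y ∈ B, ‖iteratedFDeriv ℝ (k + 1) f y‖ ≤ K) {x : E} (_ : x ∈ B)
    (_ : ∀ j, 1 ≤ j → j ≤ k → iteratedFDeriv ℝ j f x = 0) {y : E} (_ : y ∈ B),
    ‖f y - f x‖ ≤ K * ‖y - x‖ ^ (k + 1) := by
  induction k with
  | zero =>
    intro F _ _ f B K hB hc hf hK x hx _ y hy
    have h := hc.norm_image_sub_le_of_norm_hasFDerivWithin_le (f := f) (f' := fderiv ℝ f) (C := K)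
      (fun z hz => ((hf.contDiffAt (hB.mem_nhds hz)).differentiableAt
        (by simp)).hasFDerivAt.hasFDerivWithinAt)
      (fun z hz => by simpa [norm_iteratedFDeriv_one] using hK z hz) hx hy
    simpa using h
  | succ k ih =>
    intro F _ _ f B K hB hc hf hK x hx hv y hy
    have hseg : segment ℝ x y ⊆ B := hc.segment_subset hx hy
    have hd : ∀ z ∈ B, DifferentiableAt ℝ f z := fun z hz =>
      (hf.contDiffAt (hB.mem_nhds hz)).differentiableAt (by simp)
    have hx0 : fderiv ℝ f x = 0 := by
      have := hv 1 le_rfl (by omega)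
      rw [← norm_eq_zero, norm_iteratedFDeriv_one, norm_eq_zero] at this
      exact this
    -- The induction hypothesis for `fderiv ℝ f` gives the power `k + 1`; the mean value inequality
    -- on the segment gains one more. The target space varies in the induction because the
    -- derivative takes values in another space.
    have key : ∀ z ∈ B, ‖fderiv ℝ f z‖ ≤ K * ‖z - x‖ ^ (k + 1) := by
      intro z hz
      have := ih (f := fderiv ℝ f) (K := K) hB hc
        (hf.fderiv_of_isOpen hB (by norm_cast)) (fun w hw => by
          rw [norm_iteratedFDeriv_fderiv]; exact hK w hw) hx (fun j h1 h2 => by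
          rw [← norm_eq_zero, norm_iteratedFDeriv_fderiv, norm_eq_zero]
          exact hv _ (by omega) (by omega)) hz
      simpa [hx0] using this
    have hK0 : 0 ≤ K := (norm_nonneg _).trans (hK x hx)
    have h := (convex_segment x y).norm_image_sub_le_of_norm_hasFDerivWithin_le (f := f)
      (f' := fderiv ℝ f) (C := K * ‖y - x‖ ^ (k + 1))
      (fun z hz => (hd z (hseg hz)).hasFDerivAt.hasFDerivWithinAt)
      (fun z hz => (key z (hseg hz)).trans (by
        gcongr
        exact norm_sub_le_of_mem_segment hz)) (left_mem_segment ℝ x y) (right_mem_segment ℝ x y)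
    calc _ ≤ _ := h
      _ = _ := by ring

/-- By the Lindelöf property countably many of the neighbourhoods cover `A`. The domain is a general
second countable space: besides the normed spaces of Sard's theorem it will be the space of all
discs. -/
theorem volume_image_eq_zero_of_locally {E : Type*} [TopologicalSpace E] [SecondCountableTopology E]
    {f : E → ℝ} {A : Set E} (h : ∀ x ∈ A, ∃ u ∈ 𝓝[A] x, volume (f '' (u ∩ A)) = 0) :
    volume (f '' A) = 0 := by
  choose! u hu hv using h
  obtain ⟨t, hts, htc, hcov⟩ := TopologicalSpace.countable_cover_nhdsWithin hu
  refine measure_mono_null (t := ⋃ x ∈ t, f '' (u x ∩ A)) ?_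
    ((measure_biUnion_null_iff htc).2 fun x hx => hv x (hts hx))
  rintro _ ⟨x, hx, rfl⟩
  obtain ⟨y, hy, hxy⟩ := mem_iUnion₂.1 (hcov hx)
  exact mem_iUnion₂.2 ⟨y, hy, x, ⟨hxy, hx⟩, rfl⟩

/-- By Taylor's estimate `f` is locally Hölder of exponent `dim E + 1` on this set. The Hausdorff
measure of dimension `dim E + 1` vanishes on `E`, so the image has one-dimensional Hausdorff measure
zero, and that is Lebesgue measure. -/
theorem volume_image_eq_zero_of_iteratedFDeriv {E : Type} [NormedAddCommGroup E] [NormedSpace ℝ E]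
    [FiniteDimensional ℝ E] {f : E → ℝ} {U : Set E} (hU : IsOpen U) (hf : ContDiffOn ℝ ∞ f U) :
    volume (f '' {x ∈ U | ∀ j, 1 ≤ j → j ≤ Module.finrank ℝ E → iteratedFDeriv ℝ j f x = 0}) = 0 := by
  borelize E
  have : ProperSpace E := FiniteDimensional.proper ℝ E
  set d := Module.finrank ℝ E
  refine volume_image_eq_zero_of_locally fun x hx => ?_
  have hc : ContinuousAt (fun y => ‖iteratedFDeriv ℝ (d + 1) f y‖) x := by
    have := (hf.contDiffAt (hU.mem_nhds hx.1)).iteratedFDeriv_right (m := 0) (i := d + 1)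
      (by simp only [zero_add]; exact_mod_cast le_top)
    exact this.continuousAt.norm
  have hev : ∀ᶠ y in 𝓝 x, ‖iteratedFDeriv ℝ (d + 1) f y‖ < ‖iteratedFDeriv ℝ (d + 1) f x‖ + 1 ∧ y ∈ U :=
    (hc.eventually (gt_mem_nhds (lt_add_one _))).and (hU.mem_nhds hx.1)
  obtain ⟨r, hr, hball⟩ := Metric.eventually_nhds_iff_ball.1 hev
  refine ⟨Metric.ball x r, mem_nhdsWithin_of_mem_nhds (Metric.ball_mem_nhds x hr), ?_⟩
  set A := {x ∈ U | ∀ j, 1 ≤ j → j ≤ d → iteratedFDeriv ℝ j f x = 0}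
  set K : NNReal := ⟨‖iteratedFDeriv ℝ (d + 1) f x‖ + 1, by positivity⟩
  have hh : HolderOnWith K ((d + 1 : ℕ) : NNReal) f (Metric.ball x r ∩ A) := by
    intro y hy z hz
    have h := norm_sub_le_of_iteratedFDeriv_eq_zero d (K := (K : ℝ)) (f := f) Metric.isOpen_ball
      (convex_ball x r) ((hf.mono fun w hw => (hball w hw).2).of_le (by exact_mod_cast le_top))
      (fun w hw => (hball w hw).1.le) hz.1 hz.2.2 hy.1
    rw [edist_dist, edist_dist, dist_eq_norm, dist_eq_norm]
    rw [NNReal.coe_natCast, ENNReal.rpow_natCast, ← ENNReal.ofReal_pow (norm_nonneg _),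
      ← ENNReal.ofReal_coe_nnreal, ← ENNReal.ofReal_mul K.coe_nonneg]
    exact ENNReal.ofReal_le_ofReal h
  have h0 : Measure.hausdorffMeasure (((d + 1 : ℕ) : NNReal) : ℝ) (Metric.ball x r ∩ A) = 0 := by
    refine hausdorffMeasure_of_dimH_lt (lt_of_le_of_lt (dimH_mono (subset_univ _)) ?_)
    rw [Real.dimH_univ_eq_finrank E]
    exact_mod_cast Nat.lt_succ_self d
  have h1 := hh.hausdorffMeasure_image_le (by positivity) (d := 1) zero_le_one
  rw [mul_one, h0, mul_zero, hausdorffMeasure_real] at h1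
  exact le_antisymm h1 bot_le

/-- Near `x` the zero set of `w` is a hypersurface parametrized by the kernel of the differential of
`w` at `x`. A critical point of `f` on it is critical for the restriction of `f`, so Sard's theorem
in one dimension less applies. -/
theorem exists_nhds_volume_image_eq_zero {E : Type} [NormedAddCommGroup E] [NormedSpace ℝ E]
    [FiniteDimensional ℝ E]
    (ih : ∀ (W : Submodule ℝ E), Module.finrank ℝ W + 1 = Module.finrank ℝ E →
      ∀ (V : Set W) (g : W → ℝ), IsOpen V → ContDiffOn ℝ ∞ g V →
      volume (g '' {x ∈ V | fderiv ℝ g x = 0}) = 0)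
    {f w : E → ℝ} {U : Set E} (hU : IsOpen U) (hf : ContDiffOn ℝ ∞ f U) (hw : ContDiffOn ℝ ∞ w U)
    {x : E} (hx : x ∈ U) (hwx : fderiv ℝ w x ≠ 0) :
    ∃ u ∈ 𝓝 x, volume (f '' {y ∈ u | w y = 0 ∧ fderiv ℝ f y = 0}) = 0 := by
  have : CompleteSpace E := FiniteDimensional.complete ℝ E
  set l := fderiv ℝ w x
  obtain ⟨v, hv⟩ : ∃ v, l v = 1 := by
    obtain ⟨v, hv⟩ : ∃ v, l v ≠ 0 := by
      by_contra! h
      exact hwx (ContinuousLinearMap.ext h)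
    exact ⟨(l v)⁻¹ • v, by simp [hv]⟩
  set r : ℝ →L[ℝ] E := (1 : ℝ →L[ℝ] ℝ).smulRight v
  have hr : Function.RightInverse r l := fun a => by simp [r, hv]
  set eq := ContinuousLinearEquiv.equivOfRightInverse l r hr
  set P := l.projKerOfRightInverse r hr
  -- These coordinates straighten the zero set of `w` to `{0} × l.ker`.
  set Θ : E → ℝ × l.ker := fun y => (w y, P y)
  have hΘ : ∀ y ∈ U, ContDiffAt ℝ ∞ Θ y := fun y hy =>
    (hw.contDiffAt (hU.mem_nhds hy)).prodMk P.contDiff.contDiffAt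
  have hd : HasFDerivAt Θ (eq : E →L[ℝ] ℝ × l.ker) x := by
    have h1 : HasFDerivAt w l x :=
      ((hw.contDiffAt (hU.mem_nhds hx)).differentiableAt (by simp)).hasFDerivAt
    exact h1.prodMk P.hasFDerivAt
  set e := (hΘ x hx).toOpenPartialHomeomorph Θ hd (by simp)
  have he : ∀ y, e y = Θ y := fun y => rfl
  have hxs : x ∈ e.source := (hΘ x hx).mem_toOpenPartialHomeomorph_source hd (by simp)
  have hev : ∀ᶠ y in 𝓝 x, (y ∈ U ∧ y ∈ e.source) ∧
      fderiv ℝ Θ y ∈ range ((↑) : (E ≃L[ℝ] ℝ × l.ker) → (E →L[ℝ] ℝ × l.ker)) := by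
    refine (Filter.Eventually.and (hU.mem_nhds hx) (e.open_source.mem_nhds hxs)).and ?_
    have hcont : ContinuousAt (fderiv ℝ Θ) x :=
      ((hΘ x hx).fderiv_right (m := 0) (by simp)).continuousAt
    refine hcont.eventually_mem ?_
    rw [hd.fderiv]
    exact eq.nhds
  obtain ⟨V, hVs, hVo, hxV⟩ := eventually_nhds_iff.1 hev
  set ι : l.ker →L[ℝ] ℝ × l.ker := ContinuousLinearMap.inr ℝ ℝ l.ker
  set V2 : Set l.ker := ι ⁻¹' (e.target ∩ e.symm ⁻¹' V)
  have hV2 : IsOpen V2 := (e.isOpen_inter_preimage_symm hVo).preimage ι.continuous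
  -- Smoothness of the inverse is needed at every point near `x` and not only at `Θ x`; this is why
  -- `V` was shrunk until the derivative of `Θ` is invertible on all of it.
  have hsymm : ∀ k ∈ V2, ContDiffAt ℝ ∞ e.symm (ι k) := by
    intro k hk
    obtain ⟨⟨h1, -⟩, e', he'⟩ := hVs _ hk.2
    refine e.contDiffAt_symm hk.1 (f₀' := e') ?_ (hΘ _ h1)
    rw [he']
    exact ((hΘ _ h1).differentiableAt (by simp)).hasFDerivAt
  set g : l.ker → ℝ := fun k => f (e.symm (ι k))
  have hg1 : ∀ k ∈ V2, ContDiffAt ℝ ∞ (fun k => e.symm (ι k)) k := fun k hk =>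
    (hsymm k hk).comp k ι.contDiff.contDiffAt
  have hfk : ∀ k ∈ V2, ContDiffAt ℝ ∞ f (e.symm (ι k)) := fun k hk =>
    hf.contDiffAt (hU.mem_nhds (hVs _ hk.2).1.1)
  have hg : ContDiffOn ℝ ∞ g V2 := fun k hk =>
    ((hfk k hk).comp k (hg1 k hk)).contDiffWithinAt
  have hrank : Module.finrank ℝ l.ker + 1 = Module.finrank ℝ E := by
    have := eq.toLinearEquiv.finrank_eq
    rw [Module.finrank_prod, Module.finrank_self] at this
    omega
  refine ⟨V, hVo.mem_nhds hxV, measure_mono_null ?_ (ih l.ker hrank V2 g hV2 hg)⟩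
  rintro _ ⟨y, ⟨hyV, hwy, hfy⟩, rfl⟩
  have hys := (hVs y hyV).1.2
  have h1 : ι (P y) = e y := by rw [he]; simp [Θ, ι, hwy]
  have h2 : e.symm (ι (P y)) = y := by rw [h1, e.left_inv hys]
  have h3 : P y ∈ V2 := ⟨by rw [h1]; exact e.map_source hys, by
    show e.symm (ι (P y)) ∈ V
    rw [h2]; exact hyV⟩
  refine ⟨P y, ⟨h3, ?_⟩, by simp only [g, h2]⟩
  have := fderiv_comp (P y) ((hfk _ h3).differentiableAt (by simp))
    ((hg1 _ h3).differentiableAt (by simp))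
  rw [h2, hfy, ContinuousLinearMap.zero_comp] at this
  exact this

/-- **Sard's theorem** for smooth real-valued functions: the set of critical values is null. -/
theorem volume_image_critical_eq_zero (d : ℕ) : ∀ {E : Type} [NormedAddCommGroup E]
    [NormedSpace ℝ E] [FiniteDimensional ℝ E], Module.finrank ℝ E = d →
    ∀ (U : Set E) (f : E → ℝ), IsOpen U → ContDiffOn ℝ ∞ f U →
    volume (f '' {x ∈ U | fderiv ℝ f x = 0}) = 0 := by
  induction d with
  | zero =>
    intro E _ _ _ hE U f hU hf
    have := Module.finrank_zero_iff.1 hE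
    exact ((subsingleton_of_subsingleton (s := {x ∈ U | fderiv ℝ f x = 0})).image f).measure_zero _
  | succ d ih =>
    intro E _ _ _ hE U f hU hf
    have ih' : ∀ (W : Submodule ℝ E), Module.finrank ℝ W + 1 = Module.finrank ℝ E →
        ∀ (V : Set W) (g : W → ℝ), IsOpen V → ContDiffOn ℝ ∞ g V →
        volume (g '' {x ∈ V | fderiv ℝ g x = 0}) = 0 := by
      intro W hW
      have h : Module.finrank ℝ W = d := by omega
      exact ih h
    -- A critical point either has vanishing derivatives up to order `dim E`, or there is an order
    -- `k ≥ 1` whose derivative vanishes while that of order `k + 1` does not. In the second case a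
    -- component of the `k`-th derivative is a defining function of a hypersurface through the
    -- point.
    set B : ℕ → Set E := fun k => {x ∈ U | fderiv ℝ f x = 0 ∧ 1 ≤ k ∧ iteratedFDeriv ℝ k f x = 0 ∧
      iteratedFDeriv ℝ (k + 1) f x ≠ 0}
    have hB : ∀ k, volume (f '' B k) = 0 := by
      intro k
      refine volume_image_eq_zero_of_locally fun x hx => ?_
      obtain ⟨hxU, hx1, hk, hx2, hx3⟩ := hx
      obtain ⟨m, hm⟩ : ∃ m, iteratedFDeriv ℝ (k + 1) f x m ≠ 0 := by
        by_contra! h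
        exact hx3 (ContinuousMultilinearMap.ext h)
      have hD : ∀ y ∈ U, ContDiffAt ℝ ∞ (iteratedFDeriv ℝ k f) y := fun y hy =>
        (hf.contDiffAt (hU.mem_nhds hy)).iteratedFDeriv_right (by exact_mod_cast le_top)
      -- The component is evaluation at the last `k` vectors of `m`; differentiating it in the
      -- direction `m 0` gives the nonzero number in `hm`.
      set ev := ContinuousMultilinearMap.apply ℝ (fun _ : Fin k => E) ℝ (Fin.tail m)
      set w : E → ℝ := fun y => ev (iteratedFDeriv ℝ k f y)
      have hw : ContDiffOn ℝ ∞ w U := fun y hy =>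
        (ev.contDiff.contDiffAt.comp y (hD y hy)).contDiffWithinAt
      have hwx : fderiv ℝ w x ≠ 0 := by
        intro h
        apply hm
        rw [iteratedFDeriv_succ_apply_left]
        have h2 : DifferentiableAt ℝ (iteratedFDeriv ℝ k f) x :=
          (hD x hxU).differentiableAt (by simp)
        have h1 : fderiv ℝ w x = ev.comp (fderiv ℝ (iteratedFDeriv ℝ k f) x) :=
          (ev.hasFDerivAt.comp x h2.hasFDerivAt).fderiv
        have h3 := DFunLike.congr_fun h1 (m 0)
        rw [h] at h3
        exact h3.symm
      obtain ⟨u, hu, hu0⟩ := exists_nhds_volume_image_eq_zero ih' hU hf hw hxU hwx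
      refine ⟨u, mem_nhdsWithin_of_mem_nhds hu, measure_mono_null (image_mono ?_) hu0⟩
      rintro y ⟨hyu, hyU, hy1, -, hy2, -⟩
      refine ⟨hyu, ?_, hy1⟩
      simp [w, hy2]
    refine measure_mono_null ?_ (measure_union_null
      (volume_image_eq_zero_of_iteratedFDeriv hU hf) (measure_iUnion_null hB))
    rw [← image_iUnion, ← image_union]
    refine image_mono ?_
    rintro x ⟨hxU, hx⟩
    by_cases h : ∃ j, 1 ≤ j ∧ iteratedFDeriv ℝ j f x ≠ 0
    · classical
      right
      obtain ⟨h1, h2⟩ := Nat.find_spec h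
      have h3 : iteratedFDeriv ℝ 1 f x = 0 := by
        rw [← norm_eq_zero, norm_iteratedFDeriv_one, hx, norm_zero]
      have h4 : Nat.find h ≠ 1 := fun h5 => h2 (by rw [h5]; exact h3)
      obtain ⟨k, hk⟩ : ∃ k, Nat.find h = k + 1 := ⟨Nat.find h - 1, by omega⟩
      have h6 := Nat.find_min h (m := k) (by omega)
      push Not at h6
      exact mem_iUnion.2 ⟨k, hxU, hx, by omega, h6 (by omega), hk ▸ h2⟩
    · push Not at h
      exact Or.inl ⟨hxU, fun j hj _ => h j hj⟩

/-! ### Local flows and their smooth dependence, by the implicit function theorem. -/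

/-- The continuous linear maps given by pointwise application of a continuous family of linear
maps to a continuous function. -/
noncomputable def ContinuousMap.applyL (J : Type) [TopologicalSpace J] [CompactSpace J] (E F : Type)
    [NormedAddCommGroup E] [NormedSpace ℝ E] [NormedAddCommGroup F] [NormedSpace ℝ F] :
    C(J, E →L[ℝ] F) →L[ℝ] C(J, E) →L[ℝ] C(J, F) :=
  LinearMap.mkContinuous₂
    (LinearMap.mk₂ ℝ (fun (A : C(J, E →L[ℝ] F)) (h : C(J, E)) =>
      (⟨fun t => A t (h t), by fun_prop⟩ : C(J, F)))
      (fun _ _ _ => by ext; simp) (fun _ _ _ => by ext; simp) (fun _ _ _ => by ext; simp)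
      (fun _ _ _ => by ext; simp)) 1 (fun A h => by
    rw [one_mul, ContinuousMap.norm_le _ (by positivity)]
    intro t
    exact (A t).le_of_opNorm_le_of_le (A.norm_coe_le_norm t) (h.norm_coe_le_norm t))

/-- The estimate must be uniform in `t`. It follows from continuity of `β ↦ f' ∘ β` in the supremum
norm, because `α t + θ • h t` is the value at `t` of the nearby function `α + θ • h`. -/
theorem ContinuousMap.hasFDerivAt_postcomp {J : Type} [TopologicalSpace J] [CompactSpace J]
    {E F : Type} [NormedAddCommGroup E] [NormedSpace ℝ E] [NormedAddCommGroup F] [NormedSpace ℝ F]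
    (f : C(E, F)) (f' : C(E, E →L[ℝ] F)) (hf : ∀ x, HasFDerivAt f (f' x) x) (α : C(J, E)) :
    HasFDerivAt (fun β : C(J, E) => f.comp β) (ContinuousMap.applyL J E F (f'.comp α)) α := by
  rw [hasFDerivAt_iff_isLittleO_nhds_zero, Asymptotics.isLittleO_iff]
  intro ε hε
  have hc : ContinuousAt (fun β : C(J, E) => f'.comp β) α :=
    (ContinuousMap.continuous_postcomp f').continuousAt
  have hb : Metric.ball (f'.comp α) ε ∈ 𝓝 (f'.comp α) := Metric.ball_mem_nhds (f'.comp α) hε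
  have hev : ∀ᶠ β in 𝓝 α, f'.comp β ∈ Metric.ball (f'.comp α) ε := hc hb
  obtain ⟨δ, hδ, hd⟩ := Metric.eventually_nhds_iff.1 hev
  filter_upwards [Metric.ball_mem_nhds (0 : C(J, E)) hδ] with h hh
  rw [ContinuousMap.norm_le _ (by positivity)]
  intro t
  have hseg : ∀ z ∈ segment ℝ (α t) (α t + h t), ‖f' z - f' (α t)‖ ≤ ε := by
    intro z hz
    rw [segment_eq_image'] at hz
    obtain ⟨θ, hθ, rfl⟩ := hz
    have h1 : dist (α + θ • h) α < δ := by
      rw [dist_eq_norm, add_sub_cancel_left, norm_smul, Real.norm_of_nonneg hθ.1]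
      have : ‖h‖ < δ := by simpa using hh
      exact lt_of_le_of_lt (mul_le_of_le_one_left (norm_nonneg _) hθ.2) this
    have h2 := (ContinuousMap.dist_apply_le_dist (f := f'.comp (α + θ • h)) (g := f'.comp α) t).trans
      (hd h1 : dist _ _ < ε).le
    rw [dist_eq_norm] at h2
    simpa using h2
  have := (convex_segment (α t) (α t + h t)).norm_image_sub_le_of_norm_hasFDerivWithin_le'
    (fun z _ => (hf z).hasFDerivWithinAt) hseg (left_mem_segment ℝ _ _) (right_mem_segment ℝ _ _)
  simp only [add_sub_cancel_left] at this
  exact this.trans (by gcongr; exact h.norm_coe_le_norm t)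

theorem ContinuousMap.contDiff_postcomp_nat (J : Type) [TopologicalSpace J] [CompactSpace J]
    {E : Type} [NormedAddCommGroup E] [NormedSpace ℝ E] (n : ℕ) :
    ∀ {F : Type} [NormedAddCommGroup F] [NormedSpace ℝ F] (f : C(E, F)), ContDiff ℝ n f →
      ContDiff ℝ n (fun β : C(J, E) => f.comp β) := by
  induction n with
  | zero =>
    intro F _ _ f _
    exact contDiff_zero.2 (ContinuousMap.continuous_postcomp f)
  | succ n ih =>
    intro F _ _ f hf
    have hf' : ContDiff ℝ n (fderiv ℝ f) := hf.fderiv_right (by norm_cast)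
    have hd : ∀ x, HasFDerivAt f (fderiv ℝ f x) x := fun x =>
      (hf.differentiable (by simp) x).hasFDerivAt
    push_cast
    rw [contDiff_succ_iff_hasFDerivAt]
    have h1 : ContDiff ℝ n (ContinuousMap.applyL J E F) :=
      ContinuousLinearMap.contDiff (𝕜 := ℝ) (E := C(J, E →L[ℝ] F)) (F := C(J, E) →L[ℝ] C(J, F))
        (ContinuousMap.applyL J E F)
    have h2 := h1.comp (ih ⟨_, hf'.continuous⟩ hf')
    exact ⟨fun β => ContinuousMap.applyL J E F (ContinuousMap.comp ⟨_, hf'.continuous⟩ β), h2,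
      fun α => ContinuousMap.hasFDerivAt_postcomp f ⟨_, hf'.continuous⟩ hd α⟩

/-- Integration from the left end point, on continuous functions on the unit interval. -/
noncomputable def unitIntegralL (E : Type) [NormedAddCommGroup E] [NormedSpace ℝ E] [CompleteSpace E] :
    C(Icc (0 : ℝ) 1, E) →L[ℝ] C(Icc (0 : ℝ) 1, E) :=
  LinearMap.mkContinuous
    { toFun := fun α => ⟨fun t => ∫ σ in (0 : ℝ)..t, α (projIcc 0 1 zero_le_one σ), by
        have h : Continuous fun t : ℝ => ∫ σ in (0 : ℝ)..t, α (projIcc 0 1 zero_le_one σ) :=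
          intervalIntegral.continuous_primitive (fun a b =>
            (α.continuous.comp continuous_projIcc).intervalIntegrable a b) 0
        exact h.comp continuous_subtype_val⟩
      map_add' := fun α β => by
        ext t
        exact intervalIntegral.integral_add
          ((α.continuous.comp continuous_projIcc).intervalIntegrable _ _)
          ((β.continuous.comp continuous_projIcc).intervalIntegrable _ _)
      map_smul' := fun c α => by
        ext t
        exact intervalIntegral.integral_smul c _ } 1 (fun α => by
    rw [one_mul, ContinuousMap.norm_le _ (norm_nonneg _)]
    intro t
    have := intervalIntegral.norm_integral_le_of_norm_le_const (a := 0) (b := (t : ℝ))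
      (f := fun σ => α (projIcc 0 1 zero_le_one σ)) (C := ‖α‖) (fun σ _ => α.norm_coe_le_norm _)
    refine this.trans ?_
    rw [sub_zero, abs_of_nonneg t.2.1]
    exact mul_le_of_le_one_right (norm_nonneg _) t.2.2)

/-- The local flow of a smooth vector field exists and depends smoothly on the initial value and
on time; the integral curves are parametrized by the unit interval, with speed `p.2`. -/
theorem exists_contDiffAt_localFlow {E : Type} [NormedAddCommGroup E] [NormedSpace ℝ E]
    [CompleteSpace E] (f : E → E) (hf : ContDiff ℝ ∞ f) (q : E) {B : Set E} (hB : B ∈ 𝓝 q)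
    {n : ℕ} :
    ∃ γ : E × ℝ → ℝ → E, ∀ᶠ p in 𝓝 (q, (0 : ℝ)), ContDiffAt ℝ n (fun p => γ p 1) p ∧
      γ p 0 = p.1 ∧ ∀ t ∈ Icc (0 : ℝ) 1, γ p t ∈ B ∧
        HasDerivWithinAt (γ p) (p.2 • f (γ p t)) (Icc 0 1) t := by
  -- One order more than required, since the implicit function theorem needs a nonzero order and `n`
  -- may be `0`.
  set N : WithTop ℕ∞ := ((n + 1 : ℕ) : WithTop ℕ∞)
  set J := Icc (0 : ℝ) 1
  set fc : C(E, E) := ⟨f, hf.continuous⟩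
  set cst : E →L[ℝ] C(J, E) := ContinuousLinearMap.const ℝ J
  -- The zeros of `G` are the solutions of the integral equation `β(t) = p + τ ∫₀ᵗ f(β)`. At speed
  -- `τ = 0` the derivative in `β` is the identity, so the solution is a smooth function of `(p,
  -- τ)`. With the speed as a variable all curves live on the same interval.
  set G : (E × ℝ) × C(J, E) → C(J, E) := fun v =>
    v.2 - cst v.1.1 - v.1.2 • unitIntegralL E (fc.comp v.2)
  set u : (E × ℝ) × C(J, E) := ((q, 0), cst q)
  have hN : ContDiff ℝ N (fun β : C(J, E) => fc.comp β) :=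
    ContinuousMap.contDiff_postcomp_nat J (n + 1) fc (hf.of_le (by exact_mod_cast le_top))
  have hG : ContDiff ℝ N G := by
    refine (contDiff_snd.sub (cst.contDiff.comp (contDiff_fst.comp contDiff_fst))).sub
      ((contDiff_snd.comp contDiff_fst).smul ?_)
    exact (unitIntegralL E).contDiff.comp (hN.comp contDiff_snd)
  have hGu : G u = 0 := by simp [G, u]
  have hinv : (fderiv ℝ G u ∘L .inr ℝ (E × ℝ) C(J, E)) = ContinuousLinearMap.id ℝ _ := by
    have h1 : HasFDerivAt (fun a : C(J, E) => G ((q, 0), a))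
        (fderiv ℝ G u ∘L .inr ℝ (E × ℝ) C(J, E)) (cst q) := by
      have := ((hG.differentiable (by simp [N])) u).hasFDerivAt
      exact this.comp (cst q) (hasFDerivAt_prodMk_right (q, (0 : ℝ)) (cst q))
    have h2 : (fun a : C(J, E) => G ((q, 0), a)) = fun a => a - cst q := by
      ext a; simp [G]
    rw [h2] at h1
    exact h1.unique ((hasFDerivAt_id _).sub_const _)
  have if₂ : (fderiv ℝ G u ∘L .inr ℝ (E × ℝ) C(J, E)).IsInvertible := by
    rw [hinv]; exact ⟨ContinuousLinearEquiv.refl ℝ _, rfl⟩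
  have hN0 : N ≠ 0 := by simp [N]
  set ψ := hG.contDiffAt.implicitFunction hN0 if₂
  have h0 : ψ (q, 0) = cst q := ContDiffAt.implicitFunction_apply_self hG.contDiffAt hN0 if₂
  have hψ : ContDiffAt ℝ N ψ (q, 0) := ContDiffAt.contDiffAt_implicitFunction hG.contDiffAt hN0 if₂
  have hsol : ∀ᶠ p in 𝓝 (q, (0 : ℝ)), G (p, ψ p) = G u :=
    ContDiffAt.eventually_apply_implicitFunction hG.contDiffAt hN0 if₂
  obtain ⟨ε, hε, hball⟩ := Metric.mem_nhds_iff.1 hB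
  refine ⟨fun p t => ψ p (projIcc 0 1 zero_le_one t), ?_⟩
  filter_upwards [hsol, hψ.eventually (by simp [N]),
    hψ.continuousAt.eventually_mem (Metric.ball_mem_nhds _ hε)] with p hp1 hp2 hp3
  rw [hGu] at hp1
  have heq : ∀ t : J, ψ p t = p.1 + p.2 • ∫ σ in (0 : ℝ)..t,
      f (ψ p (projIcc 0 1 zero_le_one σ)) := by
    intro t
    have h1 := DFunLike.congr_fun hp1 t
    simp only [G, ContinuousMap.sub_apply, ContinuousMap.smul_apply,
      ContinuousMap.zero_apply] at h1
    have h2 : cst p.1 t = p.1 := rfl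
    rw [h2, sub_sub, sub_eq_zero] at h1
    exact h1
  refine ⟨?_, ?_, fun t ht => ⟨?_, ?_⟩⟩
  · have : ContDiffAt ℝ n ψ p := hp2.of_le (by simp [N])
    exact (ContinuousMap.evalCLM ℝ (projIcc (0 : ℝ) 1 zero_le_one 1)).contDiff.contDiffAt.comp p this
  · have := heq (projIcc 0 1 zero_le_one 0)
    simpa using this
  · apply hball
    rw [h0] at hp3
    exact lt_of_le_of_lt (ContinuousMap.dist_apply_le_dist (f := ψ p) (g := cst q) _) hp3
  · have hcont : Continuous fun σ : ℝ => f (ψ p (projIcc 0 1 zero_le_one σ)) :=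
      hf.continuous.comp ((ψ p).continuous.comp continuous_projIcc)
    have h1 : HasDerivAt (fun t : ℝ => p.1 + p.2 • ∫ σ in (0 : ℝ)..t,
        f (ψ p (projIcc 0 1 zero_le_one σ))) (p.2 • f (ψ p (projIcc 0 1 zero_le_one t))) t :=
      ((intervalIntegral.integral_hasDerivAt_right (hcont.intervalIntegrable _ _)
        (hcont.stronglyMeasurableAtFilter _ _) hcont.continuousAt).const_smul p.2).const_add p.1
    refine h1.hasDerivWithinAt.congr (fun s hs => ?_) ?_
    · rw [heq, projIcc_of_mem zero_le_one hs]
    · rw [heq, projIcc_of_mem zero_le_one ht]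

/-! ### Integrals depending on a parameter in a convex set. -/

section ParametricIntegral

variable {E : Type} [NormedAddCommGroup E] [NormedSpace ℝ E]

theorem continuousOn_integral_Icc_zero_one {X F : Type} [TopologicalSpace X] [NormedAddCommGroup F]
    [NormedSpace ℝ F] {D : Set X} {Φ : ℝ → X → F}
    (hΦ : ContinuousOn (Function.uncurry Φ) (Icc (0 : ℝ) 1 ×ˢ D)) :
    ContinuousOn (fun y => ∫ θ in (0 : ℝ)..1, Φ θ y) D := by
  intro y hy
  have hΦ' : ContinuousOn (Function.uncurry fun y θ => Φ θ y) (D ×ˢ Icc (0 : ℝ) 1) :=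
    hΦ.comp continuous_swap.continuousOn fun p hp => ⟨hp.2, hp.1⟩
  have hint : ∀ z ∈ D, IntervalIntegrable (fun θ => Φ θ z) volume 0 1 := fun z hz =>
    ContinuousOn.intervalIntegrable (by
      rw [uIcc_of_le zero_le_one]
      exact hΦ.comp (f := fun θ : ℝ => (θ, z)) (by fun_prop) fun θ hθ => ⟨hθ, hz⟩)
  rw [ContinuousWithinAt, Metric.tendsto_nhds]
  intro ε hε
  obtain ⟨v, hv, h⟩ := isCompact_Icc.mem_uniformity_of_prod hΦ' hy
    (Metric.dist_mem_uniformity (half_pos hε))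
  filter_upwards [hv, self_mem_nhdsWithin] with z hz hzD
  rw [dist_eq_norm, ← intervalIntegral.integral_sub (hint z hzD) (hint y hy)]
  refine lt_of_le_of_lt (intervalIntegral.norm_integral_le_of_norm_le_const (C := ε / 2) ?_) ?_
  · intro θ hθ
    rw [uIoc_of_le zero_le_one] at hθ
    have := h z hz θ (Ioc_subset_Icc_self hθ)
    rw [← dist_eq_norm]
    exact le_of_lt this
  · norm_num [abs_of_pos hε]; linarith

/-- The set `D` need not be open: the mean value inequality on segments inside the convex set `D`
gives the required uniform remainder. This allows charts at points of the boundary or of the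
corners. -/
theorem hasFDerivWithinAt_integral_Icc_zero_one {F : Type} [NormedAddCommGroup F] [NormedSpace ℝ F]
    [CompleteSpace F]
    {D : Set E} (hD : Convex ℝ D) {Φ : ℝ → E → F} {Φ' : ℝ → E → E →L[ℝ] F}
    (hΦ : ContinuousOn (Function.uncurry Φ) (Icc (0 : ℝ) 1 ×ˢ D))
    (hΦ' : ContinuousOn (Function.uncurry Φ') (Icc (0 : ℝ) 1 ×ˢ D))
    (hd : ∀ θ ∈ Icc (0 : ℝ) 1, ∀ y ∈ D, HasFDerivWithinAt (Φ θ) (Φ' θ y) D y) {y : E} (hy : y ∈ D) :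
    HasFDerivWithinAt (fun y => ∫ θ in (0 : ℝ)..1, Φ θ y) (∫ θ in (0 : ℝ)..1, Φ' θ y) D y := by
  have hswap : ContinuousOn (Function.uncurry fun y θ => Φ' θ y) (D ×ˢ Icc (0 : ℝ) 1) :=
    hΦ'.comp continuous_swap.continuousOn fun p hp => ⟨hp.2, hp.1⟩
  have hint : ∀ z ∈ D, IntervalIntegrable (fun θ => Φ θ z) volume 0 1 := fun z hz =>
    ContinuousOn.intervalIntegrable (by
      rw [uIcc_of_le zero_le_one]
      exact hΦ.comp (f := fun θ : ℝ => (θ, z)) (by fun_prop) fun θ hθ => ⟨hθ, hz⟩)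
  have hint' : IntervalIntegrable (fun θ => Φ' θ y) volume 0 1 :=
    ContinuousOn.intervalIntegrable (by
      rw [uIcc_of_le zero_le_one]
      exact hΦ'.comp (f := fun θ : ℝ => (θ, y)) (by fun_prop) fun θ hθ => ⟨hθ, hy⟩)
  rw [hasFDerivWithinAt_iff_isLittleO, Asymptotics.isLittleO_iff]
  intro ε hε
  obtain ⟨v, hv, h⟩ := isCompact_Icc.mem_uniformity_of_prod hswap hy
    (Metric.dist_mem_uniformity hε)
  obtain ⟨r, hr, hball⟩ := Metric.mem_nhdsWithin_iff.1 hv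
  filter_upwards [mem_nhdsWithin_of_mem_nhds (Metric.ball_mem_nhds y hr), self_mem_nhdsWithin]
    with z hz hzD
  have e1 : (∫ θ in (0 : ℝ)..1, Φ' θ y) (z - y) = ∫ θ in (0 : ℝ)..1, Φ' θ y (z - y) :=
    (ContinuousLinearMap.intervalIntegral_apply hint' (z - y))
  have hint2 : IntervalIntegrable (fun θ => Φ' θ y (z - y)) volume 0 1 :=
    ContinuousOn.intervalIntegrable (by
      rw [uIcc_of_le zero_le_one]
      exact ContinuousOn.clm_apply (hΦ'.comp (f := fun θ : ℝ => (θ, y)) (by fun_prop)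
        fun θ hθ => ⟨hθ, hy⟩) continuousOn_const)
  rw [e1, ← intervalIntegral.integral_sub (hint z hzD) (hint y hy),
    ← intervalIntegral.integral_sub ((hint z hzD).sub (hint y hy)) hint2]
  have hb : ∀ θ ∈ uIoc (0 : ℝ) 1, ‖Φ θ z - Φ θ y - Φ' θ y (z - y)‖ ≤ ε * ‖z - y‖ := by
    intro θ hθ
    rw [uIoc_of_le zero_le_one] at hθ
    have hθ' := Ioc_subset_Icc_self hθ
    have hseg : segment ℝ y z ⊆ D ∩ Metric.ball y r :=
      (hD.inter (convex_ball y r)).segment_subset ⟨hy, Metric.mem_ball_self hr⟩ ⟨hzD, hz⟩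
    refine (convex_segment y z).norm_image_sub_le_of_norm_hasFDerivWithin_le'
      (f' := Φ' θ)
      (fun x hx => (hd θ hθ' x (hseg hx).1).mono fun w hw => (hseg hw).1) (fun x hx => ?_)
      (left_mem_segment ℝ _ _) (right_mem_segment ℝ _ _)
    have := h x (hball ⟨(hseg hx).2, (hseg hx).1⟩) θ hθ'
    rw [← dist_eq_norm]
    exact le_of_lt this
  simpa using intervalIntegral.norm_integral_le_of_norm_le_const hb

theorem contDiffOn_integral_Icc_zero_one_nat {D : Set E} (hD : Convex ℝ D) (hu : UniqueDiffOn ℝ D)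
    (n : ℕ) : ∀ {F : Type} [NormedAddCommGroup F] [NormedSpace ℝ F] [CompleteSpace F]
    {Φ : ℝ → E → F} (_ : ContDiffOn ℝ n (Function.uncurry Φ) (Icc (0 : ℝ) 1 ×ˢ D)),
    ContDiffOn ℝ n (fun y => ∫ θ in (0 : ℝ)..1, Φ θ y) D := by
  have hQ : UniqueDiffOn ℝ (Icc (0 : ℝ) 1 ×ˢ D) := (uniqueDiffOn_Icc zero_lt_one).prod hu
  induction n with
  | zero =>
    intro F _ _ _ Φ hΦ
    exact contDiffOn_zero.2 (continuousOn_integral_Icc_zero_one hΦ.continuousOn)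
  | succ n ih =>
    intro F _ _ _ Φ hΦ
    set inr := ContinuousLinearMap.inr ℝ ℝ E
    set Φ' : ℝ → E → E →L[ℝ] F := fun θ y =>
      (fderivWithin ℝ (Function.uncurry Φ) (Icc (0 : ℝ) 1 ×ˢ D) (θ, y)).comp inr
    have hΦ' : ContDiffOn ℝ n (Function.uncurry Φ') (Icc (0 : ℝ) 1 ×ˢ D) :=
      (hΦ.fderivWithin hQ (by norm_cast)).clm_comp contDiffOn_const
    have hd : ∀ θ ∈ Icc (0 : ℝ) 1, ∀ y ∈ D, HasFDerivWithinAt (Φ θ) (Φ' θ y) D y := by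
      intro θ hθ y hy
      have h1 := ((hΦ.differentiableOn (by simp)) (θ, y) ⟨hθ, hy⟩).hasFDerivWithinAt
      exact h1.comp y (hasFDerivAt_prodMk_right θ y).hasFDerivWithinAt fun z hz => ⟨hθ, hz⟩
    push_cast
    rw [contDiffOn_succ_iff_hasFDerivWithinAt_of_uniqueDiffOn hu]
    exact ⟨by simp, _, ih hΦ', fun y hy => hasFDerivWithinAt_integral_Icc_zero_one hD
      hΦ.continuousOn hΦ'.continuousOn hd hy⟩

theorem contDiffOn_integral_Icc_zero_one {D : Set E} (hD : Convex ℝ D) (hu : UniqueDiffOn ℝ D)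
    {F : Type} [NormedAddCommGroup F] [NormedSpace ℝ F] [CompleteSpace F]
    {Φ : ℝ → E → F} (hΦ : ContDiffOn ℝ ∞ (Function.uncurry Φ) (Icc (0 : ℝ) 1 ×ˢ D)) :
    ContDiffOn ℝ ∞ (fun y => ∫ θ in (0 : ℝ)..1, Φ θ y) D :=
  contDiffOn_infty.2 fun n => contDiffOn_integral_Icc_zero_one_nat hD hu n
    (hΦ.of_le (by exact_mod_cast le_top))

end ParametricIntegral

/-! ### The Poincaré lemma and pull-backs of primitives. -/

section Poincare

variable {E : Type} [NormedAddCommGroup E] [NormedSpace ℝ E]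

/-- The **Poincaré lemma** for closed `2`-forms on a convex set. -/
theorem exists_primitive_of_closed {D : Set E} (hD : Convex ℝ D) (hu : UniqueDiffOn ℝ D) {y₀ : E}
    (hy₀ : y₀ ∈ D) {W : E → E →L[ℝ] E →L[ℝ] ℝ} (hW : ContDiffOn ℝ ∞ W D)
    (hanti : ∀ y v w, W y v w = - W y w v)
    (hclosed : ∀ y ∈ D, ∀ u v w, fderivWithin ℝ W D y u v w - fderivWithin ℝ W D y v u w
      + fderivWithin ℝ W D y w u v = 0) :
    ∃ l : E → E →L[ℝ] ℝ, ContDiffOn ℝ ∞ l D ∧ ∀ y ∈ D, ∀ v w,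
      fderivWithin ℝ l D y v w - fderivWithin ℝ l D y w v = W y v w := by
  set c : ℝ → E → E := fun θ y => y₀ + θ • (y - y₀)
  -- The integrand of the radial homotopy operator, for the contraction `c` of `D` to `y₀`.
  set Φ : ℝ → E → E →L[ℝ] ℝ := fun θ y => θ • W (c θ y) (y - y₀)
  set W' := fderivWithin ℝ W D
  set Φ' : ℝ → E → E →L[ℝ] E →L[ℝ] ℝ := fun θ y =>
    θ • (θ • (W' (c θ y)).flip (y - y₀) + W (c θ y))
  have hc : ContDiff ℝ ∞ (Function.uncurry c) := by
    simp only [c, Function.uncurry_def]; fun_prop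
  have hcD : MapsTo (Function.uncurry c) (Icc (0 : ℝ) 1 ×ˢ D) D := by
    rintro ⟨θ, y⟩ ⟨hθ, hy⟩
    exact hD.add_smul_sub_mem hy₀ hy hθ
  have hWc := hW.comp hc.contDiffOn hcD
  have hW' : ContDiffOn ℝ ∞ W' D := hW.fderivWithin hu (by simp)
  have hΦ : ContDiffOn ℝ ∞ (Function.uncurry Φ) (Icc (0 : ℝ) 1 ×ˢ D) := by
    refine contDiffOn_fst.smul (hWc.clm_apply ?_)
    exact contDiffOn_snd.sub contDiffOn_const
  have hΦ' : ContinuousOn (Function.uncurry Φ') (Icc (0 : ℝ) 1 ×ˢ D) := by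
    have h1 := hW'.continuousOn.comp hc.continuous.continuousOn hcD
    have h2 : ContinuousOn (fun p : ℝ × E => (W' (c p.1 p.2)).flip) (Icc (0 : ℝ) 1 ×ˢ D) :=
      (ContinuousLinearMap.flipₗᵢ ℝ E E (E →L[ℝ] ℝ)).continuous.comp_continuousOn h1
    exact continuousOn_fst.smul ((continuousOn_fst.smul
      (h2.clm_apply (continuousOn_snd.sub continuousOn_const))).add hWc.continuousOn)
  have hWd : ∀ y ∈ D, HasFDerivWithinAt W (W' y) D y := fun y hy =>
    (hW.differentiableOn (by simp) y hy).hasFDerivWithinAt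
  have hd : ∀ θ ∈ Icc (0 : ℝ) 1, ∀ y ∈ D, HasFDerivWithinAt (Φ θ) (Φ' θ y) D y := by
    intro θ hθ y hy
    have h1 : HasFDerivWithinAt (c θ) (θ • ContinuousLinearMap.id ℝ E) D y :=
      ((((hasFDerivAt_id y).sub_const y₀).const_smul θ).const_add y₀).hasFDerivWithinAt
    have h2 := (hWd (c θ y) (hcD (x := (θ, y)) ⟨hθ, hy⟩)).comp y h1 fun z hz => hcD (x := (θ, z)) ⟨hθ, hz⟩
    have h3 := (h2.clm_apply ((hasFDerivAt_id y).sub_const y₀).hasFDerivWithinAt).const_smul θ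
    refine h3.congr_fderiv ?_
    ext v w
    simp [Φ']
    ring
  have hl := contDiffOn_integral_Icc_zero_one hD hu hΦ
  refine ⟨_, hl, fun y hy v w => ?_⟩
  have hder := (hasFDerivWithinAt_integral_Icc_zero_one hD hΦ.continuousOn hΦ' hd hy).fderivWithin
    (hu y hy)
  rw [hder]
  have hcont : ContinuousOn (fun θ => Φ' θ y) (Icc (0 : ℝ) 1) :=
    hΦ'.comp (f := fun θ : ℝ => (θ, y)) (by fun_prop) fun θ hθ => ⟨hθ, hy⟩
  have hint : IntervalIntegrable (fun θ => Φ' θ y) volume 0 1 :=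
    ContinuousOn.intervalIntegrable (by rwa [uIcc_of_le zero_le_one])
  have happ : ∀ a b, (∫ θ in (0 : ℝ)..1, Φ' θ y) a b = ∫ θ in (0 : ℝ)..1, Φ' θ y a b := by
    intro a b
    rw [ContinuousLinearMap.intervalIntegral_apply hint a]
    refine ContinuousLinearMap.intervalIntegral_apply ?_ b
    exact ContinuousOn.intervalIntegrable (by
      rw [uIcc_of_le zero_le_one]; exact hcont.clm_apply continuousOn_const)
  have hint2 : ∀ a b, IntervalIntegrable (fun θ => Φ' θ y a b) volume 0 1 := fun a b =>
    ContinuousOn.intervalIntegrable (by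
      rw [uIcc_of_le zero_le_one]
      exact (hcont.clm_apply continuousOn_const).clm_apply continuousOn_const)
  rw [happ, happ, ← intervalIntegral.integral_sub (hint2 _ _) (hint2 _ _)]
  have hcI : ∀ θ ∈ Icc (0 : ℝ) 1, c θ y ∈ D := fun θ hθ => hcD (x := (θ, y)) ⟨hθ, hy⟩
  have hcw : ContinuousOn (fun θ => W (c θ y)) (Icc (0 : ℝ) 1) :=
    hWc.continuousOn.comp (f := fun θ : ℝ => (θ, y)) (by fun_prop) fun θ hθ => ⟨hθ, hy⟩
  -- Closedness turns the antisymmetrized derivative of the integrand into the `θ`-derivative of `θ²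
  -- W(c θ y)(v, w)`, whose values at `0` and `1` are `0` and `W y v w`.
  have key := intervalIntegral.integral_eq_sub_of_hasDerivAt_of_le (zero_le_one' ℝ)
    (f := fun θ => θ ^ 2 * W (c θ y) v w) (f' := fun θ => Φ' θ y v w - Φ' θ y w v) ?_ ?_
    ((hint2 _ _).sub (hint2 _ _))
  · rw [key]
    simp [c]
  · exact (continuousOn_id.pow 2).mul
      ((hcw.clm_apply continuousOn_const).clm_apply continuousOn_const)
  · intro θ hθ
    have h1 : HasDerivAt (fun θ => c θ y) (y - y₀) θ := by
      simpa [c] using ((hasDerivAt_id θ).smul_const (y - y₀)).const_add y₀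
    have h2 : HasDerivAt (fun θ => W (c θ y)) (W' (c θ y) (y - y₀)) θ := by
      have := (hWd _ (hcI θ (Ioo_subset_Icc_self hθ))).comp_hasDerivWithinAt θ
        (s := Icc 0 1) h1.hasDerivWithinAt hcI
      exact this.hasDerivAt (Icc_mem_nhds hθ.1 hθ.2)
    have h3 := (hasDerivAt_pow 2 θ).mul
      ((h2.clm_apply (hasDerivAt_const θ v)).clm_apply (hasDerivAt_const θ w))
    refine h3.congr_deriv ?_
    have h4 := hclosed _ (hcI θ (Ioo_subset_Icc_self hθ)) (y - y₀) v w
    have h5 := hanti (c θ y) w v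
    simp only [Φ', smul_apply, add_apply, ContinuousLinearMap.flip_apply, smul_eq_mul, map_zero,
      add_zero, Nat.cast_ofNat, Nat.add_one_sub_one, pow_one]
    linear_combination θ ^ 2 * h4 + θ * h5

/-- The pull-back of a primitive is a primitive of the pull-back, along a map of the plane. -/
theorem fderiv_pullback_primitive {D : Set E} {l : E → E →L[ℝ] ℝ} (hl : ContDiffOn ℝ ∞ l D)
    {W : E → E →L[ℝ] E →L[ℝ] ℝ} (hlW : ∀ y ∈ D, ∀ v w,
      fderivWithin ℝ l D y v w - fderivWithin ℝ l D y w v = W y v w)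
    {P : Type} [NormedAddCommGroup P] [NormedSpace ℝ P]
    {v : P → E} {p : P} (hv : ContDiffAt ℝ 2 v p) (hvD : ∀ᶠ q in 𝓝 p, v q ∈ D) :
    ContDiffAt ℝ 1 (fun q => (l (v q)).comp (fderiv ℝ v q)) p ∧
    ∀ a b, fderiv ℝ (fun q => (l (v q)).comp (fderiv ℝ v q)) p a b -
      fderiv ℝ (fun q => (l (v q)).comp (fderiv ℝ v q)) p b a =
      W (v p) (fderiv ℝ v p a) (fderiv ℝ v p b) := by
  have hp : v p ∈ D := hvD.self_of_nhds
  have h1 : ContDiffAt ℝ 1 (fun q => l (v q)) p := by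
    have := ((hl (v p) hp).of_le (m := 1) (by simp)).comp (s := v ⁻¹' D) p
      ((hv.of_le (by norm_num)).contDiffWithinAt) (fun q hq => hq)
    exact this.contDiffAt hvD
  have h2 : ContDiffAt ℝ 1 (fderiv ℝ v) p := hv.fderiv_right (by norm_num)
  refine ⟨h1.clm_comp h2, fun a b => ?_⟩
  have hd1 : HasFDerivAt (fun q => l (v q)) ((fderivWithin ℝ l D (v p)).comp (fderiv ℝ v p)) p := by
    have h3 := ((hl.differentiableOn (by simp)) _ hp).hasFDerivWithinAt.comp (s := v ⁻¹' D) p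
      (hv.differentiableAt (by norm_num)).hasFDerivAt.hasFDerivWithinAt (fun q hq => hq)
    exact h3.hasFDerivAt hvD
  have hd2 := (h2.differentiableAt (by norm_num)).hasFDerivAt
  -- The terms containing the second derivative of `v` cancel by symmetry; what remains is the
  -- exterior derivative of `l` on the two images.
  have hsym : IsSymmSndFDerivAt ℝ v p := hv.isSymmSndFDerivAt (by simp)
  have h4 := (hd1.clm_comp hd2).fderiv
  rw [h4]
  have h5 := hsym.eq a b
  have h6 := hlW _ hp (fderiv ℝ v p a) (fderiv ℝ v p b)
  simp only [add_apply, ContinuousLinearMap.comp_apply,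
    ContinuousLinearMap.compL_apply, ContinuousLinearMap.flip_apply]
  rw [← h6, h5]
  ring

end Poincare

/-! ### Symplectic forms in charts and their local primitives. -/

/-- Alternating `2`-forms as bilinear maps. -/
noncomputable def alternatingToBilin (E : Type) [NormedAddCommGroup E] [NormedSpace ℝ E] :
    (E [⋀^Fin 2]→L[ℝ] ℝ) →L[ℝ] E →L[ℝ] E →L[ℝ] ℝ :=
  LinearMap.mkContinuous
    { toFun := fun β => ((continuousMultilinearCurryFin1 ℝ E ℝ).toContinuousLinearEquiv :
          (E [×1]→L[ℝ] ℝ) →L[ℝ] E →L[ℝ] ℝ).comp β.toContinuousMultilinearMap.curryLeft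
      map_add' := fun β γ => by ext v w; rfl
      map_smul' := fun a β => by ext v w; rfl } 1 (fun β => by
    rw [one_mul]
    refine ContinuousLinearMap.opNorm_le_bound₂ _ (norm_nonneg _) fun v w => ?_
    refine (β.le_opNorm (Fin.cons v (fun _ => w))).trans_eq ?_
    rw [Fin.prod_univ_two, ← mul_assoc]
    rfl)

theorem alternatingToBilin_apply {E : Type} [NormedAddCommGroup E] [NormedSpace ℝ E]
    (β : E [⋀^Fin 2]→L[ℝ] ℝ) (v w : E) : alternatingToBilin E β v w = β ![v, w] := by
  change β _ = β _
  congr 1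
  ext i
  fin_cases i <;> rfl

theorem alternatingToBilin_swap {E : Type} [NormedAddCommGroup E] [NormedSpace ℝ E]
    (β : E [⋀^Fin 2]→L[ℝ] ℝ) (v w : E) :
    alternatingToBilin E β v w = - alternatingToBilin E β w v := by
  rw [alternatingToBilin_apply, alternatingToBilin_apply]
  have h := β.toAlternatingMap.map_swap ![w, v] (i := 0) (j := 1) (by decide)
  have h2 : ![w, v] ∘ Equiv.swap (0 : Fin 2) 1 = ![v, w] := by
    funext i; fin_cases i <;> simp
  rw [h2] at h
  exact h

/-- The coordinate space of a `2n`-dimensional manifold. -/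
abbrev Coord (n : ℕ) : Type := EuclideanSpace ℝ (Fin (2 * n))

namespace HamiltonianSpectrum

variable {n : ℕ} {H : Type*} [TopologicalSpace H]
  {I : ModelWithCorners ℝ (Coord n) H}
  {M : Type*} [TopologicalSpace M] [ChartedSpace H M]

/-- A symplectic form as a field of bilinear forms. -/
noncomputable def SymplecticForm.bilin (Ω : SymplecticForm I M) (x : M) :
    Coord n →L[ℝ] Coord n →L[ℝ] ℝ :=
  alternatingToBilin (Coord n) (Ω.form x)

theorem SymplecticForm.bilin_apply (Ω : SymplecticForm I M) (x : M) (v w : Coord n) :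
    Ω.bilin x v w = Ω.form x ![v, w] := alternatingToBilin_apply _ v w

theorem SymplecticForm.bilin_swap (Ω : SymplecticForm I M) (x : M) (v w : Coord n) :
    Ω.bilin x v w = - Ω.bilin x w v := alternatingToBilin_swap _ v w

/-- The coordinate expression of a symplectic form, as a bilinear form. -/
noncomputable def SymplecticForm.bilinChart (Ω : SymplecticForm I M) (m : M) (y : Coord n) :
    Coord n →L[ℝ] Coord n →L[ℝ] ℝ :=
  alternatingToBilin (Coord n) (formInChart I Ω.form m y)

theorem SymplecticForm.bilinChart_swap (Ω : SymplecticForm I M) (m : M) (y v w : Coord n) :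
    Ω.bilinChart m y v w = - Ω.bilinChart m y w v := alternatingToBilin_swap _ v w

/-- The derivative of a chart, in terms of the preferred coordinates at a point. -/
noncomputable def chartDeriv (I : ModelWithCorners ℝ (Coord n) H) (m x : M) :
    Coord n →L[ℝ] Coord n :=
  mfderiv I 𝓘(ℝ, Coord n) (extChartAt I m) x

/-- The derivative of the inverse of a chart, in terms of the preferred coordinates at a point. -/
noncomputable def chartSymmDeriv (I : ModelWithCorners ℝ (Coord n) H) (m : M) (y : Coord n) :
    Coord n →L[ℝ] Coord n :=
  mfderivWithin 𝓘(ℝ, Coord n) I (extChartAt I m).symm (range I) y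

/-- The derivative of a map into a manifold, in terms of the preferred coordinates at a point. -/
noncomputable def coordDeriv (I : ModelWithCorners ℝ (Coord n) H) {P : Type}
    [NormedAddCommGroup P] [NormedSpace ℝ P] (u : P → M) (p : P) : P →L[ℝ] Coord n :=
  mfderiv 𝓘(ℝ, P) I u p

theorem SymplecticForm.bilinChart_apply (Ω : SymplecticForm I M) (m : M) (y v w : Coord n) :
    Ω.bilinChart m y v w = Ω.bilin ((extChartAt I m).symm y)
      (chartSymmDeriv I m y v) (chartSymmDeriv I m y w) := by
  rw [SymplecticForm.bilinChart, alternatingToBilin_apply, SymplecticForm.bilin_apply]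
  change (Ω.form ((extChartAt I m).symm y)) _ = (Ω.form ((extChartAt I m).symm y)) _
  refine congrArg _ ?_
  funext i
  fin_cases i <;> rfl

theorem SymplecticForm.contDiffOn_bilinChart (Ω : SymplecticForm I M) (m : M) :
    ContDiffOn ℝ ∞ (Ω.bilinChart m) (extChartAt I m).target :=
  (alternatingToBilin (Coord n)).contDiff.comp_contDiffOn (Ω.smooth m)

theorem SymplecticForm.bilinChart_closed (Ω : SymplecticForm I M) (m : M) {y : Coord n}
    (hy : y ∈ (extChartAt I m).target) (u v w : Coord n) :
    fderivWithin ℝ (Ω.bilinChart m) (extChartAt I m).target y u v w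
      - fderivWithin ℝ (Ω.bilinChart m) (extChartAt I m).target y v u w
      + fderivWithin ℝ (Ω.bilinChart m) (extChartAt I m).target y w u v = 0 := by
  set T := (extChartAt I m).target
  have hu : UniqueDiffWithinAt ℝ T y := uniqueDiffOn_extChartAt_target m y hy
  have hd : DifferentiableWithinAt ℝ (formInChart I Ω.form m) T y :=
    (Ω.smooth m).differentiableOn (by simp) y hy
  have h := DFunLike.congr_fun (Ω.closed m y hy) ![u, v, w]
  rw [extDerivWithin_apply hd hu] at h
  have hB : ∀ a b c : Coord n, fderivWithin ℝ (Ω.bilinChart m) T y a b c =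
      fderivWithin ℝ (fun z => formInChart I Ω.form m z ![b, c]) T y a := by
    intro a b c
    have h1 : HasFDerivWithinAt (Ω.bilinChart m) (fderivWithin ℝ (Ω.bilinChart m) T y) T y :=
      ((Ω.contDiffOn_bilinChart m).differentiableOn (by simp) y hy).hasFDerivWithinAt
    have h2 := ((h1.clm_apply (hasFDerivWithinAt_const b y T)).clm_apply
      (hasFDerivWithinAt_const c y T)).fderivWithin hu
    have h3 : (fun z => formInChart I Ω.form m z ![b, c]) = fun z => Ω.bilinChart m z b c := by
      funext z; rw [SymplecticForm.bilinChart, alternatingToBilin_apply]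
    rw [h3, h2]
    simp
  rw [hB, hB, hB]
  rw [Fin.sum_univ_three] at h
  have e0 : (0 : Fin 3).removeNth ![u, v, w] = ![v, w] := by
    funext i; fin_cases i <;> rfl
  have e1 : (1 : Fin 3).removeNth ![u, v, w] = ![u, w] := by
    funext i; fin_cases i <;> rfl
  have e2 : (2 : Fin 3).removeNth ![u, v, w] = ![u, v] := by
    funext i; fin_cases i <;> rfl
  rw [e0, e1, e2] at h
  have h' : fderivWithin ℝ (fun z => formInChart I Ω.form m z ![v, w]) T y u
      - fderivWithin ℝ (fun z => formInChart I Ω.form m z ![u, w]) T y v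
      + fderivWithin ℝ (fun z => formInChart I Ω.form m z ![u, v]) T y w = 0 := by
    simpa [← sub_eq_add_neg] using h
  exact h'

variable [IsManifold I ∞ M]

theorem chartSymmDeriv_chartDeriv {m x : M} (hx : x ∈ (extChartAt I m).source) (v : Coord n) :
    chartSymmDeriv I m (extChartAt I m x) (chartDeriv I m x v) = v := by
  have : IsManifold I 1 M := IsManifold.of_le (n := ∞) (by simp)
  exact DFunLike.congr_fun (mfderivWithin_extChartAt_symm_comp_mfderiv_extChartAt' (I := I) hx) v

theorem chartDeriv_chartSymmDeriv {m : M} {y : Coord n} (hy : y ∈ (extChartAt I m).target)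
    (v : Coord n) :
    chartDeriv I m ((extChartAt I m).symm y) (chartSymmDeriv I m y v) = v := by
  have : IsManifold I 1 M := IsManifold.of_le (n := ∞) (by simp)
  exact DFunLike.congr_fun (mfderiv_extChartAt_comp_mfderivWithin_extChartAt_symm (I := I) hy) v

theorem chartSymmDeriv_chartDeriv' {m : M} {y : Coord n} (hy : y ∈ (extChartAt I m).target)
    (v : Coord n) :
    chartSymmDeriv I m y (chartDeriv I m ((extChartAt I m).symm y) v) = v := by
  have := chartSymmDeriv_chartDeriv ((extChartAt I m).map_target hy) v
  rwa [(extChartAt I m).right_inv hy] at this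

theorem SymplecticForm.bilin_eq_bilinChart (Ω : SymplecticForm I M) (m : M) {x : M}
    (hx : x ∈ (extChartAt I m).source) (v w : Coord n) :
    Ω.bilin x v w = Ω.bilinChart m (extChartAt I m x) (chartDeriv I m x v)
      (chartDeriv I m x w) := by
  rw [SymplecticForm.bilinChart_apply, (extChartAt I m).left_inv hx,
    chartSymmDeriv_chartDeriv hx, chartSymmDeriv_chartDeriv hx]

omit [IsManifold I ∞ M] in
theorem SymplecticForm.bilin_nondegenerate (Ω : SymplecticForm I M) (x : M) {v : Coord n}
    (hv : ∀ w, Ω.bilin x v w = 0) : v = 0 :=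
  Ω.nondegenerate x v fun w => (Ω.bilin_apply x v w).symm.trans (hv w)

theorem SymplecticForm.bilinChart_nondegenerate (Ω : SymplecticForm I M) (m : M) {y : Coord n}
    (hy : y ∈ (extChartAt I m).target) {v : Coord n} (hv : ∀ w, Ω.bilinChart m y v w = 0) :
    v = 0 := by
  have h0 : chartSymmDeriv I m y v = 0 := by
    refine Ω.bilin_nondegenerate ((extChartAt I m).symm y) fun w => ?_
    have h3 := hv (chartDeriv I m ((extChartAt I m).symm y) w)
    rwa [SymplecticForm.bilinChart_apply, chartSymmDeriv_chartDeriv' hy] at h3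
  have h5 := chartDeriv_chartSymmDeriv hy v
  rw [← h5, h0, map_zero]

omit [IsManifold I ∞ M] in
theorem exists_ball_subset_target (m : M) : ∃ R : ℝ, 0 < R ∧
    Metric.ball (extChartAt I m m) R ∩ range I ⊆ (extChartAt I m).target :=
  Metric.mem_nhdsWithin_iff.1 (extChartAt_target_mem_nhdsWithin m)

omit [IsManifold I ∞ M] in
theorem SymplecticForm.exists_chart_primitive (Ω : SymplecticForm I M) (m : M) {R : ℝ}
    (hR : 0 < R) (hsub : Metric.ball (extChartAt I m m) R ∩ range I ⊆ (extChartAt I m).target) :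
    ∃ l : Coord n → Coord n →L[ℝ] ℝ,
      ContDiffOn ℝ ∞ l (Metric.ball (extChartAt I m m) R ∩ range I) ∧
      ∀ y ∈ Metric.ball (extChartAt I m m) R ∩ range I, ∀ v w,
        fderivWithin ℝ l (Metric.ball (extChartAt I m m) R ∩ range I) y v w -
        fderivWithin ℝ l (Metric.ball (extChartAt I m m) R ∩ range I) y w v =
          Ω.bilinChart m y v w := by
  set D := Metric.ball (extChartAt I m m) R ∩ range I
  have hD : Convex ℝ D := (convex_ball _ _).inter I.convex_range
  have hu : UniqueDiffOn ℝ D := by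
    rw [show D = range I ∩ Metric.ball (extChartAt I m m) R from inter_comm _ _]
    exact I.uniqueDiffOn.inter Metric.isOpen_ball
  refine exists_primitive_of_closed hD hu (y₀ := extChartAt I m m)
    ⟨Metric.mem_ball_self hR, mem_range_self _⟩ ((Ω.contDiffOn_bilinChart m).mono hsub)
    (Ω.bilinChart_swap m) fun y hy u v w => ?_
  -- The form is closed within the target of the chart, while the Poincaré lemma works within the
  -- convex set `D`. The two sets have the same germ at `y`, hence the same derivatives within them.
  have h1 : D =ᶠ[𝓝 y] (extChartAt I m).target := by
    rw [← nhdsWithin_eq_iff_eventuallyEq, nhdsWithin_extChartAt_target_eq_of_mem (hsub hy)]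
    rw [show D = range I ∩ Metric.ball (extChartAt I m m) R from inter_comm _ _]
    exact nhdsWithin_inter_of_mem' (mem_nhdsWithin_of_mem_nhds (Metric.isOpen_ball.mem_nhds hy.1))
  rw [fderivWithin_congr_set h1]
  exact Ω.bilinChart_closed m (hsub hy) u v w

/-- The radius of a ball around the centre of a chart contained in the target of the chart. -/
noncomputable def chartRadius (I : ModelWithCorners ℝ (Coord n) H) (m : M) : ℝ :=
  (exists_ball_subset_target (I := I) m).choose

/-- A convex neighbourhood of the centre of a chart, in coordinates. -/
def chartDomain (I : ModelWithCorners ℝ (Coord n) H) (m : M) : Set (Coord n) :=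
  Metric.ball (extChartAt I m m) (chartRadius I m) ∩ range I

/-- A convex neighbourhood of the centre of a chart. -/
def chartNhd (I : ModelWithCorners ℝ (Coord n) H) (m : M) : Set M :=
  (extChartAt I m).source ∩ extChartAt I m ⁻¹' Metric.ball (extChartAt I m m) (chartRadius I m)

omit [IsManifold I ∞ M]

theorem chartRadius_pos (m : M) : 0 < chartRadius I m :=
  (exists_ball_subset_target (I := I) m).choose_spec.1

theorem chartDomain_subset (m : M) : chartDomain I m ⊆ (extChartAt I m).target :=
  (exists_ball_subset_target (I := I) m).choose_spec.2

theorem convex_chartDomain (m : M) : Convex ℝ (chartDomain I m) :=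
  (convex_ball _ _).inter I.convex_range

theorem isOpen_chartNhd (m : M) : IsOpen (chartNhd I m) := by
  have := isOpen_extChartAt_preimage' (I := I) m
    (Metric.isOpen_ball (x := extChartAt I m m) (ε := chartRadius I m))
  exact this

theorem mem_chartNhd_self (m : M) : m ∈ chartNhd I m :=
  ⟨mem_extChartAt_source m, Metric.mem_ball_self (chartRadius_pos m)⟩

theorem chartNhd_subset_source (m : M) : chartNhd I m ⊆ (extChartAt I m).source :=
  inter_subset_left

theorem extChartAt_mem_chartDomain {m x : M} (hx : x ∈ chartNhd I m) :
    extChartAt I m x ∈ chartDomain I m :=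
  ⟨hx.2, extChartAt_target_subset_range m ((extChartAt I m).map_source hx.1)⟩

theorem extChartAt_symm_mem_chartNhd {m : M} {y : Coord n} (hy : y ∈ chartDomain I m) :
    (extChartAt I m).symm y ∈ chartNhd I m := by
  have h := chartDomain_subset m hy
  refine ⟨(extChartAt I m).map_target h, ?_⟩
  rw [mem_preimage, (extChartAt I m).right_inv h]
  exact hy.1

/-- A primitive of a symplectic form in coordinates. -/
noncomputable def SymplecticForm.primitive (Ω : SymplecticForm I M) (m : M) :
    Coord n → Coord n →L[ℝ] ℝ :=
  (Ω.exists_chart_primitive m (chartRadius_pos m) (chartDomain_subset m)).choose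

theorem SymplecticForm.contDiffOn_primitive (Ω : SymplecticForm I M) (m : M) :
    ContDiffOn ℝ ∞ (Ω.primitive m) (chartDomain I m) :=
  (Ω.exists_chart_primitive m (chartRadius_pos m) (chartDomain_subset m)).choose_spec.1

theorem SymplecticForm.fderivWithin_primitive (Ω : SymplecticForm I M) (m : M) {y : Coord n}
    (hy : y ∈ chartDomain I m) (v w : Coord n) :
    fderivWithin ℝ (Ω.primitive m) (chartDomain I m) y v w -
      fderivWithin ℝ (Ω.primitive m) (chartDomain I m) y w v = Ω.bilinChart m y v w :=
  (Ω.exists_chart_primitive m (chartRadius_pos m) (chartDomain_subset m)).choose_spec.2 y hy v w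

variable [IsManifold I ∞ M]

variable {P : Type} [NormedAddCommGroup P] [NormedSpace ℝ P]

theorem chartDeriv_coordDeriv {u : P → M} {p : P} {m : M}
    (hu : MDifferentiableAt 𝓘(ℝ, P) I u p) (hp : u p ∈ (extChartAt I m).source) (a : P) :
    chartDeriv I m (u p) (coordDeriv I u p a) = fderiv ℝ (extChartAt I m ∘ u) p a := by
  have : IsManifold I 1 M := IsManifold.of_le (n := ∞) (by simp)
  have h1 : mfderiv 𝓘(ℝ, P) 𝓘(ℝ, Coord n) (extChartAt I m ∘ u) p =
      (mfderiv I 𝓘(ℝ, Coord n) (extChartAt I m) (u p)).comp (mfderiv 𝓘(ℝ, P) I u p) :=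
    mfderiv_comp p (mdifferentiableAt_extChartAt (by rwa [extChartAt_source] at hp)) hu
  rw [mfderiv_eq_fderiv] at h1
  exact (DFunLike.congr_fun h1 a).symm

/-- The pull-back of a symplectic form, in coordinates. -/
theorem SymplecticForm.bilin_coordDeriv (Ω : SymplecticForm I M) {u : P → M} {p : P} (m : M)
    (hu : MDifferentiableAt 𝓘(ℝ, P) I u p) (hp : u p ∈ (extChartAt I m).source) (a b : P) :
    Ω.bilin (u p) (coordDeriv I u p a) (coordDeriv I u p b) =
      Ω.bilinChart m (extChartAt I m (u p)) (fderiv ℝ (extChartAt I m ∘ u) p a)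
        (fderiv ℝ (extChartAt I m ∘ u) p b) := by
  rw [Ω.bilin_eq_bilinChart m hp, chartDeriv_coordDeriv hu hp, chartDeriv_coordDeriv hu hp]

end HamiltonianSpectrum

/-! ### Deforming one square into a nearby one inside a chart, and Stokes' theorem for this step. -/

namespace HamiltonianSpectrum

variable {n : ℕ} {H : Type*} [TopologicalSpace H]
  {I : ModelWithCorners ℝ (Coord n) H}
  {M : Type*} [TopologicalSpace M] [ChartedSpace H M]

/-- A chart together with a bump function supported in the convex neighbourhood of its centre. -/
structure DeformationStep (I : ModelWithCorners ℝ (Coord n) H) (M : Type*) [TopologicalSpace M]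
    [ChartedSpace H M] where
  /-- the centre of the chart -/
  center : M
  /-- the bump function -/
  bump : M → ℝ
  smooth : ContMDiff I 𝓘(ℝ, ℝ) ∞ bump
  mem_Icc : ∀ x, bump x ∈ Icc (0 : ℝ) 1
  tsupport_subset : tsupport bump ⊆ chartNhd I center

namespace DeformationStep

open Classical in
/-- Move `y` towards `x` in the chart, by the fraction given by the value at `x` of the bump
function. -/
noncomputable def move (st : DeformationStep I M) (x y : M) : M :=
  if x ∈ chartNhd I st.center ∧ y ∈ chartNhd I st.center then
    (extChartAt I st.center).symm (extChartAt I st.center y +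
      st.bump x • (extChartAt I st.center x - extChartAt I st.center y)) else y

/-- The condition under which `move` is smooth. -/
def Near (st : DeformationStep I M) (x y : M) : Prop :=
  x ∈ tsupport st.bump → y ∈ chartNhd I st.center

variable (st : DeformationStep I M) {x y : M}

theorem combination_mem (hx : x ∈ chartNhd I st.center) (hy : y ∈ chartNhd I st.center) :
    extChartAt I st.center y +
      st.bump x • (extChartAt I st.center x - extChartAt I st.center y) ∈
      chartDomain I st.center :=
  (convex_chartDomain st.center).add_smul_sub_mem (extChartAt_mem_chartDomain hy)
    (extChartAt_mem_chartDomain hx) (st.mem_Icc x)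

theorem move_of_mem (hx : x ∈ chartNhd I st.center) (hy : y ∈ chartNhd I st.center) :
    st.move x y = (extChartAt I st.center).symm (extChartAt I st.center y +
      st.bump x • (extChartAt I st.center x - extChartAt I st.center y)) :=
  if_pos ⟨hx, hy⟩

theorem move_mem (hx : x ∈ chartNhd I st.center) (hy : y ∈ chartNhd I st.center) :
    st.move x y ∈ chartNhd I st.center := by
  rw [st.move_of_mem hx hy]
  exact extChartAt_symm_mem_chartNhd (st.combination_mem hx hy)

theorem move_of_bump_eq_zero (hx : st.bump x = 0) : st.move x y = y := by
  unfold move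
  split_ifs with h
  · rw [hx, zero_smul, add_zero, (extChartAt I st.center).left_inv (chartNhd_subset_source _ h.2)]
  · rfl

theorem move_of_notMem_tsupport (hx : x ∉ tsupport st.bump) : st.move x y = y :=
  st.move_of_bump_eq_zero (image_eq_zero_of_notMem_tsupport hx)

theorem move_of_bump_eq_one (hx : st.bump x = 1) (hy : y ∈ chartNhd I st.center) :
    st.move x y = x := by
  have hxs : x ∈ chartNhd I st.center := st.tsupport_subset (subset_tsupport _ (by
    simp [Function.mem_support, hx]))
  rw [st.move_of_mem hxs hy, hx, one_smul, add_sub_cancel,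
    (extChartAt I st.center).left_inv (chartNhd_subset_source _ hxs)]

theorem move_self : st.move x x = x := by
  unfold move
  split_ifs with h
  · rw [sub_self, smul_zero, add_zero,
      (extChartAt I st.center).left_inv (chartNhd_subset_source _ h.2)]
  · rfl

theorem near_self : st.Near x x := fun h => st.tsupport_subset h

section

variable {X : Type*} [TopologicalSpace X] {u w : X → M} {p : X}

theorem eventually_near (hu : ContinuousAt u p) (hw : ContinuousAt w p)
    (h : st.Near (u p) (w p)) : ∀ᶠ q in 𝓝 p, st.Near (u q) (w q) := by
  by_cases hp : u p ∈ tsupport st.bump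
  · filter_upwards [hw.eventually_mem ((isOpen_chartNhd st.center).mem_nhds (h hp))] with q hq
    exact fun _ => hq
  · filter_upwards [hu.eventually_mem ((isClosed_tsupport st.bump).isOpen_compl.mem_nhds hp)]
      with q hq
    exact fun h => absurd h hq

/-- This dichotomy makes `move` smooth: near `p` either both maps stay in the convex chart
neighbourhood, where `move` is a convex combination in coordinates, or the bump function vanishes
along `u` and `move` is the second argument. -/
theorem eventually_mem_or_eventually_notMem (hu : ContinuousAt u p) (hw : ContinuousAt w p)
    (h : st.Near (u p) (w p)) :
    (∀ᶠ q in 𝓝 p, u q ∈ chartNhd I st.center ∧ w q ∈ chartNhd I st.center) ∨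
      ∀ᶠ q in 𝓝 p, u q ∉ tsupport st.bump := by
  by_cases hp : u p ∈ tsupport st.bump
  · left
    exact (hu.eventually_mem ((isOpen_chartNhd st.center).mem_nhds (st.tsupport_subset hp))).and
      (hw.eventually_mem ((isOpen_chartNhd st.center).mem_nhds (h hp)))
  · right
    exact hu.eventually_mem ((isClosed_tsupport st.bump).isOpen_compl.mem_nhds hp)

end

variable [IsManifold I ∞ M]

theorem contMDiffAt_move {E' : Type*} [NormedAddCommGroup E'] [NormedSpace ℝ E'] {H' : Type*}
    [TopologicalSpace H'] {J : ModelWithCorners ℝ E' H'} {N : Type*} [TopologicalSpace N]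
    [ChartedSpace H' N] {u w : N → M} {p : N} (hu : ContMDiffAt J I ∞ u p)
    (hw : ContMDiffAt J I ∞ w p) (h : st.Near (u p) (w p)) :
    ContMDiffAt J I ∞ (fun q => st.move (u q) (w q)) p := by
  rcases st.eventually_mem_or_eventually_notMem hu.continuousAt hw.continuousAt h with h1 | h1
  · set c : N → Coord n := fun q => extChartAt I st.center (w q) +
      st.bump (u q) • (extChartAt I st.center (u q) - extChartAt I st.center (w q))
    have hp := h1.self_of_nhds
    have hchart : ∀ {f : N → M}, ContMDiffAt J I ∞ f p → f p ∈ chartNhd I st.center →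
        ContMDiffAt J 𝓘(ℝ, Coord n) ∞ (fun q => extChartAt I st.center (f q)) p := by
      intro f hf hfp
      have h2 : ContMDiffAt I 𝓘(ℝ, Coord n) ∞ (extChartAt I st.center) (f p) :=
        contMDiffAt_extChartAt' (by
          have := chartNhd_subset_source _ hfp
          rwa [extChartAt_source] at this)
      exact h2.comp p hf
    have hb : ContMDiffAt J 𝓘(ℝ, ℝ) ∞ (fun q => st.bump (u q)) p := (st.smooth (u p)).comp p hu
    have hc : ContMDiffAt J 𝓘(ℝ, Coord n) ∞ c p :=
      (hchart hw hp.2).add (hb.smul ((hchart hu hp.1).sub (hchart hw hp.2)))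
    have hct : ∀ᶠ q in 𝓝 p, c q ∈ (extChartAt I st.center).target := by
      filter_upwards [h1] with q hq
      exact chartDomain_subset _ (st.combination_mem hq.1 hq.2)
    have h3 : ContMDiffWithinAt 𝓘(ℝ, Coord n) I ∞ (extChartAt I st.center).symm
        (extChartAt I st.center).target (c p) :=
      contMDiffOn_extChartAt_symm st.center (c p) hct.self_of_nhds
    have h4 : ContMDiffWithinAt J I ∞ ((extChartAt I st.center).symm ∘ c)
        (c ⁻¹' (extChartAt I st.center).target) p :=
      h3.comp p hc.contMDiffWithinAt (fun q hq => hq)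
    refine (h4.contMDiffAt hct).congr_of_eventuallyEq ?_
    filter_upwards [h1] with q hq
    exact st.move_of_mem hq.1 hq.2
  · refine hw.congr_of_eventuallyEq ?_
    filter_upwards [h1] with q hq
    exact st.move_of_notMem_tsupport hq

end DeformationStep

/-- The area density of a map of the plane into a symplectic manifold. -/
noncomputable def SymplecticForm.density (Ω : SymplecticForm I M) (u : ℝ × ℝ → M) (p : ℝ × ℝ) : ℝ :=
  Ω.bilin (u p) (coordDeriv I u p (1, 0)) (coordDeriv I u p (0, 1))

/-- The pull-back to a curve, at time `t`, of the primitive of the symplectic form centred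
at `m`. -/
noncomputable def SymplecticForm.lineForm (Ω : SymplecticForm I M) (m : M) (γ : ℝ → M) (t : ℝ) :
    ℝ :=
  Ω.primitive m (extChartAt I m (γ t)) (deriv (extChartAt I m ∘ γ) t)

open Classical in
/-- The change of the integral of the primitive when a curve is moved by a deformation step. -/
noncomputable def SymplecticForm.stepForm (Ω : SymplecticForm I M) (st : DeformationStep I M)
    (γ₀ γ : ℝ → M) (t : ℝ) : ℝ :=
  if γ₀ t ∈ chartNhd I st.center ∧ γ t ∈ chartNhd I st.center then
    Ω.lineForm st.center (fun t => st.move (γ₀ t) (γ t)) t - Ω.lineForm st.center γ t else 0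

variable [IsManifold I ∞ M]

theorem contDiffAt_extChartAt_comp {P : Type} [NormedAddCommGroup P] [NormedSpace ℝ P] {u : P → M}
    {p : P} {m : M} (hu : ContMDiffAt 𝓘(ℝ, P) I ∞ u p) (hp : u p ∈ (extChartAt I m).source) :
    ContDiffAt ℝ ∞ (extChartAt I m ∘ u) p := by
  have h2 : ContMDiffAt I 𝓘(ℝ, Coord n) ∞ (extChartAt I m) (u p) :=
    contMDiffAt_extChartAt' (by rwa [extChartAt_source] at hp)
  exact (h2.comp p hu).contDiffAt

theorem SymplecticForm.continuousAt_density (Ω : SymplecticForm I M) {u : ℝ × ℝ → M} {p : ℝ × ℝ}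
    (hu : ContMDiffAt 𝓘(ℝ, ℝ × ℝ) I ∞ u p) : ContinuousAt (Ω.density u) p := by
  set m := u p
  have hp : u p ∈ (extChartAt I m).source := mem_extChartAt_source m
  have hv := contDiffAt_extChartAt_comp hu hp
  have h1 : ∀ᶠ q in 𝓝 p, u q ∈ (extChartAt I m).source :=
    hu.continuousAt.eventually_mem ((isOpen_extChartAt_source m).mem_nhds hp)
  have h2 : ∀ᶠ q in 𝓝 p, ContMDiffAt 𝓘(ℝ, ℝ × ℝ) I 1 u q :=
    contMDiffAt_iff_contMDiffAt_nhds (by simp) |>.1 (hu.of_le (by simp))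
  have h3 : Ω.density u =ᶠ[𝓝 p] fun q => Ω.bilinChart m ((extChartAt I m ∘ u) q)
      (fderiv ℝ (extChartAt I m ∘ u) q (1, 0)) (fderiv ℝ (extChartAt I m ∘ u) q (0, 1)) := by
    filter_upwards [h1, h2] with q hq1 hq2
    exact Ω.bilin_coordDeriv m (hq2.mdifferentiableAt (by simp)) hq1 _ _
  refine ContinuousAt.congr ?_ h3.symm
  have h4 : ContinuousAt (fderiv ℝ (extChartAt I m ∘ u)) p :=
    (hv.fderiv_right (m := 0) (by simp)).continuousAt
  have h5 : ContinuousAt (fun q => Ω.bilinChart m ((extChartAt I m ∘ u) q)) p := by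
    have h6 := ((Ω.contDiffOn_bilinChart m).continuousOn _ ((extChartAt I m).map_source hp))
    refine ContinuousWithinAt.continuousAt (s := u ⁻¹' (extChartAt I m).source)
      (h6.comp (f := extChartAt I m ∘ u) hv.continuousAt.continuousWithinAt
        fun q hq => (extChartAt I m).map_source hq) h1
  exact (h5.clm_apply (h4.clm_apply continuousAt_const)).clm_apply (h4.clm_apply continuousAt_const)

theorem unitSquare_eq : unitSquare = Icc ((0 : ℝ), (0 : ℝ)) (1, 1) := by
  rw [unitSquare, Icc_prod_eq]

theorem SymplecticForm.integrableOn_density (Ω : SymplecticForm I M) {u : ℝ × ℝ → M}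
    (hu : ∀ p ∈ unitSquare, ContMDiffAt 𝓘(ℝ, ℝ × ℝ) I ∞ u p) :
    IntegrableOn (Ω.density u) unitSquare := by
  refine ContinuousOn.integrableOn_compact (isCompact_Icc.prod isCompact_Icc) fun p hp => ?_
  exact (Ω.continuousAt_density (hu p hp)).continuousWithinAt

/-- The `1`-form on the plane which is the change of the pull-back of the primitive. -/
theorem SymplecticForm.exists_planar_form (Ω : SymplecticForm I M) (st : DeformationStep I M)
    {u w : ℝ × ℝ → M} :
    ∃ η : ℝ × ℝ → ℝ × ℝ →L[ℝ] ℝ, ∀ p, ContMDiffAt 𝓘(ℝ, ℝ × ℝ) I ∞ u p →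
      ContMDiffAt 𝓘(ℝ, ℝ × ℝ) I ∞ w p → st.Near (u p) (w p) →
      ContDiffAt ℝ 1 η p ∧
      (fderiv ℝ η p (1, 0) (0, 1) - fderiv ℝ η p (0, 1) (1, 0) =
        Ω.density (fun q => st.move (u q) (w q)) p - Ω.density w p) ∧
      (η p (0, 1) = Ω.stepForm st (fun t => u (p.1, t)) (fun t => w (p.1, t)) p.2) ∧
      (η p (1, 0) = Ω.stepForm st (fun t => u (t, p.2)) (fun t => w (t, p.2)) p.1) := by
  classical
  set c := st.center
  set χ := extChartAt I c
  set u' : ℝ × ℝ → M := fun q => st.move (u q) (w q)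
  set pb : (ℝ × ℝ → M) → ℝ × ℝ → ℝ × ℝ →L[ℝ] ℝ := fun f p =>
    (Ω.primitive c ((χ ∘ f) p)).comp (fderiv ℝ (χ ∘ f) p)
  -- The difference of the two pull-backs of the primitive, extended by zero. The extension is `C¹`:
  -- away from the support of the bump function the moved map equals `w`, so the difference is zero
  -- already inside the chart.
  refine ⟨fun p => if u p ∈ chartNhd I c ∧ w p ∈ chartNhd I c then pb u' p - pb w p else 0, ?_⟩
  intro p hu hw hn
  have hu' : ContMDiffAt 𝓘(ℝ, ℝ × ℝ) I ∞ u' p := st.contMDiffAt_move hu hw hn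
  rcases st.eventually_mem_or_eventually_notMem hu.continuousAt hw.continuousAt hn with h1 | h1
  · have hp := h1.self_of_nhds
    have hu'm : ∀ᶠ q in 𝓝 p, u' q ∈ chartNhd I c := by
      filter_upwards [h1] with q hq using st.move_mem hq.1 hq.2
    have hwm : ∀ᶠ q in 𝓝 p, w q ∈ chartNhd I c := h1.mono fun q hq => hq.2
    have key : ∀ {f : ℝ × ℝ → M}, ContMDiffAt 𝓘(ℝ, ℝ × ℝ) I ∞ f p →
        (∀ᶠ q in 𝓝 p, f q ∈ chartNhd I c) → ContDiffAt ℝ 1 (pb f) p ∧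
        (fderiv ℝ (pb f) p (1, 0) (0, 1) - fderiv ℝ (pb f) p (0, 1) (1, 0) = Ω.density f p) ∧
        (pb f p (0, 1) = Ω.lineForm c (fun t => f (p.1, t)) p.2) ∧
        (pb f p (1, 0) = Ω.lineForm c (fun t => f (t, p.2)) p.1) := by
      intro f hf hfc
      have hfs : f p ∈ χ.source := chartNhd_subset_source _ hfc.self_of_nhds
      have hv := contDiffAt_extChartAt_comp hf hfs
      have h2 := fderiv_pullback_primitive (Ω.contDiffOn_primitive c)
        (fun y hy v w => Ω.fderivWithin_primitive c hy v w) (v := χ ∘ f) (p := p)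
        (hv.of_le (WithTop.coe_le_coe.2 le_top))
        (hfc.mono fun q hq => extChartAt_mem_chartDomain hq)
      have hd : HasFDerivAt (χ ∘ f) (fderiv ℝ (χ ∘ f) p) p :=
        (hv.differentiableAt (by simp)).hasFDerivAt
      refine ⟨h2.1, ?_, ?_, ?_⟩
      · rw [h2.2]
        exact (Ω.bilin_coordDeriv c (hf.mdifferentiableAt (by simp)) hfs _ _).symm
      · have h3 : HasDerivAt (fun t : ℝ => (p.1, t)) ((0 : ℝ), (1 : ℝ)) p.2 :=
          (hasDerivAt_const p.2 p.1).prodMk (hasDerivAt_id p.2)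
        have h4 := (HasFDerivAt.comp_hasDerivAt p.2 (f := fun t : ℝ => (p.1, t)) hd h3).deriv
        exact congrArg _ h4.symm
      · have h3 : HasDerivAt (fun t : ℝ => (t, p.2)) ((1 : ℝ), (0 : ℝ)) p.1 :=
          (hasDerivAt_id p.1).prodMk (hasDerivAt_const p.1 p.2)
        have h4 := (HasFDerivAt.comp_hasDerivAt p.1 (f := fun t : ℝ => (t, p.2)) hd h3).deriv
        exact congrArg _ h4.symm
    obtain ⟨a1, a2, a3, a4⟩ := key hu' hu'm
    obtain ⟨b1, b2, b3, b4⟩ := key hw hwm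
    have heq : (fun q => if u q ∈ chartNhd I c ∧ w q ∈ chartNhd I c then pb u' q - pb w q else 0)
        =ᶠ[𝓝 p] pb u' - pb w := by
      filter_upwards [h1] with q hq
      rw [if_pos hq]; rfl
    refine ⟨(a1.sub b1).congr_of_eventuallyEq heq, ?_, ?_, ?_⟩
    · rw [heq.fderiv_eq, fderiv_sub (a1.differentiableAt (by simp))
        (b1.differentiableAt (by simp)), ← a2, ← b2]
      simp only [sub_apply]
      ring
    · dsimp only
      rw [if_pos hp, SymplecticForm.stepForm, if_pos hp, ← b3]
      exact congrArg₂ _ a3 rfl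
    · dsimp only
      rw [if_pos hp, SymplecticForm.stepForm, if_pos hp, ← b4]
      exact congrArg₂ _ a4 rfl
  · have h2 : u' =ᶠ[𝓝 p] w := by
      filter_upwards [h1] with q hq using st.move_of_notMem_tsupport hq
    have hpb : pb u' =ᶠ[𝓝 p] pb w := by
      filter_upwards [h2.eventuallyEq_nhds] with q hq
      have h3 : χ ∘ u' =ᶠ[𝓝 q] χ ∘ w := hq.fun_comp χ
      simp only [pb]
      rw [h3.fderiv_eq, h3.self_of_nhds]
    have heq : (fun q => if u q ∈ chartNhd I c ∧ w q ∈ chartNhd I c then pb u' q - pb w q else 0)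
        =ᶠ[𝓝 p] fun _ => 0 := by
      filter_upwards [hpb] with q hq
      rw [hq, sub_self, ite_self]
    have hsf : ∀ (g : ℝ → ℝ × ℝ) (t : ℝ), Continuous g → g t = p →
        Ω.stepForm st (fun t => u (g t)) (fun t => w (g t)) t = 0 := by
      intro g t hg hgt
      have h3 : (fun t => u' (g t)) =ᶠ[𝓝 t] fun t => w (g t) := by
        have : Filter.Tendsto g (𝓝 t) (𝓝 p) := hgt ▸ hg.continuousAt
        exact this.eventually h2
      have h4 : Ω.lineForm c (fun t => u' (g t)) t = Ω.lineForm c (fun t => w (g t)) t := by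
        have h5 : (χ ∘ fun t => u' (g t)) =ᶠ[𝓝 t] χ ∘ fun t => w (g t) := h3.fun_comp χ
        unfold SymplecticForm.lineForm
        rw [h5.deriv_eq, show χ (u' (g t)) = χ (w (g t)) from h5.self_of_nhds]
      rw [SymplecticForm.stepForm]
      change (if _ then Ω.lineForm c (fun t => u' (g t)) t - _ else (0 : ℝ)) = 0
      rw [h4, sub_self, ite_self]
    refine ⟨contDiffAt_const.congr_of_eventuallyEq heq, ?_, ?_, ?_⟩
    · rw [heq.fderiv_eq, SymplecticForm.density, SymplecticForm.density]
      have h3 : coordDeriv I u' p = coordDeriv I w p := h2.mfderiv_eq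
      change _ = Ω.bilin (u' p) (coordDeriv I u' p (1, 0)) (coordDeriv I u' p (0, 1)) - _
      rw [h3, h2.self_of_nhds]
      simp
    · rw [hsf (fun t => (p.1, t)) p.2 (by fun_prop) rfl]
      exact DFunLike.congr_fun heq.self_of_nhds _
    · rw [hsf (fun t => (t, p.2)) p.1 (by fun_prop) rfl]
      exact DFunLike.congr_fun heq.self_of_nhds _

/-- The integral over the boundary of the unit square of a form on pairs of curves. -/
noncomputable def boundaryIntegral (e : (ℝ → M) → (ℝ → M) → ℝ → ℝ) (u w : ℝ × ℝ → M) : ℝ :=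
  (∫ t in (0 : ℝ)..1, e (fun t => u (1, t)) (fun t => w (1, t)) t) -
  (∫ t in (0 : ℝ)..1, e (fun t => u (0, t)) (fun t => w (0, t)) t) -
  (∫ t in (0 : ℝ)..1, e (fun t => u (t, 1)) (fun t => w (t, 1)) t) +
  ∫ t in (0 : ℝ)..1, e (fun t => u (t, 0)) (fun t => w (t, 0)) t

/-- **Stokes' theorem** for a single deformation step; the four boundary integrands are
integrable. -/
theorem SymplecticForm.integral_density_move (Ω : SymplecticForm I M) (st : DeformationStep I M)
    {u w : ℝ × ℝ → M} (hu : ∀ p ∈ unitSquare, ContMDiffAt 𝓘(ℝ, ℝ × ℝ) I ∞ u p)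
    (hw : ∀ p ∈ unitSquare, ContMDiffAt 𝓘(ℝ, ℝ × ℝ) I ∞ w p)
    (hn : ∀ p ∈ unitSquare, st.Near (u p) (w p)) :
    ((∫ p in unitSquare, Ω.density (fun q => st.move (u q) (w q)) p) -
      ∫ p in unitSquare, Ω.density w p) = boundaryIntegral (Ω.stepForm st) u w ∧
    ∀ r ∈ Icc (0 : ℝ) 1,
      ContinuousOn (Ω.stepForm st (fun t => u (r, t)) (fun t => w (r, t))) (Icc 0 1) ∧
      ContinuousOn (Ω.stepForm st (fun t => u (t, r)) (fun t => w (t, r))) (Icc 0 1) := by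
  obtain ⟨η, hη⟩ := Ω.exists_planar_form st (u := u) (w := w)
  have h : ∀ p ∈ unitSquare, _ := fun p hp => hη p (hu p hp) (hw p hp) (hn p hp)
  have hu' : ∀ p ∈ unitSquare, ContMDiffAt 𝓘(ℝ, ℝ × ℝ) I ∞ (fun q => st.move (u q) (w q)) p :=
    fun p hp => st.contMDiffAt_move (hu p hp) (hw p hp) (hn p hp)
  have hc : ContinuousOn η unitSquare := fun p hp => (h p hp).1.continuousAt.continuousWithinAt
  have hd : ∀ p ∈ unitSquare, HasFDerivAt η (fderiv ℝ η p) p := fun p hp =>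
    ((h p hp).1.differentiableAt (by simp)).hasFDerivAt
  have hda : ∀ p ∈ unitSquare, ∀ a, HasFDerivAt (fun q => η q a) ((fderiv ℝ η p).flip a) p := by
    intro p hp a
    have := (hd p hp).clm_apply (hasFDerivAt_const a p)
    refine this.congr_fderiv ?_
    ext <;> simp
  have hoo : Ioo (0 : ℝ) 1 ×ˢ Ioo (0 : ℝ) 1 ⊆ unitSquare :=
    prod_mono Ioo_subset_Icc_self Ioo_subset_Icc_self
  have hint := (Ω.integrableOn_density hu').sub (Ω.integrableOn_density hw)
  have hdiv : ∀ p ∈ unitSquare, ((fderiv ℝ η p).flip (0, 1)) (1, 0) +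
      (-((fderiv ℝ η p).flip (1, 0))) (0, 1) =
      Ω.density (fun q => st.move (u q) (w q)) p - Ω.density w p := by
    intro p hp
    rw [← (h p hp).2.1]
    simp [sub_eq_add_neg]
  have hsq : MeasurableSet unitSquare := measurableSet_Icc.prod measurableSet_Icc
  -- Green's formula, in the form of the divergence theorem for the field with components `η(0,1)`
  -- and `-η(1,0)`.
  have hstokes := integral_divergence_prod_Icc_of_hasFDerivAt_of_le
    (fun p => η p (0, 1)) (fun p => - η p (1, 0)) (fun p => (fderiv ℝ η p).flip (0, 1))
    (fun p => -((fderiv ℝ η p).flip (1, 0))) (0, 0) (1, 1) (by simp)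
    (by rw [← unitSquare_eq]; exact hc.clm_apply continuousOn_const)
    (by rw [← unitSquare_eq]; exact (hc.clm_apply continuousOn_const).neg)
    (fun p hp => hda p (hoo hp) _) (fun p hp => (hda p (hoo hp) _).neg)
    (by rw [← unitSquare_eq]; exact (integrableOn_congr_fun hdiv hsq).2 hint)
  rw [← unitSquare_eq, setIntegral_congr_fun hsq hdiv,
    integral_sub (Ω.integrableOn_density hu') (Ω.integrableOn_density hw)] at hstokes
  have hI : ∀ {r t : ℝ}, r ∈ Icc (0 : ℝ) 1 → t ∈ Icc (0 : ℝ) 1 → (r, t) ∈ unitSquare :=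
    fun hr ht => ⟨hr, ht⟩
  have e1 : ∀ r ∈ Icc (0 : ℝ) 1, ∀ t ∈ Icc (0 : ℝ) 1,
      Ω.stepForm st (fun t => u (r, t)) (fun t => w (r, t)) t = η (r, t) (0, 1) :=
    fun r hr t ht => (h (r, t) (hI hr ht)).2.2.1.symm
  have e2 : ∀ r ∈ Icc (0 : ℝ) 1, ∀ t ∈ Icc (0 : ℝ) 1,
      Ω.stepForm st (fun t => u (t, r)) (fun t => w (t, r)) t = η (t, r) (1, 0) :=
    fun r hr t ht => (h (t, r) (hI ht hr)).2.2.2.symm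
  refine ⟨?_, fun r hr => ⟨?_, ?_⟩⟩
  · rw [hstokes, boundaryIntegral]
    have h0 : (0 : ℝ) ∈ Icc (0 : ℝ) 1 := by simp
    have h1 : (1 : ℝ) ∈ Icc (0 : ℝ) 1 := by simp
    have f1 : ∀ r ∈ Icc (0 : ℝ) 1, (∫ t in (0 : ℝ)..1,
        Ω.stepForm st (fun t => u (r, t)) (fun t => w (r, t)) t) = ∫ t in (0 : ℝ)..1, η (r, t) (0, 1) :=
      fun r hr => intervalIntegral.integral_congr fun t ht =>
        e1 r hr t (by rwa [uIcc_of_le zero_le_one] at ht)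
    have f2 : ∀ r ∈ Icc (0 : ℝ) 1, (∫ t in (0 : ℝ)..1,
        Ω.stepForm st (fun t => u (t, r)) (fun t => w (t, r)) t) = ∫ t in (0 : ℝ)..1, η (t, r) (1, 0) :=
      fun r hr => intervalIntegral.integral_congr fun t ht =>
        e2 r hr t (by rwa [uIcc_of_le zero_le_one] at ht)
    rw [f1 1 h1, f1 0 h0, f2 1 h1, f2 0 h0]
    simp only [intervalIntegral.integral_neg]
    ring
  · refine ContinuousOn.congr ?_ (e1 r hr)
    exact (hc.comp (f := fun t : ℝ => (r, t)) (by fun_prop) fun t ht => hI hr ht).clm_apply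
      continuousOn_const
  · refine ContinuousOn.congr ?_ (e2 r hr)
    exact (hc.comp (f := fun t : ℝ => (t, r)) (by fun_prop) fun t ht => hI ht hr).clm_apply
      continuousOn_const

end HamiltonianSpectrum

/-! ### Successive deformation steps and Stokes' theorem for nearby squares. -/

namespace HamiltonianSpectrum

variable {n : ℕ} {H : Type*} [TopologicalSpace H]
  {I : ModelWithCorners ℝ (Coord n) H}
  {M : Type*} [TopologicalSpace M] [ChartedSpace H M]

/-- Successive deformation steps. -/
noncomputable def moves : List (DeformationStep I M) → M → M → M
  | [], _, y => y
  | st :: l, x, y => moves l x (st.move x y)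

/-- The condition under which `moves` is smooth. -/
def NearAll : List (DeformationStep I M) → M → M → Prop
  | [], _, _ => True
  | st :: l, x, y => st.Near x y ∧ NearAll l x (st.move x y)

/-- The change of the integrals of the primitives when a curve is moved by successive
deformation steps. -/
noncomputable def SymplecticForm.deformationForm (Ω : SymplecticForm I M) :
    List (DeformationStep I M) → (ℝ → M) → (ℝ → M) → ℝ → ℝ
  | [], _, _, _ => 0
  | st :: l, γ₀, γ, t => Ω.stepForm st γ₀ γ t +
      Ω.deformationForm l γ₀ (fun t => st.move (γ₀ t) (γ t)) t

theorem moves_self (l : List (DeformationStep I M)) (x : M) : moves l x x = x := by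
  induction l with
  | nil => rfl
  | cons st l ih => rw [moves, st.move_self, ih]

theorem nearAll_self (l : List (DeformationStep I M)) (x : M) : NearAll l x x := by
  induction l with
  | nil => trivial
  | cons st l ih => exact ⟨st.near_self, by rwa [st.move_self]⟩

theorem moves_eq_left (l : List (DeformationStep I M)) {x y : M} (hn : NearAll l x y)
    (h : ∃ st ∈ l, st.bump x = 1) : moves l x y = x := by
  induction l generalizing y with
  | nil => simp at h
  | cons st l ih =>
    rw [moves]
    obtain ⟨st', hst', h1⟩ := h
    rcases List.mem_cons.1 hst' with rfl | h2
    · rw [st'.move_of_bump_eq_one h1 (hn.1 (subset_tsupport _ (by simp [h1]))), moves_self]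
    · exact ih hn.2 ⟨st', h2, h1⟩

theorem SymplecticForm.lineForm_of_eventuallyEq_const (Ω : SymplecticForm I M) (m x : M)
    {γ : ℝ → M} {t : ℝ} (h : ∀ᶠ τ in 𝓝 t, γ τ = x) : Ω.lineForm m γ t = 0 := by
  have h1 : (extChartAt I m ∘ γ) =ᶠ[𝓝 t] fun _ => extChartAt I m x := by
    filter_upwards [h] with τ hτ
    rw [Function.comp_apply, hτ]
  rw [SymplecticForm.lineForm, h1.deriv_eq, deriv_const, map_zero]

theorem SymplecticForm.deformationForm_const_const (Ω : SymplecticForm I M)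
    (l : List (DeformationStep I M)) (x y : M) (t : ℝ) :
    Ω.deformationForm l (fun _ => x) (fun _ => y) t = 0 := by
  induction l generalizing y with
  | nil => rfl
  | cons st l ih =>
    rw [SymplecticForm.deformationForm, ih, SymplecticForm.stepForm,
      Ω.lineForm_of_eventuallyEq_const st.center (st.move x y) (Filter.Eventually.of_forall
        fun _ => rfl),
      Ω.lineForm_of_eventuallyEq_const st.center y (Filter.Eventually.of_forall fun _ => rfl)]
    simp

theorem SymplecticForm.deformationForm_const_of_eventuallyEq (Ω : SymplecticForm I M)
    (l : List (DeformationStep I M)) (x : M) {γ : ℝ → M} {t : ℝ} (h : ∀ᶠ τ in 𝓝 t, γ τ = x) :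
    Ω.deformationForm l (fun _ => x) γ t = 0 := by
  induction l generalizing γ with
  | nil => rfl
  | cons st l ih =>
    have h1 : ∀ᶠ τ in 𝓝 t, st.move x (γ τ) = x := by
      filter_upwards [h] with τ hτ
      rw [hτ, st.move_self]
    rw [SymplecticForm.deformationForm, ih h1, SymplecticForm.stepForm,
      Ω.lineForm_of_eventuallyEq_const st.center x h1,
      Ω.lineForm_of_eventuallyEq_const st.center x h]
    simp

/-- At `x` the first effective step of the list is one which is centred at `x` and moves
everything nearby to `x`. -/
def LeadsAt (l : List (DeformationStep I M)) (x : M) : Prop :=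
  ∃ l₁ st l₂, l = l₁ ++ st :: l₂ ∧ st.center = x ∧ st.bump x = 1 ∧
    ∀ st' ∈ l₁, x ∉ tsupport st'.bump

/-- Steps before the one centred at `x` do nothing; that step collapses `γ` to the constant `x`, and
later steps keep it there. Only the primitive at `x`, with a minus sign, survives. This makes the
edge terms of the first variation explicit, and it forces `γ t` into the chart at `x`. -/
theorem SymplecticForm.deformationForm_of_leadsAt (Ω : SymplecticForm I M)
    {l : List (DeformationStep I M)} {x : M} (hl : LeadsAt l x) {γ : ℝ → M} {t : ℝ}
    (hγ : ContinuousAt γ t) (hn : NearAll l x (γ t)) :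
    Ω.deformationForm l (fun _ => x) γ t = - Ω.lineForm x γ t ∧ γ t ∈ chartNhd I x := by
  obtain ⟨l₁, st, l₂, rfl, rfl, h1, h2⟩ := hl
  induction l₁ with
  | nil =>
    rw [List.nil_append] at hn ⊢
    have hxs : st.center ∈ tsupport st.bump := subset_tsupport _ (by simp [h1])
    have h3 : γ t ∈ chartNhd I st.center := hn.1 hxs
    have h4 : ∀ᶠ τ in 𝓝 t, st.move st.center (γ τ) = st.center := by
      filter_upwards [hγ.eventually_mem ((isOpen_chartNhd st.center).mem_nhds h3)] with τ hτ
      exact st.move_of_bump_eq_one h1 hτ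
    refine ⟨?_, h3⟩
    rw [SymplecticForm.deformationForm, Ω.deformationForm_const_of_eventuallyEq l₂ _ h4,
      SymplecticForm.stepForm, if_pos ⟨mem_chartNhd_self _, h3⟩,
      Ω.lineForm_of_eventuallyEq_const _ _ h4]
    ring
  | cons st' l₁ ih =>
    have h3 : ∀ y, st'.move st.center y = y := fun y =>
      st'.move_of_notMem_tsupport (h2 st' (by simp))
    rw [List.cons_append] at hn ⊢
    have h4 := ih (by have := hn.2; rwa [h3] at this)
      (fun st'' hst'' => h2 st'' (List.mem_cons_of_mem _ hst''))
    refine ⟨?_, h4.2⟩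
    rw [SymplecticForm.deformationForm, SymplecticForm.stepForm]
    simp only [h3, sub_self, ite_self, zero_add]
    exact h4.1

variable [IsManifold I ∞ M]

theorem DeformationStep.continuousAt_move (st : DeformationStep I M) {p : M × M}
    (h : st.Near p.1 p.2) : ContinuousAt (fun q : M × M => st.move q.1 q.2) p :=
  (st.contMDiffAt_move (J := I.prod I) (u := Prod.fst) (w := Prod.snd) contMDiffAt_fst
    contMDiffAt_snd h).continuousAt

theorem isOpen_nearAll (l : List (DeformationStep I M)) :
    IsOpen {p : M × M | NearAll l p.1 p.2} := by
  induction l with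
  | nil => exact isOpen_univ
  | cons st l ih =>
    rw [isOpen_iff_mem_nhds]
    intro p hp
    have h1 := st.eventually_near (X := M × M) continuousAt_fst continuousAt_snd hp.1
    have h2 : ContinuousAt (fun q : M × M => (q.1, st.move q.1 q.2)) p :=
      continuousAt_fst.prodMk (st.continuousAt_move hp.1)
    filter_upwards [h1, h2.eventually_mem (ih.mem_nhds hp.2)] with q hq1 hq2
    exact ⟨hq1, hq2⟩

theorem SymplecticForm.integral_density_moves (Ω : SymplecticForm I M)
    (l : List (DeformationStep I M))
    {u w : ℝ × ℝ → M} (hu : ∀ p ∈ unitSquare, ContMDiffAt 𝓘(ℝ, ℝ × ℝ) I ∞ u p)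
    (hw : ∀ p ∈ unitSquare, ContMDiffAt 𝓘(ℝ, ℝ × ℝ) I ∞ w p)
    (hn : ∀ p ∈ unitSquare, NearAll l (u p) (w p)) :
    ((∫ p in unitSquare, Ω.density (fun q => moves l (u q) (w q)) p) -
      ∫ p in unitSquare, Ω.density w p) = boundaryIntegral (Ω.deformationForm l) u w ∧
    ∀ r ∈ Icc (0 : ℝ) 1,
      ContinuousOn (Ω.deformationForm l (fun t => u (r, t)) (fun t => w (r, t))) (Icc 0 1) ∧
      ContinuousOn (Ω.deformationForm l (fun t => u (t, r)) (fun t => w (t, r))) (Icc 0 1) := by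
  induction l generalizing w with
  | nil =>
    refine ⟨?_, fun r _ => ⟨continuousOn_const, continuousOn_const⟩⟩
    simp [moves, boundaryIntegral, SymplecticForm.deformationForm]
  | cons st l ih =>
    obtain ⟨a1, a2⟩ := Ω.integral_density_move st hu hw fun p hp => (hn p hp).1
    obtain ⟨b1, b2⟩ := ih (w := fun q => st.move (u q) (w q))
      (fun p hp => st.contMDiffAt_move (hu p hp) (hw p hp) (hn p hp).1) fun p hp => (hn p hp).2
    refine ⟨?_, fun r hr => ⟨(a2 r hr).1.add (b2 r hr).1, (a2 r hr).2.add (b2 r hr).2⟩⟩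
    have hint : ∀ {f : ℝ → ℝ}, ContinuousOn f (Icc 0 1) → IntervalIntegrable f volume 0 1 := by
      intro f hf
      exact ContinuousOn.intervalIntegrable (by rwa [uIcc_of_le zero_le_one])
    have e1 : ∀ r ∈ Icc (0 : ℝ) 1, (∫ t in (0 : ℝ)..1,
        Ω.deformationForm (st :: l) (fun t => u (r, t)) (fun t => w (r, t)) t) =
        (∫ t in (0 : ℝ)..1, Ω.stepForm st (fun t => u (r, t)) (fun t => w (r, t)) t) +
        ∫ t in (0 : ℝ)..1, Ω.deformationForm l (fun t => u (r, t))
          (fun t => st.move (u (r, t)) (w (r, t))) t := fun r hr =>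
      intervalIntegral.integral_add (hint (a2 r hr).1) (hint (b2 r hr).1)
    have e2 : ∀ r ∈ Icc (0 : ℝ) 1, (∫ t in (0 : ℝ)..1,
        Ω.deformationForm (st :: l) (fun t => u (t, r)) (fun t => w (t, r)) t) =
        (∫ t in (0 : ℝ)..1, Ω.stepForm st (fun t => u (t, r)) (fun t => w (t, r)) t) +
        ∫ t in (0 : ℝ)..1, Ω.deformationForm l (fun t => u (t, r))
          (fun t => st.move (u (t, r)) (w (t, r))) t := fun r hr =>
      intervalIntegral.integral_add (hint (a2 r hr).2) (hint (b2 r hr).2)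
    have h0 : (0 : ℝ) ∈ Icc (0 : ℝ) 1 := by simp
    have h1 : (1 : ℝ) ∈ Icc (0 : ℝ) 1 := by simp
    rw [boundaryIntegral, e1 1 h1, e1 0 h0, e2 1 h1, e2 0 h0]
    rw [boundaryIntegral] at a1 b1
    change (∫ p in unitSquare, Ω.density (fun q => moves l (u q) (st.move (u q) (w q))) p) - _ = _
    linarith

omit [IsManifold I ∞ M] in
theorem SymplecticForm.density_congr (Ω : SymplecticForm I M) {u w : ℝ × ℝ → M} {p : ℝ × ℝ}
    (h : u =ᶠ[𝓝 p] w) : Ω.density u p = Ω.density w p := by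
  have h3 : coordDeriv I u p = coordDeriv I w p := h.mfderiv_eq
  rw [SymplecticForm.density, h3, h.self_of_nhds, SymplecticForm.density]

/-- A list of deformation steps which moves everything nearby to the points of `C`. -/
def Covers (l : List (DeformationStep I M)) (C : Set M) : Prop :=
  ∀ x ∈ C, ∃ st ∈ l, ∀ᶠ x' in 𝓝 x, st.bump x' = 1

/-- **Stokes' theorem** for two nearby squares in a symplectic manifold. -/
theorem SymplecticForm.integral_density_sub (Ω : SymplecticForm I M)
    {l : List (DeformationStep I M)}
    {u w : ℝ × ℝ → M} (hu : ∀ p ∈ unitSquare, ContMDiffAt 𝓘(ℝ, ℝ × ℝ) I ∞ u p)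
    (hw : ∀ p ∈ unitSquare, ContMDiffAt 𝓘(ℝ, ℝ × ℝ) I ∞ w p)
    (hn : ∀ p ∈ unitSquare, NearAll l (u p) (w p)) (hl : Covers l (u '' unitSquare)) :
    (∫ p in unitSquare, Ω.density u p) - (∫ p in unitSquare, Ω.density w p) =
      boundaryIntegral (Ω.deformationForm l) u w := by
  rw [← (Ω.integral_density_moves l hu hw hn).1]
  congr 1
  -- Some step has bump function equal to one near `u p`, so near `p` the composition of all steps
  -- carries `w` onto `u`, and the densities agree.
  refine setIntegral_congr_fun (measurableSet_Icc.prod measurableSet_Icc) fun p hp => ?_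
  refine Ω.density_congr ?_
  obtain ⟨st, hst, h1⟩ := hl (u p) (mem_image_of_mem u hp)
  have h2 : ∀ᶠ q in 𝓝 p, NearAll l (u q) (w q) :=
    ((hu p hp).continuousAt.prodMk (hw p hp).continuousAt).eventually_mem
      ((isOpen_nearAll l).mem_nhds (hn p hp))
  filter_upwards [h2, (hu p hp).continuousAt.eventually h1] with q hq1 hq2
  exact (moves_eq_left l hq1 ⟨st, hst, hq2⟩).symm

variable [T2Space M]

theorem exists_deformationStep (m : M) {U : Set M} (hU : U ∈ 𝓝 m) :
    ∃ st : DeformationStep I M, st.center = m ∧ (∀ᶠ x in 𝓝 m, st.bump x = 1) ∧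
      tsupport st.bump ⊆ U := by
  obtain ⟨f, -, hf⟩ := (SmoothBumpFunction.nhds_basis_tsupport (I := I) m).mem_iff.1
    (Filter.inter_mem hU ((isOpen_chartNhd (I := I) m).mem_nhds (mem_chartNhd_self m)))
  exact ⟨⟨m, f, f.contMDiff, fun x => f.mem_Icc, hf.trans inter_subset_right⟩, rfl,
    f.eventuallyEq_one, hf.trans inter_subset_left⟩

/-- Compactness gives finitely many steps covering `C`. The steps centred at `x₀` and `x₁` are put
in front; if the points differ, the support of the first bump function is chosen to avoid `x₁`, so
that this step is ineffective there. -/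
theorem exists_deformation {C : Set M} (hC : IsCompact C) (x₀ x₁ : M) :
    ∃ l : List (DeformationStep I M), Covers l C ∧ LeadsAt l x₀ ∧ LeadsAt l x₁ := by
  obtain ⟨l, hl⟩ : ∃ l : List (DeformationStep I M), Covers l C := by
    refine hC.induction_on (p := fun C => ∃ l : List (DeformationStep I M), Covers l C)
      ⟨[], fun x hx => hx.elim⟩ ?_ ?_ ?_
    · rintro s t hst ⟨l, hl⟩
      exact ⟨l, fun x hx => hl x (hst hx)⟩
    · rintro s t ⟨l, hl⟩ ⟨l', hl'⟩
      refine ⟨l ++ l', fun x hx => ?_⟩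
      rcases hx with hx | hx
      · obtain ⟨st, h1, h2⟩ := hl x hx
        exact ⟨st, List.mem_append_left _ h1, h2⟩
      · obtain ⟨st, h1, h2⟩ := hl' x hx
        exact ⟨st, List.mem_append_right _ h1, h2⟩
    · intro x _
      obtain ⟨st, -, h1, -⟩ := exists_deformationStep (I := I) x Filter.univ_mem
      exact ⟨_, mem_nhdsWithin_of_mem_nhds h1.eventually_nhds, [st], fun y hy =>
        ⟨st, by simp, hy⟩⟩
  have hcov : ∀ l' : List (DeformationStep I M), Covers (l' ++ l) C := fun l' x hx =>
    (hl x hx).imp fun st h => ⟨List.mem_append_right _ h.1, h.2⟩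
  by_cases hx : x₁ = x₀
  · obtain ⟨st, h1, h2, -⟩ := exists_deformationStep (I := I) x₀ Filter.univ_mem
    subst hx
    have : LeadsAt ([st] ++ l) x₁ := ⟨[], st, l, rfl, h1, h2.self_of_nhds, by simp⟩
    exact ⟨[st] ++ l, hcov _, this, this⟩
  · obtain ⟨st, h1, h2, h3⟩ := exists_deformationStep (I := I) x₀
      (isOpen_compl_singleton.mem_nhds (Ne.symm hx))
    obtain ⟨st', h1', h2', -⟩ := exists_deformationStep (I := I) x₁ Filter.univ_mem
    refine ⟨[st, st'] ++ l, hcov _, ⟨[], st, st' :: l, rfl, h1, h2.self_of_nhds, by simp⟩,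
      ⟨[st], st', l, rfl, h1', h2'.self_of_nhds, ?_⟩⟩
    simp only [List.mem_singleton, forall_eq]
    exact fun h => h3 h rfl

end HamiltonianSpectrum

/-! ### Hamiltonian vector fields in charts and uniqueness of their orbits. -/

namespace HamiltonianSpectrum

variable {n : ℕ} {H : Type*} [TopologicalSpace H]
  {I : ModelWithCorners ℝ (Coord n) H}
  {M : Type*} [TopologicalSpace M] [ChartedSpace H M]

/-- The Hamiltonian vector field, in terms of the preferred coordinates at each point. -/
noncomputable def SymplecticForm.hamField (Ω : SymplecticForm I M) (f : M → ℝ) (x : M) : Coord n :=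
  Ω.hamVectorField f x

/-- The differential of a function, in terms of the preferred coordinates at each point. -/
noncomputable def coordDifferential (I : ModelWithCorners ℝ (Coord n) H) (f : M → ℝ) (x : M) :
    Coord n →L[ℝ] ℝ :=
  mfderiv I 𝓘(ℝ, ℝ) f x

theorem SymplecticForm.bilin_hamField (Ω : SymplecticForm I M) (f : M → ℝ) (x : M) (w : Coord n) :
    Ω.bilin x (Ω.hamField f x) w = coordDifferential I f x w :=
  (Ω.bilin_apply x _ w).trans (Ω.form_hamVectorField f x w)

theorem SymplecticForm.hamField_unique (Ω : SymplecticForm I M) {f : M → ℝ} {x : M} {v : Coord n}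
    (h : ∀ w, Ω.bilin x v w = coordDifferential I f x w) : Ω.hamField f x = v := by
  rw [← sub_eq_zero]
  refine Ω.bilin_nondegenerate x fun w => ?_
  rw [map_sub, sub_apply, h, Ω.bilin_hamField, sub_self]

theorem SymplecticForm.hamField_eq_zero (Ω : SymplecticForm I M) {f : M → ℝ} {x : M}
    (h : ∀ᶠ y in 𝓝 x, f y = 0) : Ω.hamField f x = 0 := by
  refine Ω.hamField_unique fun w => ?_
  have h1 : f =ᶠ[𝓝 x] fun _ => (0 : ℝ) := h
  have h2 : coordDifferential I f x = 0 := by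
    rw [coordDifferential]
    exact h1.mfderiv_eq.trans mfderiv_const
  rw [h2]
  simp

/-- A Hamiltonian vector field in a chart. -/
noncomputable def SymplecticForm.chartField (Ω : SymplecticForm I M) (h : ℝ → ℝ → M → ℝ) (m : M)
    (q : ℝ × ℝ × Coord n) : Coord n :=
  chartDeriv I m ((extChartAt I m).symm q.2.2)
    (Ω.hamField (h q.1 q.2.1) ((extChartAt I m).symm q.2.2))

/-- A solution on `[0,1]` of the Hamiltonian equation, up to an affine change of time. -/
def SymplecticForm.IsFlowLine (Ω : SymplecticForm I M) (h : ℝ → M → ℝ) (t τ : ℝ) (γ : ℝ → M) :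
    Prop :=
  ∀ θ ∈ Icc (0 : ℝ) 1, HasMFDerivWithinAt 𝓘(ℝ, ℝ) I γ (Icc (0 : ℝ) 1) θ
    ((1 : ℝ →L[ℝ] ℝ).smulRight (τ • Ω.hamField (h (t + τ * θ)) (γ θ)) : ℝ →L[ℝ] Coord n)

/-- A solution on `ℝ` of the Hamiltonian equation. -/
def SymplecticForm.IsFullOrbit (Ω : SymplecticForm I M) (h : ℝ → M → ℝ) (γ : ℝ → M) : Prop :=
  ∀ t, HasMFDerivAt 𝓘(ℝ, ℝ) I γ t
    ((1 : ℝ →L[ℝ] ℝ).smulRight (Ω.hamField (h t) (γ t)) : ℝ →L[ℝ] Coord n)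

theorem SymplecticForm.IsFullOrbit.isFlowLine {Ω : SymplecticForm I M} {h : ℝ → M → ℝ} {γ : ℝ → M}
    (hγ : Ω.IsFullOrbit h γ) (t τ : ℝ) : Ω.IsFlowLine h t τ (fun θ => γ (t + τ * θ)) := by
  intro θ _
  have h1 : HasDerivAt (fun θ => t + τ * θ) τ θ := by
    simpa using ((hasDerivAt_id θ).const_mul τ).const_add t
  have h2 : HasMFDerivAt 𝓘(ℝ, ℝ) 𝓘(ℝ, ℝ) (fun θ => t + τ * θ) θ
      ((1 : ℝ →L[ℝ] ℝ).smulRight τ) := h1.hasFDerivAt.hasMFDerivAt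
  have h3 := (HasMFDerivAt.comp θ (hγ (t + τ * θ)) h2).hasMFDerivWithinAt (s := Icc (0 : ℝ) 1)
  have h4 : ((1 : ℝ →L[ℝ] ℝ).smulRight (Ω.hamField (h (t + τ * θ)) (γ (t + τ * θ)))).comp
      ((1 : ℝ →L[ℝ] ℝ).smulRight τ) =
      (1 : ℝ →L[ℝ] ℝ).smulRight (τ • Ω.hamField (h (t + τ * θ)) (γ (t + τ * θ))) := by
    ext; simp
  exact h3.congr_mfderiv h4

variable [IsManifold I ∞ M]

theorem hasDerivWithinAt_extChartAt_comp {γ : ℝ → M} {S : Set ℝ} {t : ℝ} {v : Coord n} {m : M}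
    (hγ : HasMFDerivWithinAt 𝓘(ℝ, ℝ) I γ S t
      ((1 : ℝ →L[ℝ] ℝ).smulRight v : ℝ →L[ℝ] Coord n))
    (hm : γ t ∈ (extChartAt I m).source) :
    HasDerivWithinAt (extChartAt I m ∘ γ) (chartDeriv I m (γ t) v) S t := by
  have : IsManifold I 1 M := IsManifold.of_le (n := ∞) (by simp)
  have h1 : HasMFDerivAt I 𝓘(ℝ, Coord n) (extChartAt I m) (γ t)
      (mfderiv I 𝓘(ℝ, Coord n) (extChartAt I m) (γ t)) :=
    (mdifferentiableAt_extChartAt (by rwa [extChartAt_source] at hm)).hasMFDerivAt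
  have h2 : HasFDerivWithinAt (extChartAt I m ∘ γ)
      ((chartDeriv I m (γ t)).comp ((1 : ℝ →L[ℝ] ℝ).smulRight v)) S t :=
    (h1.comp_hasMFDerivWithinAt t hγ).hasFDerivWithinAt
  exact h2.hasDerivWithinAt.congr_deriv (by simp)

theorem hasMFDerivWithinAt_extChartAt_symm_comp {y : ℝ → Coord n} {S : Set ℝ} {t : ℝ}
    {v : Coord n} {m : M} (hy : HasDerivWithinAt y v S t) (hm : ∀ τ ∈ S, y τ ∈ (extChartAt I m).target)
    (ht : t ∈ S) :
    HasMFDerivWithinAt 𝓘(ℝ, ℝ) I ((extChartAt I m).symm ∘ y) S t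
      ((1 : ℝ →L[ℝ] ℝ).smulRight (chartSymmDeriv I m (y t) v) : ℝ →L[ℝ] Coord n) := by
  have : IsManifold I 1 M := IsManifold.of_le (n := ∞) (by simp)
  have h1 : HasMFDerivWithinAt 𝓘(ℝ, Coord n) I (extChartAt I m).symm (range I) (y t)
      (mfderivWithin 𝓘(ℝ, Coord n) I (extChartAt I m).symm (range I) (y t)) :=
    (mdifferentiableWithinAt_extChartAt_symm (hm t ht)).hasMFDerivWithinAt
  have h2 := h1.comp t (HasFDerivWithinAt.hasMFDerivWithinAt hy.hasFDerivWithinAt)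
    fun τ hτ => extChartAt_target_subset_range m (hm τ hτ)
  have h3 : (chartSymmDeriv I m (y t)).comp ((1 : ℝ →L[ℝ] ℝ).smulRight v) =
      (1 : ℝ →L[ℝ] ℝ).smulRight (chartSymmDeriv I m (y t) v) := by
    ext; simp
  exact h2.congr_mfderiv h3

theorem coordDifferential_chartSymmDeriv {f : M → ℝ} (hf : ContMDiff I 𝓘(ℝ, ℝ) ∞ f) {m : M}
    {y : Coord n} (hy : y ∈ (extChartAt I m).target) (w : Coord n) :
    coordDifferential I f ((extChartAt I m).symm y) (chartSymmDeriv I m y w) =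
      fderivWithin ℝ (f ∘ (extChartAt I m).symm) (extChartAt I m).target y w := by
  have : IsManifold I 1 M := IsManifold.of_le (n := ∞) (by simp)
  have h1 : HasMFDerivWithinAt 𝓘(ℝ, Coord n) I (extChartAt I m).symm (range I) y
      (mfderivWithin 𝓘(ℝ, Coord n) I (extChartAt I m).symm (range I) y) :=
    (mdifferentiableWithinAt_extChartAt_symm hy).hasMFDerivWithinAt
  have h0 : HasMFDerivAt I 𝓘(ℝ, ℝ) f ((extChartAt I m).symm y)
      (mfderiv I 𝓘(ℝ, ℝ) f ((extChartAt I m).symm y)) :=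
    ((hf _).mdifferentiableAt (by simp)).hasMFDerivAt
  have h2 : HasFDerivWithinAt (f ∘ (extChartAt I m).symm)
      ((coordDifferential I f ((extChartAt I m).symm y)).comp (chartSymmDeriv I m y))
      (extChartAt I m).target y :=
    ((h0.comp_hasMFDerivWithinAt y h1).mono (extChartAt_target_subset_range m)).hasFDerivWithinAt
  rw [h2.fderivWithin (uniqueDiffOn_extChartAt_target m y hy)]
  rfl

section Family

variable {Ω : SymplecticForm I M} {h : ℝ → ℝ → M → ℝ}
  (hh : ContMDiff (𝓘(ℝ, ℝ × ℝ).prod I) 𝓘(ℝ, ℝ) ∞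
    (fun p : (ℝ × ℝ) × M => h p.1.1 p.1.2 p.2))

include hh

omit [IsManifold I ∞ M] in
theorem contMDiff_slice (s t : ℝ) : ContMDiff I 𝓘(ℝ, ℝ) ∞ (h s t) :=
  hh.comp (g := fun p : (ℝ × ℝ) × M => h p.1.1 p.1.2 p.2) (f := fun x => ((s, t), x))
    (contMDiff_const.prodMk contMDiff_id)

theorem contDiffOn_family_chart (m : M) :
    ContDiffOn ℝ ∞ (fun q : ℝ × ℝ × Coord n => h q.1 q.2.1 ((extChartAt I m).symm q.2.2))
      (univ ×ˢ univ ×ˢ (extChartAt I m).target) := by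
  have h1 : ContMDiffOn 𝓘(ℝ, ℝ × ℝ × Coord n) I ∞
      (fun q : ℝ × ℝ × Coord n => (extChartAt I m).symm q.2.2)
      (univ ×ˢ univ ×ˢ (extChartAt I m).target) :=
    (contMDiffOn_extChartAt_symm m).comp
      (contDiff_snd.comp contDiff_snd : ContDiff ℝ ∞ fun q : ℝ × ℝ × Coord n => q.2.2).contMDiff.contMDiffOn
      fun q hq => hq.2.2
  have h2 : ContMDiffOn 𝓘(ℝ, ℝ × ℝ × Coord n) 𝓘(ℝ, ℝ × ℝ) ∞
      (fun q : ℝ × ℝ × Coord n => (q.1, q.2.1)) (univ ×ˢ univ ×ˢ (extChartAt I m).target) :=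
    (contDiff_fst.prodMk (contDiff_fst.comp contDiff_snd) :
      ContDiff ℝ ∞ fun q : ℝ × ℝ × Coord n => (q.1, q.2.1)).contMDiff.contMDiffOn
  exact contMDiffOn_iff_contDiffOn.1 (hh.comp_contMDiffOn (h2.prodMk h1))

theorem bilinChart_chartField (m : M) {q : ℝ × ℝ × Coord n}
    (hq : q.2.2 ∈ (extChartAt I m).target) (w : Coord n) :
    Ω.bilinChart m q.2.2 (Ω.chartField h m q) w =
      fderivWithin ℝ (h q.1 q.2.1 ∘ (extChartAt I m).symm) (extChartAt I m).target q.2.2 w := by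
  rw [SymplecticForm.bilinChart_apply, SymplecticForm.chartField, chartSymmDeriv_chartDeriv' hq,
    Ω.bilin_hamField, coordDifferential_chartSymmDeriv (contMDiff_slice hh _ _) hq]

/-- In the chart the field is the inverse of the bilinear form, as an operator into the dual,
applied to the differential of the Hamiltonian. Nondegeneracy makes the operator invertible, and
inversion is smooth at invertible operators. -/
theorem contDiffOn_chartField (m : M) :
    ContDiffOn ℝ ∞ (Ω.chartField h m) (univ ×ˢ univ ×ˢ (extChartAt I m).target) := by
  set T := (extChartAt I m).target
  set S : Set (ℝ × ℝ × Coord n) := univ ×ˢ univ ×ˢ T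
  have hT : UniqueDiffOn ℝ T := uniqueDiffOn_extChartAt_target m
  have hS : UniqueDiffOn ℝ S := uniqueDiffOn_univ.prod (uniqueDiffOn_univ.prod hT)
  have h1 := contDiffOn_family_chart hh m
  set g : ℝ × ℝ × Coord n → ℝ := fun q => h q.1 q.2.1 ((extChartAt I m).symm q.2.2)
  set j : Coord n →L[ℝ] ℝ × ℝ × Coord n :=
    ContinuousLinearMap.prod 0 (ContinuousLinearMap.prod 0 (ContinuousLinearMap.id ℝ (Coord n)))
  have h2 : ContDiffOn ℝ ∞ (fun q => (fderivWithin ℝ g S q).comp j) S :=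
    (h1.fderivWithin hS (by simp)).clm_comp contDiffOn_const
  have h3 : ∀ q ∈ S, fderivWithin ℝ (h q.1 q.2.1 ∘ (extChartAt I m).symm) T q.2.2 =
      (fderivWithin ℝ g S q).comp j := by
    intro q hq
    have h4 : HasFDerivWithinAt g (fderivWithin ℝ g S q) S q :=
      (h1.differentiableOn (by simp) q hq).hasFDerivWithinAt
    have h5 : HasFDerivWithinAt (fun y : Coord n => (q.1, q.2.1, y)) j T q.2.2 :=
      HasFDerivWithinAt.prodMk (f₁ := fun _ => q.1) (hasFDerivWithinAt_const q.1 _ _)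
        (HasFDerivWithinAt.prodMk (f₁ := fun _ => q.2.1) (hasFDerivWithinAt_const q.2.1 _ _)
          (hasFDerivWithinAt_id _ _))
    exact (HasFDerivWithinAt.comp (t := S) q.2.2 h4 h5 fun y hy => ⟨trivial, trivial, hy⟩).fderivWithin
      (hT _ hq.2.2)
  have hinv : ∀ y ∈ T, ∃ A : Coord n ≃L[ℝ] (Coord n →L[ℝ] ℝ),
      (A : Coord n →L[ℝ] Coord n →L[ℝ] ℝ) = Ω.bilinChart m y := by
    intro y hy
    have hk : Function.Injective (Ω.bilinChart m y : Coord n →ₗ[ℝ] Coord n →L[ℝ] ℝ) := by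
      rw [injective_iff_map_eq_zero]
      intro v hv
      exact Ω.bilinChart_nondegenerate m hy fun w => DFunLike.congr_fun hv w
    have hr : Module.finrank ℝ (Coord n) = Module.finrank ℝ (Coord n →L[ℝ] ℝ) := by
      rw [← (LinearMap.toContinuousLinearMap (𝕜 := ℝ) (E := Coord n) (F' := ℝ)).finrank_eq]
      exact (Subspace.dual_finrank_eq).symm
    exact ⟨(LinearEquiv.ofInjectiveOfFinrankEq _ hk hr).toContinuousLinearEquiv, by ext; rfl⟩
  have h6 : ∀ q ∈ S, Ω.chartField h m q = (Ω.bilinChart m q.2.2).inverse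
      ((fderivWithin ℝ g S q).comp j) := by
    intro q hq
    obtain ⟨A, hA⟩ := hinv _ hq.2.2
    rw [← hA, ContinuousLinearMap.inverse_equiv, ← h3 q hq]
    refine ((ContinuousLinearEquiv.symm_apply_eq A).2 ?_).symm
    refine ContinuousLinearMap.ext fun w => ?_
    rw [← bilinChart_chartField hh m hq.2.2 w (Ω := Ω), ← hA]
    rfl
  refine ContDiffOn.congr ?_ h6
  refine ContDiffOn.clm_apply ?_ h2
  intro q hq
  obtain ⟨A, hA⟩ := hinv _ hq.2.2
  have h7 : ContDiffAt ℝ ∞ ContinuousLinearMap.inverse (Ω.bilinChart m q.2.2) := by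
    rw [← hA]; exact contDiffAt_map_inverse A
  have h8 : ContDiffOn ℝ ∞ (fun q : ℝ × ℝ × Coord n => Ω.bilinChart m q.2.2) S :=
    (Ω.contDiffOn_bilinChart m).comp (contDiff_snd.comp contDiff_snd).contDiffOn
      fun q hq => hq.2.2
  exact h7.comp_contDiffWithinAt q (h8 q hq)

omit hh in
theorem SymplecticForm.IsFlowLine.hasDerivWithinAt {s t τ : ℝ} {γ : ℝ → M}
    (hγ : Ω.IsFlowLine (h s) t τ γ) {θ : ℝ} (hθ : θ ∈ Icc (0 : ℝ) 1) {m : M}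
    (hm : γ θ ∈ (extChartAt I m).source) :
    HasDerivWithinAt (extChartAt I m ∘ γ)
      (τ • Ω.chartField h m (s, t + τ * θ, extChartAt I m (γ θ))) (Icc 0 1) θ := by
  have h1 := hasDerivWithinAt_extChartAt_comp (hγ θ hθ) hm
  rw [map_smul] at h1
  rw [SymplecticForm.chartField]
  dsimp only
  rwa [(extChartAt I m).left_inv hm]

/-- Uniqueness of the solutions of the Hamiltonian equation. -/
theorem SymplecticForm.IsFlowLine.eqOn [T2Space M] {s t τ : ℝ} {α β : ℝ → M}
    (hα : Ω.IsFlowLine (h s) t τ α) (hβ : Ω.IsFlowLine (h s) t τ β) (h0 : α 0 = β 0) :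
    EqOn α β (Icc 0 1) := by
  have hαc : ContinuousOn α (Icc 0 1) := fun θ hθ => (hα θ hθ).1
  have hβc : ContinuousOn β (Icc 0 1) := fun θ hθ => (hβ θ hθ).1
  have hcl : IsClosed ({θ | α θ = β θ} ∩ Icc 0 1) := by
    have := (hαc.prodMk hβc).preimage_isClosed_of_isClosed isClosed_Icc isClosed_diagonal
    rwa [inter_comm] at this
  -- Continuous induction: the set of agreement is closed, and it extends to the right of each of
  -- its points by Grönwall uniqueness in a chart. The field is Lipschitz within the convex chart
  -- domain, jointly in time and position, so boundary points need no separate treatment.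
  refine hcl.Icc_subset_of_forall_mem_nhdsWithin h0 ?_
  rintro θ₀ ⟨heq, hθ₀⟩
  have hθ' : θ₀ ∈ Icc (0 : ℝ) 1 := Ico_subset_Icc_self hθ₀
  set m := α θ₀
  have hcd : ContDiffOn ℝ ∞ (fun p : ℝ × Coord n => τ • Ω.chartField h m (s, t + τ * p.1, p.2))
      (univ ×ˢ chartDomain I m) := by
    have h1 : ContDiff ℝ ∞ (fun p : ℝ × Coord n => (s, t + τ * p.1, p.2)) := by fun_prop
    have h2 : MapsTo (fun p : ℝ × Coord n => (s, t + τ * p.1, p.2)) (univ ×ˢ chartDomain I m)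
        (univ ×ˢ univ ×ˢ (extChartAt I m).target) :=
      fun p hp => ⟨trivial, trivial, chartDomain_subset m hp.2⟩
    exact (contDiffOn_const (c := τ)).smul ((contDiffOn_chartField hh m).comp h1.contDiffOn h2)
  have hmem : ((θ₀, extChartAt I m m) : ℝ × Coord n) ∈ univ ×ˢ chartDomain I m :=
    ⟨trivial, extChartAt_mem_chartDomain (mem_chartNhd_self m)⟩
  obtain ⟨K, W, hW, hK⟩ := ((hcd _ hmem).of_le (m := 1) (by simp)).exists_lipschitzOnWith
    (convex_univ.prod (convex_chartDomain m))
  have hIci : Icc (0 : ℝ) 1 ∈ 𝓝[≥] θ₀ :=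
    Filter.mem_of_superset (Icc_mem_nhdsGE hθ₀.2) (Icc_subset_Icc_left hθ₀.1)
  have key : ∀ {γ : ℝ → M}, Ω.IsFlowLine (h s) t τ γ → γ θ₀ = m → ∀ᶠ θ in 𝓝[≥] θ₀,
      θ ∈ Icc (0 : ℝ) 1 ∧ γ θ ∈ (extChartAt I m).source ∧ (θ, extChartAt I m (γ θ)) ∈ W := by
    intro γ hγ h1
    have hc : ContinuousWithinAt γ (Ici θ₀) θ₀ :=
      (hγ θ₀ hθ').1.mono_of_mem_nhdsWithin hIci
    have h2 : ∀ᶠ θ in 𝓝[≥] θ₀, γ θ ∈ chartNhd I m :=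
      hc.eventually_mem ((isOpen_chartNhd m).mem_nhds (by rw [h1]; exact mem_chartNhd_self m))
    have h3 : Filter.Tendsto (fun θ => (θ, extChartAt I m (γ θ))) (𝓝[≥] θ₀)
        (𝓝[univ ×ˢ chartDomain I m] (θ₀, extChartAt I m m)) := by
      refine tendsto_nhdsWithin_iff.2 ⟨?_, ?_⟩
      · refine Filter.Tendsto.prodMk_nhds (nhdsWithin_le_nhds) ?_
        have h4 : ContinuousAt (extChartAt I m) (γ θ₀) := by
          rw [h1]; exact continuousAt_extChartAt m
        have h5 : Filter.Tendsto (fun θ => extChartAt I m (γ θ)) (𝓝[≥] θ₀)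
          (𝓝 (extChartAt I m (γ θ₀))) := h4.comp_continuousWithinAt hc
        rwa [h1] at h5
      · filter_upwards [h2] with θ hθ using ⟨trivial, extChartAt_mem_chartDomain hθ⟩
    filter_upwards [hIci, h2, h3.eventually_mem hW] with θ a b c
    exact ⟨a, chartNhd_subset_source m b, c⟩
  obtain ⟨b, hb, hsub⟩ := mem_nhdsGE_iff_exists_Icc_subset.1
    ((key hα rfl).and (key hβ (Eq.symm heq)))
  have hbθ : ∀ θ ∈ Icc θ₀ b, _ := fun θ hθ => hsub hθ
  have huniq : EqOn (extChartAt I m ∘ α) (extChartAt I m ∘ β) (Icc θ₀ b) := by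
    refine ODE_solution_unique_of_mem_Icc_right
      (v := fun θ y => τ • Ω.chartField h m (s, t + τ * θ, y)) (s := fun θ => {y | (θ, y) ∈ W})
      (K := K) ?_ ?_ ?_ ?_ ?_ ?_ ?_ ?_
    · intro θ _ y hy y' hy'
      have := hK hy hy'
      rwa [Prod.edist_eq, edist_self, max_eq_right zero_le] at this
    · exact fun θ hθ => ((hα.hasDerivWithinAt (hbθ θ hθ).1.1 (hbθ θ hθ).1.2.1).continuousWithinAt).mono
        fun τ hτ => (hbθ τ hτ).1.1
    · intro θ hθ
      have hθ1 := hbθ θ (Ico_subset_Icc_self hθ)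
      refine (hα.hasDerivWithinAt hθ1.1.1 hθ1.1.2.1).mono_of_mem_nhdsWithin ?_
      have h1 : b ≤ 1 := (hbθ b ⟨hb.le, le_rfl⟩).1.1.2
      exact Filter.mem_of_superset (Icc_mem_nhdsGE (hθ.2.trans_le h1)) (Icc_subset_Icc_left hθ1.1.1.1)
    · exact fun θ hθ => (hbθ θ (Ico_subset_Icc_self hθ)).1.2.2
    · exact fun θ hθ => ((hβ.hasDerivWithinAt (hbθ θ hθ).1.1 (hbθ θ hθ).2.2.1).continuousWithinAt).mono
        fun τ hτ => (hbθ τ hτ).1.1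
    · intro θ hθ
      have hθ1 := hbθ θ (Ico_subset_Icc_self hθ)
      refine (hβ.hasDerivWithinAt hθ1.1.1 hθ1.2.2.1).mono_of_mem_nhdsWithin ?_
      have h1 : b ≤ 1 := (hbθ b ⟨hb.le, le_rfl⟩).1.1.2
      exact Filter.mem_of_superset (Icc_mem_nhdsGE (hθ.2.trans_le h1)) (Icc_subset_Icc_left hθ1.1.1.1)
    · exact fun θ hθ => (hbθ θ (Ico_subset_Icc_self hθ)).2.2.2
    · exact congrArg (extChartAt I m) heq
  refine nhdsWithin_mono _ Ioi_subset_Ici_self (Filter.mem_of_superset (Icc_mem_nhdsGE hb) ?_)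
  intro θ hθ
  exact (extChartAt I m).injOn (hbθ θ hθ).1.2.1 (hbθ θ hθ).2.2.1 (huniq hθ)

/-- The affine change of time has speed `t - t₀`, of either sign, so uniqueness on the unit interval
covers both directions of time. -/
theorem SymplecticForm.IsFullOrbit.eq [T2Space M] {s t₀ : ℝ} {α β : ℝ → M}
    (hα : Ω.IsFullOrbit (h s) α) (hβ : Ω.IsFullOrbit (h s) β) (h0 : α t₀ = β t₀) : α = β := by
  funext t
  have h1 := (hα.isFlowLine t₀ (t - t₀)).eqOn hh (hβ.isFlowLine t₀ (t - t₀)) (by simpa using h0)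
    (right_mem_Icc.2 zero_le_one)
  simpa using h1

end Family

end HamiltonianSpectrum

/-! ### Smoothness of the Hamiltonian flow at interior points. -/

theorem exists_contDiff_eventuallyEq {E F : Type*} [NormedAddCommGroup E] [NormedSpace ℝ E]
    [FiniteDimensional ℝ E] [NormedAddCommGroup F] [NormedSpace ℝ F] {f : E → F} {U : Set E} {q : E}
    (hf : ContDiffOn ℝ ∞ f U) (hU : U ∈ 𝓝 q) :
    ∃ g : E → F, ContDiff ℝ ∞ g ∧ ∀ᶠ y in 𝓝 q, g y = f y := by
  obtain ⟨ε, hε, hsub⟩ := Metric.mem_nhds_iff.1 hU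
  let ρ : ContDiffBump q := ⟨ε / 4, ε / 2, by positivity, by linarith⟩
  refine ⟨fun y => ρ y • f y, contDiff_iff_contDiffAt.2 fun y => ?_, ?_⟩
  · by_cases hy : y ∈ Metric.ball q ε
    · exact ρ.contDiff.contDiffAt.smul ((hf.mono hsub).contDiffAt (Metric.isOpen_ball.mem_nhds hy))
    · have h1 : y ∉ tsupport ρ := by
        rw [ρ.tsupport_eq]
        intro h2
        refine hy (Metric.closedBall_subset_ball ?_ h2)
        change ε / 2 < ε
        linarith
      have h2 : (fun y => ρ y • f y) =ᶠ[𝓝 y] fun _ => 0 := by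
        filter_upwards [(isClosed_tsupport ρ).isOpen_compl.mem_nhds h1] with z hz
        rw [image_eq_zero_of_notMem_tsupport hz, zero_smul]
      exact contDiffAt_const.congr_of_eventuallyEq h2
  · filter_upwards [ρ.eventuallyEq_one] with y hy
    rw [hy, Pi.one_apply, one_smul]

theorem eq_add_smul_of_hasDerivWithinAt {F : Type*} [NormedAddCommGroup F] [NormedSpace ℝ F]
    {g : ℝ → F} {c : F} (hg : ∀ t ∈ Icc (0 : ℝ) 1, HasDerivWithinAt g c (Icc 0 1) t) {t : ℝ}
    (ht : t ∈ Icc (0 : ℝ) 1) : g t = g 0 + t • c := by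
  have h1 : ∀ t ∈ Icc (0 : ℝ) 1, HasDerivWithinAt (fun t => g t - t • c) 0 (Icc 0 1) t := by
    intro t ht
    have := (hg t ht).sub ((hasDerivWithinAt_id t _).smul_const c)
    rw [one_smul, sub_self] at this
    exact this
  have h2 := (convex_Icc (0 : ℝ) 1).norm_image_sub_le_of_norm_hasDerivWithin_le (C := 0) h1
    (by simp) (left_mem_Icc.2 zero_le_one) ht
  rw [zero_mul, norm_le_zero_iff, zero_smul, sub_zero, sub_eq_zero] at h2
  rw [← h2]; abel

namespace HamiltonianSpectrum

variable {n : ℕ} {H : Type*} [TopologicalSpace H]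
  {I : ModelWithCorners ℝ (Coord n) H}
  {M : Type*} [TopologicalSpace M] [ChartedSpace H M]

/-- A smooth family of Hamiltonians, defined for all times, with the orbits of its flows. -/
structure FlowFamily (Ω : SymplecticForm I M) where
  /-- the Hamiltonians -/
  ham : ℝ → ℝ → M → ℝ
  smooth : ContMDiff (𝓘(ℝ, ℝ × ℝ).prod I) 𝓘(ℝ, ℝ) ∞
    (fun p : (ℝ × ℝ) × M => ham p.1.1 p.1.2 p.2)
  /-- the orbits -/
  orbit : ℝ → M → ℝ → M
  orbit_zero : ∀ s x, orbit s x 0 = x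
  isFullOrbit : ∀ s x, Ω.IsFullOrbit (ham s) (orbit s x)
  support : ∀ s, ∃ K : Set M, IsClosed K ∧ K ⊆ I.interior M ∧ ∀ t, ∀ x ∉ K, ham s t x = 0

theorem extChartAt_mem_interior_target [IsManifold I ∞ M] {m x : M} (hx : x ∈ I.interior M)
    (hm : x ∈ (extChartAt I m).source) : extChartAt I m x ∈ interior (extChartAt I m).target :=
  (I.isInteriorPoint_iff_of_mem_atlas (n := ∞) (by simp) (chart_mem_atlas H m)
    (by rwa [extChartAt_source] at hm)).1 hx

theorem extChartAt_symm_mem_interior [IsManifold I ∞ M] {m : M} {y : Coord n}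
    (hy : y ∈ interior (extChartAt I m).target) : (extChartAt I m).symm y ∈ I.interior M := by
  have h1 := (extChartAt I m).map_target (interior_subset hy)
  refine (I.isInteriorPoint_iff_of_mem_atlas (n := ∞) (by simp) (chart_mem_atlas H m)
    (by rwa [extChartAt_source] at h1)).2 ?_
  change extChartAt I m _ ∈ interior (extChartAt I m).target
  rwa [(extChartAt I m).right_inv (interior_subset hy)]

theorem contMDiffAt_extChartAt_symm [IsManifold I ∞ M] {m : M} {y : Coord n}
    (hy : y ∈ interior (extChartAt I m).target) :
    ContMDiffAt 𝓘(ℝ, Coord n) I ∞ (extChartAt I m).symm y :=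
  (contMDiffOn_extChartAt_symm m).contMDiffAt (mem_interior_iff_mem_nhds.1 hy)

namespace FlowFamily

variable [IsManifold I ∞ M] {Ω : SymplecticForm I M} (Φ : FlowFamily Ω)

omit [IsManifold I ∞ M] in
theorem continuous_orbit (s : ℝ) (x : M) : Continuous (Φ.orbit s x) :=
  continuous_iff_continuousAt.2 fun t => (Φ.isFullOrbit s x t).1

omit [IsManifold I ∞ M] in
theorem isFullOrbit_const (s : ℝ) {x : M} (h : ∀ t, ∀ᶠ y in 𝓝 x, Φ.ham s t y = 0) :
    Ω.IsFullOrbit (Φ.ham s) (fun _ => x) := by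
  intro t
  have h1 : ((1 : ℝ →L[ℝ] ℝ).smulRight (Ω.hamField (Φ.ham s t) x) : ℝ →L[ℝ] Coord n) = 0 := by
    rw [Ω.hamField_eq_zero (h t)]
    ext; simp
  have h2 : HasMFDerivAt 𝓘(ℝ, ℝ) I (fun _ : ℝ => x) t (0 : ℝ →L[ℝ] Coord n) :=
    hasMFDerivAt_const x t
  exact h2.congr_mfderiv h1.symm

variable [T2Space M]

theorem orbit_of_eq (s t : ℝ) {x p : M} (hp : ∀ t, ∀ᶠ y in 𝓝 p, Φ.ham s t y = 0)
    (h : Φ.orbit s x t = p) : x = p := by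
  have h1 := (Φ.isFullOrbit s x).eq (t₀ := t) Φ.smooth (Φ.isFullOrbit_const s hp) h
  rw [← Φ.orbit_zero s x, h1]

theorem orbit_eq_self (s t : ℝ) {x : M} (hp : ∀ t, ∀ᶠ y in 𝓝 x, Φ.ham s t y = 0) :
    Φ.orbit s x t = x := by
  have h1 := (Φ.isFullOrbit s x).eq (t₀ := 0) Φ.smooth (Φ.isFullOrbit_const s hp)
    (Φ.orbit_zero s x)
  rw [h1]

/-- Outside the support the field vanishes and constant curves are orbits; by uniqueness an orbit
that is outside the support at one time is constant. Since the support lies in the interior, orbits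
never leave the interior. -/
theorem orbit_mem_interior (s t : ℝ) {x : M} (hx : x ∈ I.interior M) :
    Φ.orbit s x t ∈ I.interior M := by
  obtain ⟨K, hK, hKi, h0⟩ := Φ.support s
  by_cases h : Φ.orbit s x t ∈ K
  · exact hKi h
  · have h1 := Φ.orbit_of_eq s t (x := x) (p := Φ.orbit s x t)
      (fun t => by filter_upwards [hK.isOpen_compl.mem_nhds h] with y hy using h0 t y hy) rfl
    rwa [← h1]

omit [T2Space M] [IsManifold I ∞ M] in
theorem eventually_ham_eq_zero (s : ℝ) {x : M} (hx : x ∉ I.interior M) (t : ℝ) :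
    ∀ᶠ y in 𝓝 x, Φ.ham s t y = 0 := by
  obtain ⟨K, hK, hKi, h0⟩ := Φ.support s
  filter_upwards [hK.isOpen_compl.mem_nhds fun h => hx (hKi h)] with y hy using h0 t y hy

/-- The flow in a chart of the initial points. -/
noncomputable def flowMap (m : M) (q : ℝ × ℝ × Coord n) : M :=
  Φ.orbit q.1 ((extChartAt I m).symm q.2.2) q.2.1

/-- The passage from time `t` to time `t₁` is a local flow in the chart at the orbit point of time
`t₀`, so smoothness of the time-`t` map in parameter and initial point gives joint smoothness at
`t₁`. The two times range independently near `t₀`, and either may be `t₀` itself; this is what makes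
the set of good times clopen. The order `N` is finite because the domain of the local flow depends
on it. -/
theorem exists_contMDiffAt_flowMap (m : M) (s₀ t₀ : ℝ) {y₀ : Coord n}
    (hy₀ : y₀ ∈ interior (extChartAt I m).target) (N : ℕ) :
    ∀ᶠ t in 𝓝 t₀, ∀ᶠ t₁ in 𝓝 t₀,
      ContMDiffAt 𝓘(ℝ, ℝ × Coord n) I N
        (fun p : ℝ × Coord n => Φ.orbit p.1 ((extChartAt I m).symm p.2) t) (s₀, y₀) →
      ContMDiffAt 𝓘(ℝ, ℝ × ℝ × Coord n) I N (Φ.flowMap m) (s₀, t₁, y₀) := by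
  set x₀ := (extChartAt I m).symm y₀
  set m' := Φ.orbit s₀ x₀ t₀
  have hm' : m' ∈ I.interior M := Φ.orbit_mem_interior s₀ t₀ (extChartAt_symm_mem_interior hy₀)
  set χ := extChartAt I m'
  set q₀ : ℝ × ℝ × Coord n := (s₀, t₀, χ m')
  set U : Set (ℝ × ℝ × Coord n) := univ ×ˢ univ ×ˢ interior χ.target
  have hUo : IsOpen U := isOpen_univ.prod (isOpen_univ.prod isOpen_interior)
  have hq₀ : q₀ ∈ U := ⟨trivial, trivial,
    extChartAt_mem_interior_target hm' (mem_extChartAt_source m')⟩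
  -- With parameter and time as additional coordinates of velocities `0` and `1` the field becomes
  -- autonomous. Cutting it off makes it global without changing it near `q₀`; this uses that the
  -- orbit point is interior.
  obtain ⟨f, hf, hfe⟩ := exists_contDiff_eventuallyEq (q := q₀)
    (f := fun q => ((0 : ℝ), (1 : ℝ), Ω.chartField Φ.ham m' q)) (U := U)
    (contDiffOn_const.prodMk (contDiffOn_const.prodMk ((contDiffOn_chartField Φ.smooth m').mono
      (prod_mono_right (prod_mono_right interior_subset))))) (hUo.mem_nhds hq₀)
  obtain ⟨γ, hγ⟩ := exists_contDiffAt_localFlow f hf q₀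
    (Filter.inter_mem hfe (hUo.mem_nhds hq₀)) (n := N)
  have hsrc : ∀ᶠ t in 𝓝 t₀, Φ.orbit s₀ x₀ t ∈ χ.source :=
    (Φ.continuous_orbit s₀ x₀).continuousAt.eventually_mem
      ((isOpen_extChartAt_source m').mem_nhds (mem_extChartAt_source m'))
  have hχc : ContinuousAt (fun t => χ (Φ.orbit s₀ x₀ t)) t₀ :=
    ContinuousAt.comp (g := χ) (continuousAt_extChartAt m')
      (Φ.continuous_orbit s₀ x₀).continuousAt
  have hpair : ContinuousAt (fun p : ℝ × ℝ =>
      (((s₀, p.1, χ (Φ.orbit s₀ x₀ p.1)) : ℝ × ℝ × Coord n), p.2 - p.1)) (t₀, t₀) := by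
    refine ContinuousAt.prodMk (continuousAt_const.prodMk (continuousAt_fst.prodMk ?_))
      (continuousAt_snd.sub continuousAt_fst)
    exact ContinuousAt.comp (g := fun t => χ (Φ.orbit s₀ x₀ t)) (f := Prod.fst) hχc continuousAt_fst
  have hγ' := hγ.eventually_nhds
  have hpair0 : Filter.Tendsto (fun p : ℝ × ℝ =>
      (((s₀, p.1, χ (Φ.orbit s₀ x₀ p.1)) : ℝ × ℝ × Coord n), p.2 - p.1)) (𝓝 (t₀, t₀))
      (𝓝 (q₀, 0)) := by
    have := hpair.tendsto
    simp only [sub_self] at this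
    exact this
  have h1 := hpair0.eventually hγ'
  rw [nhds_prod_eq] at h1
  filter_upwards [h1.curry, hsrc] with t ht1 hts
  filter_upwards [ht1] with t₁ ht hC
  set A : ℝ × Coord n → Coord n := fun p => χ (Φ.orbit p.1 ((extChartAt I m).symm p.2) t)
  have hA : ContDiffAt ℝ N A (s₀, y₀) := by
    have h2 : ContMDiffAt I 𝓘(ℝ, Coord n) N χ (Φ.orbit s₀ x₀ t) :=
      (contMDiffAt_extChartAt' (n := ∞) (by rwa [extChartAt_source] at hts)).of_le
        (mod_cast le_top)
    exact contMDiffAt_iff_contDiffAt.1 (h2.comp (s₀, y₀) hC)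
  set B : ℝ × ℝ × Coord n → (ℝ × ℝ × Coord n) × ℝ := fun q =>
    ((q.1, t, A (q.1, q.2.2)), q.2.1 - t)
  have hB : ContDiffAt ℝ N B (s₀, t₁, y₀) := by
    have h3 : ContDiffAt ℝ N (fun q : ℝ × ℝ × Coord n => (q.1, q.2.2)) (s₀, t₁, y₀) := by
      fun_prop
    have h4 : ContDiffAt ℝ N (fun q : ℝ × ℝ × Coord n => A (q.1, q.2.2)) (s₀, t₁, y₀) :=
      ContDiffAt.comp (s₀, t₁, y₀) (g := A) hA h3
    have h5 : ContDiffAt ℝ N (fun q : ℝ × ℝ × Coord n => q.2.1 - t) (s₀, t₁, y₀) := by fun_prop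
    exact (contDiffAt_fst.prodMk (contDiffAt_const.prodMk h4)).prodMk h5
  have htself := ht.self_of_nhds
  have hψ : ContDiffAt ℝ N (fun q => (γ (B q) 1).2.2) (s₀, t₁, y₀) :=
    contDiff_snd.contDiffAt.comp _ (contDiff_snd.contDiffAt.comp _
      (ContDiffAt.comp (s₀, t₁, y₀) (g := fun p => γ p 1) (f := B) htself.1 hB))
  have h6 : ContMDiffAt 𝓘(ℝ, ℝ × ℝ × Coord n) I N (fun q => χ.symm (γ (B q) 1).2.2)
      (s₀, t₁, y₀) := by
    have h7 : (γ (B (s₀, t₁, y₀)) 1).2.2 ∈ interior χ.target :=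
      (htself.2.2 1 (right_mem_Icc.2 zero_le_one)).1.2.2.2
    exact ((contMDiffAt_extChartAt_symm h7).of_le (mod_cast le_top)).comp (s₀, t₁, y₀)
      (contMDiffAt_iff_contDiffAt.2 hψ)
  refine h6.congr_of_eventuallyEq ?_
  have hsrc2 : ∀ᶠ q : ℝ × ℝ × Coord n in 𝓝 (s₀, t₁, y₀),
      Φ.orbit q.1 ((extChartAt I m).symm q.2.2) t ∈ χ.source := by
    have h8 : ContinuousAt (fun q : ℝ × ℝ × Coord n => (q.1, q.2.2)) (s₀, t₁, y₀) := by fun_prop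
    have h9 := ContinuousAt.comp (x := (s₀, t₁, y₀))
      (g := fun p : ℝ × Coord n => Φ.orbit p.1 ((extChartAt I m).symm p.2) t)
      (f := fun q : ℝ × ℝ × Coord n => (q.1, q.2.2)) hC.continuousAt h8
    exact h9.eventually_mem ((isOpen_extChartAt_source m').mem_nhds hts)
  filter_upwards [hsrc2, hB.continuousAt.eventually ht] with q hq1 hq2
  obtain ⟨-, hq0, hqγ⟩ := hq2
  have hcomp1 : ∀ θ ∈ Icc (0 : ℝ) 1, (γ (B q) θ).1 = q.1 := by
    intro θ hθ
    have := eq_add_smul_of_hasDerivWithinAt (g := fun θ => (γ (B q) θ).1) (c := 0)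
      (fun θ hθ => by
        have h8 := (hqγ θ hθ).2.hasFDerivWithinAt.fst.hasDerivWithinAt
        rw [(hqγ θ hθ).1.1] at h8
        simpa using h8) hθ
    simpa [hq0] using this
  have hcomp2 : ∀ θ ∈ Icc (0 : ℝ) 1, (γ (B q) θ).2.1 = t + (q.2.1 - t) * θ := by
    intro θ hθ
    have := eq_add_smul_of_hasDerivWithinAt (g := fun θ => (γ (B q) θ).2.1) (c := q.2.1 - t)
      (fun θ hθ => by
        have h8 := (hqγ θ hθ).2.hasFDerivWithinAt.snd.fst.hasDerivWithinAt
        rw [(hqγ θ hθ).1.1] at h8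
        simpa [B] using h8) hθ
    rw [hq0] at this
    rw [this, smul_eq_mul, mul_comm]
  have hline : Ω.IsFlowLine (Φ.ham q.1) t (q.2.1 - t) (χ.symm ∘ fun θ => (γ (B q) θ).2.2) := by
    intro θ hθ
    have h8 : HasDerivWithinAt (fun θ => (γ (B q) θ).2.2)
        ((q.2.1 - t) • Ω.chartField Φ.ham m' (γ (B q) θ)) (Icc 0 1) θ := by
      have h9 := (hqγ θ hθ).2.hasFDerivWithinAt.snd.snd.hasDerivWithinAt
      rw [(hqγ θ hθ).1.1] at h9
      simpa [B] using h9
    have hmem : ∀ θ ∈ Icc (0 : ℝ) 1, (γ (B q) θ).2.2 ∈ χ.target := fun θ hθ =>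
      interior_subset (hqγ θ hθ).1.2.2.2
    have h10 := hasMFDerivWithinAt_extChartAt_symm_comp h8 hmem hθ
    rw [map_smul, SymplecticForm.chartField, chartSymmDeriv_chartDeriv' (hmem θ hθ),
      hcomp1 θ hθ, hcomp2 θ hθ] at h10
    exact h10
  have h11 := hline.eqOn Φ.smooth
    ((Φ.isFullOrbit q.1 ((extChartAt I m).symm q.2.2)).isFlowLine t (q.2.1 - t))
    (by
      simp only [Function.comp_apply, hq0, mul_zero, add_zero]
      exact χ.left_inv hq1) (right_mem_Icc.2 zero_le_one)
  simp only [mul_one, add_sub_cancel] at h11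
  exact h11.symm

/-- The flow is smooth at interior points. -/
theorem contMDiffAt_flowMap (m : M) (s t : ℝ) {y : Coord n}
    (hy : y ∈ interior (extChartAt I m).target) :
    ContMDiffAt 𝓘(ℝ, ℝ × ℝ × Coord n) I ∞ (Φ.flowMap m) (s, t, y) := by
  rw [contMDiffAt_infty]
  intro N
  set S : Set ℝ := {t | ContMDiffAt 𝓘(ℝ, ℝ × Coord n) I N
    (fun p : ℝ × Coord n => Φ.orbit p.1 ((extChartAt I m).symm p.2) t) (s, y)}
  have h1 : ∀ t, ContMDiffAt 𝓘(ℝ, ℝ × ℝ × Coord n) I N (Φ.flowMap m) (s, t, y) → t ∈ S := by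
    intro t ht
    have h2 : ContDiff ℝ N (fun p : ℝ × Coord n => (p.1, t, p.2)) := by fun_prop
    exact ContMDiffAt.comp (s, y) (g := Φ.flowMap m) ht h2.contMDiff.contMDiffAt
  have hstep := fun t₀ => Φ.exists_contMDiffAt_flowMap m s t₀ hy N
  -- Membership in `S` is constant near each time, so `S` is clopen; it contains `0`, where the flow
  -- is the inverse chart.
  have hopen : ∀ t₀, ∀ᶠ t in 𝓝 t₀, (t₀ ∈ S → t ∈ S) ∧ (t ∈ S → t₀ ∈ S) := by
    intro t₀
    filter_upwards [hstep t₀, (hstep t₀).self_of_nhds] with t ht ht'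
    exact ⟨fun h => h1 t (ht' h), fun h => h1 t₀ (ht.self_of_nhds h)⟩
  have hclopen : IsClopen S := by
    refine ⟨isOpen_compl_iff.1 (isOpen_iff_mem_nhds.2 fun t ht => ?_),
      isOpen_iff_mem_nhds.2 fun t ht => ?_⟩
    · filter_upwards [hopen t] with t' ht' using fun h => ht (ht'.2 h)
    · filter_upwards [hopen t] with t' ht' using ht'.1 ht
  have h0 : (0 : ℝ) ∈ S := by
    have h2 : (fun p : ℝ × Coord n => Φ.orbit p.1 ((extChartAt I m).symm p.2) 0) =
        (extChartAt I m).symm ∘ Prod.snd := by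
      funext p; exact Φ.orbit_zero _ _
    change ContMDiffAt _ _ _ _ _
    rw [h2]
    exact ((contMDiffAt_extChartAt_symm hy).of_le (mod_cast le_top)).comp (s, y)
      contDiff_snd.contMDiff.contMDiffAt
  have huniv : S = univ := (isClopen_iff.1 hclopen).resolve_left (nonempty_iff_ne_empty.1 ⟨0, h0⟩)
  exact (hstep t).self_of_nhds.self_of_nhds (show t ∈ S by rw [huniv]; trivial)

end FlowFamily

end HamiltonianSpectrum

/-! ### Calculus along the flow: derivatives in the parameter, in time and in the initial point. -/

/-- A function whose increments are given by the integrals of a continuous field of covectors along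
segments is differentiable. -/
theorem hasFDerivAt_of_sub_eq_integral {P : Type*} [NormedAddCommGroup P] [NormedSpace ℝ P]
    {N : Set P} (hN : IsOpen N) {a : P → ℝ} {L : P → P →L[ℝ] ℝ}
    (hL : ContinuousOn L N) (h : ∀ p ∈ N, ∀ v, (∀ θ ∈ Icc (0 : ℝ) 1, p + θ • v ∈ N) →
      a (p + v) - a p = ∫ θ in (0 : ℝ)..1, L (p + θ • v) v) {p : P} (hp : p ∈ N) :
    HasFDerivAt a (L p) p := by
  rw [hasFDerivAt_iff_isLittleO_nhds_zero, Asymptotics.isLittleO_iff]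
  intro c hc
  have h1 : ∀ᶠ q in 𝓝 p, q ∈ N ∧ ‖L q - L p‖ ≤ c := by
    have h2 := (hL.continuousAt (hN.mem_nhds hp))
    filter_upwards [hN.mem_nhds hp, h2.eventually_mem (Metric.closedBall_mem_nhds (L p) hc)]
      with q hq1 hq2
    exact ⟨hq1, by rwa [← dist_eq_norm]⟩
  obtain ⟨δ, hδ, hball⟩ := Metric.eventually_nhds_iff_ball.1 h1
  filter_upwards [Metric.ball_mem_nhds 0 hδ] with v hv
  have hseg : ∀ θ ∈ Icc (0 : ℝ) 1, p + θ • v ∈ Metric.ball p δ := by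
    intro θ hθ
    rw [mem_ball_iff_norm, add_sub_cancel_left, norm_smul, Real.norm_of_nonneg hθ.1]
    rw [mem_ball_zero_iff] at hv
    exact (mul_le_of_le_one_left (norm_nonneg _) hθ.2).trans_lt hv
  have hint : IntervalIntegrable (fun θ : ℝ => L (p + θ • v) v) volume 0 1 := by
    refine ContinuousOn.intervalIntegrable ?_
    rw [uIcc_of_le zero_le_one]
    exact (hL.comp (f := fun θ : ℝ => p + θ • v) (by fun_prop)
      fun θ hθ => (hball _ (hseg θ hθ)).1).clm_apply continuousOn_const
  have h3 : a (p + v) - a p - L p v = ∫ θ in (0 : ℝ)..1, (L (p + θ • v) - L p) v := by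
    rw [h p hp v fun θ hθ => (hball _ (hseg θ hθ)).1]
    simp only [sub_apply]
    rw [intervalIntegral.integral_sub hint intervalIntegrable_const]
    simp
  rw [h3]
  have h4 := intervalIntegral.norm_integral_le_of_norm_le_const (a := (0 : ℝ)) (b := 1)
    (f := fun θ => (L (p + θ • v) - L p) v) (C := c * ‖v‖) fun θ hθ => by
      rw [uIoc_of_le zero_le_one] at hθ
      exact (ContinuousLinearMap.le_opNorm _ _).trans (mul_le_mul_of_nonneg_right
        (hball _ (hseg θ (Ioc_subset_Icc_self hθ))).2 (norm_nonneg _))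
  simpa using h4

namespace HamiltonianSpectrum

variable {n : ℕ} {H : Type*} [TopologicalSpace H]
  {I : ModelWithCorners ℝ (Coord n) H}
  {M : Type*} [TopologicalSpace M] [ChartedSpace H M]

theorem chartDomain_mem_nhds {m : M} {y : Coord n} (hy : y ∈ chartDomain I m)
    (hy' : y ∈ interior (extChartAt I m).target) : chartDomain I m ∈ 𝓝 y :=
  Filter.inter_mem (Metric.isOpen_ball.mem_nhds hy.1) (Filter.mem_of_superset
    (mem_interior_iff_mem_nhds.1 hy') (extChartAt_target_subset_range m))

theorem hasMFDerivAt_of_contMDiffAt {P : Type} [NormedAddCommGroup P] [NormedSpace ℝ P]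
    {u : P → M} {p : P} (hu : ContMDiffAt 𝓘(ℝ, P) I ∞ u p) :
    HasMFDerivAt 𝓘(ℝ, P) I u p (coordDeriv I u p : P →L[ℝ] Coord n) :=
  (hu.mdifferentiableAt (by simp)).hasMFDerivAt

/-- The derivative of a function along a path. -/
theorem hasDerivAt_comp_coordDeriv {f : M → ℝ} (hf : ContMDiff I 𝓘(ℝ, ℝ) ∞ f)
    {P : Type} [NormedAddCommGroup P] [NormedSpace ℝ P]
    {u : P → M} {κ : ℝ → P} {θ : ℝ} {v : P} (hu : ContMDiffAt 𝓘(ℝ, P) I ∞ u (κ θ))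
    (hκ : HasDerivAt κ v θ) :
    HasDerivAt (fun θ => f (u (κ θ))) (coordDifferential I f (u (κ θ)) (coordDeriv I u (κ θ) v))
      θ := by
  have h0 : HasMFDerivAt I 𝓘(ℝ, ℝ) f (u (κ θ)) (coordDifferential I f (u (κ θ))) :=
    ((hf _).mdifferentiableAt (by simp)).hasMFDerivAt
  have h1 : HasFDerivAt (f ∘ u)
      ((coordDifferential I f (u (κ θ))).comp (coordDeriv I u (κ θ))) (κ θ) :=
    (h0.comp _ (hasMFDerivAt_of_contMDiffAt hu)).hasFDerivAt
  exact h1.comp_hasDerivAt θ hκ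

namespace FlowFamily

variable {Ω : SymplecticForm I M} (Φ : FlowFamily Ω)

/-- The derivative of the Hamiltonians with respect to the parameter. -/
noncomputable def hamDot (s t : ℝ) (x : M) : ℝ := deriv (fun s => Φ.ham s t x) s

variable [IsManifold I ∞ M]

theorem contMDiff_hamDot : ContMDiff (𝓘(ℝ, ℝ × ℝ).prod I) 𝓘(ℝ, ℝ) ∞
    (fun p : (ℝ × ℝ) × M => Φ.hamDot p.1.1 p.1.2 p.2) := by
  intro p
  set m := p.2
  set S : Set (ℝ × ℝ × Coord n) := univ ×ˢ univ ×ˢ (extChartAt I m).target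
  have hS : UniqueDiffOn ℝ S :=
    uniqueDiffOn_univ.prod (uniqueDiffOn_univ.prod (uniqueDiffOn_extChartAt_target m))
  have hg := contDiffOn_family_chart Φ.smooth m
  set g : ℝ × ℝ × Coord n → ℝ := fun q => Φ.ham q.1 q.2.1 ((extChartAt I m).symm q.2.2)
  have hk : ContDiffOn ℝ ∞ (fun q => fderivWithin ℝ g S q (1, 0, 0)) S :=
    (hg.fderivWithin hS (by simp)).clm_apply contDiffOn_const
  have h1 : ∀ q ∈ S, Φ.hamDot q.1 q.2.1 ((extChartAt I m).symm q.2.2) =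
      fderivWithin ℝ g S q (1, 0, 0) := by
    intro q hq
    have h2 : HasFDerivWithinAt g (fderivWithin ℝ g S q) S q :=
      (hg.differentiableOn (by simp) q hq).hasFDerivWithinAt
    have h3 : HasDerivWithinAt (fun s : ℝ => (s, q.2.1, q.2.2)) (1, 0, 0) univ q.1 :=
      (hasDerivWithinAt_id _ _).prodMk ((hasDerivWithinAt_const _ _ _).prodMk
        (hasDerivWithinAt_const _ _ _))
    have h4 := HasFDerivWithinAt.comp_hasDerivWithinAt (t := S) q.1 h2 h3
      fun s _ => ⟨trivial, trivial, hq.2.2⟩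
    exact (hasDerivWithinAt_univ.1 h4).deriv
  have hsrc : (univ : Set (ℝ × ℝ)) ×ˢ (extChartAt I m).source ∈ 𝓝 p := by
    refine prod_mem_nhds Filter.univ_mem ?_
    exact (isOpen_extChartAt_source m).mem_nhds (mem_extChartAt_source m)
  have h5 : ContMDiffOn (𝓘(ℝ, ℝ × ℝ).prod I) 𝓘(ℝ, ℝ × ℝ × Coord n) ∞
      (fun p : (ℝ × ℝ) × M => (p.1.1, p.1.2, extChartAt I m p.2))
      (univ ×ˢ (extChartAt I m).source) := by
    have h6 : ContMDiffOn (𝓘(ℝ, ℝ × ℝ).prod I) 𝓘(ℝ, Coord n) ∞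
        (fun p : (ℝ × ℝ) × M => extChartAt I m p.2) (univ ×ˢ (extChartAt I m).source) := by
      have := contMDiffOn_extChartAt (I := I) (x := m) (n := ∞)
      rw [← extChartAt_source (I := I)] at this
      exact this.comp contMDiffOn_snd fun p hp => hp.2
    have h7 : ContMDiff (𝓘(ℝ, ℝ × ℝ).prod I) 𝓘(ℝ, ℝ) ∞ (fun p : (ℝ × ℝ) × M => p.1.1) :=
      (contDiff_fst (𝕜 := ℝ) (E := ℝ) (F := ℝ)).contMDiff.comp contMDiff_fst
    have h8 : ContMDiff (𝓘(ℝ, ℝ × ℝ).prod I) 𝓘(ℝ, ℝ) ∞ (fun p : (ℝ × ℝ) × M => p.1.2) :=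
      (contDiff_snd (𝕜 := ℝ) (E := ℝ) (F := ℝ)).contMDiff.comp contMDiff_fst
    exact h7.contMDiffOn.prodMk_space (h8.contMDiffOn.prodMk_space h6)
  have h9 := (contMDiffOn_iff_contDiffOn.2 hk).comp h5
    fun p hp => ⟨trivial, trivial, (extChartAt I m).map_source hp.2⟩
  refine (h9.contMDiffAt hsrc).congr_of_eventuallyEq ?_
  filter_upwards [hsrc] with p hp
  have := h1 (p.1.1, p.1.2, extChartAt I m p.2)
    ⟨trivial, trivial, (extChartAt I m).map_source hp.2⟩
  rw [(extChartAt I m).left_inv hp.2] at this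
  exact this

omit [IsManifold I ∞ M] in
theorem hasDerivAt_ham (s t : ℝ) (x : M) :
    HasDerivAt (fun s => Φ.ham s t x) (Φ.hamDot s t x) s := by
  have h1 : ContMDiff 𝓘(ℝ, ℝ) 𝓘(ℝ, ℝ) ∞ (fun s => Φ.ham s t x) := by
    have h2 : ContMDiff 𝓘(ℝ, ℝ) 𝓘(ℝ, ℝ × ℝ) ∞ (fun s : ℝ => (s, t)) :=
      (contDiff_id.prodMk contDiff_const).contMDiff
    exact Φ.smooth.comp (h2.prodMk contMDiff_const)
  exact (h1.contDiff.differentiable (by simp) s).hasDerivAt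

variable [T2Space M]

/-- Functions of the parameters and of the flow are smooth. -/
theorem contDiffAt_comp_flowMap {f : ℝ → ℝ → M → ℝ}
    (hf : ContMDiff (𝓘(ℝ, ℝ × ℝ).prod I) 𝓘(ℝ, ℝ) ∞ (fun p : (ℝ × ℝ) × M => f p.1.1 p.1.2 p.2))
    (m : M) {q : ℝ × ℝ × Coord n} (hq : q.2.2 ∈ interior (extChartAt I m).target) :
    ContDiffAt ℝ ∞ (fun q => f q.1 q.2.1 (Φ.flowMap m q)) q := by
  have h1 : ContMDiff 𝓘(ℝ, ℝ × ℝ × Coord n) 𝓘(ℝ, ℝ × ℝ) ∞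
      (fun q : ℝ × ℝ × Coord n => (q.1, q.2.1)) :=
    (contDiff_fst.prodMk (contDiff_fst.comp contDiff_snd) :
      ContDiff ℝ ∞ fun q : ℝ × ℝ × Coord n => (q.1, q.2.1)).contMDiff
  exact contMDiffAt_iff_contDiffAt.1 (ContMDiffAt.comp q
    (g := fun p : (ℝ × ℝ) × M => f p.1.1 p.1.2 p.2) (hf _)
    (h1.contMDiffAt.prodMk (Φ.contMDiffAt_flowMap m q.1 q.2.1 hq)))

/-- The time derivative of the flow. -/
theorem coordDeriv_flowMap (m : M) {q : ℝ × ℝ × Coord n}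
    (hq : q.2.2 ∈ interior (extChartAt I m).target) :
    coordDeriv I (Φ.flowMap m) q (0, 1, 0) = Ω.hamField (Φ.ham q.1 q.2.1) (Φ.flowMap m q) := by
  have h1 : HasFDerivAt (fun t : ℝ => (q.1, t, q.2.2))
      ((1 : ℝ →L[ℝ] ℝ).smulRight ((0 : ℝ), (1 : ℝ), (0 : Coord n))) q.2.1 :=
    ((hasDerivAt_const _ _).prodMk ((hasDerivAt_id _).prodMk (hasDerivAt_const _ _))).hasFDerivAt
  have h2 : HasMFDerivAt 𝓘(ℝ, ℝ) I (fun t => Φ.flowMap m (q.1, t, q.2.2)) q.2.1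
      ((coordDeriv I (Φ.flowMap m) q).comp
        ((1 : ℝ →L[ℝ] ℝ).smulRight ((0 : ℝ), (1 : ℝ), (0 : Coord n)))) :=
    HasMFDerivAt.comp q.2.1 (g := Φ.flowMap m) (f := fun t : ℝ => (q.1, t, q.2.2))
      (hasMFDerivAt_of_contMDiffAt (Φ.contMDiffAt_flowMap m q.1 q.2.1 hq)) h1.hasMFDerivAt
  have h3 := hasMFDerivAt_unique h2 (Φ.isFullOrbit q.1 ((extChartAt I m).symm q.2.2) q.2.1)
  have h4 := DFunLike.congr_fun h3 (1 : ℝ)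
  have h5 : ((coordDeriv I (Φ.flowMap m) q).comp
        ((1 : ℝ →L[ℝ] ℝ).smulRight ((0 : ℝ), (1 : ℝ), (0 : Coord n)))) 1 =
      coordDeriv I (Φ.flowMap m) q (0, 1, 0) := by simp
  have h6 : ((1 : ℝ →L[ℝ] ℝ).smulRight
      (Ω.hamField (Φ.ham q.1 q.2.1) (Φ.orbit q.1 ((extChartAt I m).symm q.2.2) q.2.1))) (1 : ℝ) =
      Ω.hamField (Φ.ham q.1 q.2.1) (Φ.flowMap m q) := by simp [flowMap]
  exact h5.symm.trans (h4.trans h6)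

end FlowFamily

end HamiltonianSpectrum

/-! ### The first variation of the action. -/

namespace HamiltonianSpectrum

variable {n : ℕ} {H : Type*} [TopologicalSpace H]
  {I : ModelWithCorners ℝ (Coord n) H}
  {M : Type*} [TopologicalSpace M] [ChartedSpace H M]

theorem coordDeriv_comp {P Q : Type} [NormedAddCommGroup P] [NormedSpace ℝ P]
    [NormedAddCommGroup Q] [NormedSpace ℝ Q] {u : P → M} {κ : Q → P} {κ' : Q →L[ℝ] P} {q : Q}
    (hu : ContMDiffAt 𝓘(ℝ, P) I ∞ u (κ q)) (hκ : HasFDerivAt κ κ' q) (a : Q) :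
    coordDeriv I (fun q => u (κ q)) q a = coordDeriv I u (κ q) (κ' a) := by
  have h1 : HasMFDerivAt 𝓘(ℝ, Q) I (fun q => u (κ q)) q
      ((coordDeriv I u (κ q)).comp κ' : Q →L[ℝ] Coord n) :=
    HasMFDerivAt.comp q (g := u) (hasMFDerivAt_of_contMDiffAt hu) hκ.hasMFDerivAt
  exact DFunLike.congr_fun h1.mfderiv a

namespace FlowFamily

variable {Ω : SymplecticForm I M} (Φ : FlowFamily Ω)

/-- The action of the orbit with parameter and initial point `p`, relative to that of a fixed
orbit. -/
noncomputable def relAction (l : List (DeformationStep I M)) (s₀ : ℝ) (x₀ : M) (t₁ : ℝ)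
    (p : ℝ × Coord n) : ℝ :=
  (∫ τ in (0 : ℝ)..1, Ω.deformationForm l (fun τ => Φ.orbit s₀ x₀ (t₁ * τ))
    (fun τ => Φ.flowMap x₀ (p.1, t₁ * τ, p.2)) τ) -
  t₁ * ∫ τ in (0 : ℝ)..1, Φ.ham p.1 (t₁ * τ) (Φ.flowMap x₀ (p.1, t₁ * τ, p.2))

/-- The end point of the orbit with parameter and initial point `p`, in coordinates. -/
noncomputable def flowEnd (x₀ x₁ : M) (t₁ : ℝ) (p : ℝ × Coord n) : Coord n :=
  extChartAt I x₁ (Φ.flowMap x₀ (p.1, t₁, p.2))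

/-- The mean of the derivative of the Hamiltonian along an orbit. -/
noncomputable def meanDot (x₀ : M) (t₁ : ℝ) (p : ℝ × Coord n) : ℝ :=
  ∫ τ in (0 : ℝ)..1, Φ.hamDot p.1 (t₁ * τ) (Φ.flowMap x₀ (p.1, t₁ * τ, p.2))

/-- The first variation of the action. -/
noncomputable def variation (x₀ x₁ : M) (t₁ : ℝ) (p : ℝ × Coord n) : ℝ × Coord n →L[ℝ] ℝ :=
  (Ω.primitive x₀ p.2).comp (ContinuousLinearMap.snd ℝ ℝ (Coord n)) -
  (Ω.primitive x₁ (Φ.flowEnd x₀ x₁ t₁ p)).comp (fderiv ℝ (Φ.flowEnd x₀ x₁ t₁) p) -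
  (t₁ * Φ.meanDot x₀ t₁ p) • ContinuousLinearMap.fst ℝ ℝ (Coord n)

/-- The parameters and initial points at which the relative action is well behaved. -/
def Admissible (l : List (DeformationStep I M)) (s₀ : ℝ) (x₀ : M) (t₁ : ℝ) (p : ℝ × Coord n) :
    Prop :=
  p.2 ∈ chartDomain I x₀ ∧ p.2 ∈ interior (extChartAt I x₀).target ∧
    ∀ τ ∈ Icc (0 : ℝ) 1, NearAll l (Φ.orbit s₀ x₀ (t₁ * τ)) (Φ.flowMap x₀ (p.1, t₁ * τ, p.2))

variable [IsManifold I ∞ M] [T2Space M]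

omit [IsManifold I ∞ M] [T2Space M] in
theorem flowMap_center (s₀ : ℝ) (x₀ : M) (t : ℝ) :
    Φ.flowMap x₀ (s₀, t, extChartAt I x₀ x₀) = Φ.orbit s₀ x₀ t := by
  simp [flowMap]

theorem eventually_admissible (l : List (DeformationStep I M)) (s₀ : ℝ) {x₀ : M}
    (hx₀ : x₀ ∈ I.interior M) (t₁ : ℝ) :
    ∀ᶠ p in 𝓝 (s₀, extChartAt I x₀ x₀), Φ.Admissible l s₀ x₀ t₁ p := by
  have hint := extChartAt_mem_interior_target hx₀ (mem_extChartAt_source (I := I) x₀)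
  have hsnd : Filter.Tendsto Prod.snd (𝓝 (s₀, extChartAt I x₀ x₀)) (𝓝 (extChartAt I x₀ x₀)) :=
    continuousAt_snd
  have h1 : ∀ᶠ p : ℝ × Coord n in 𝓝 (s₀, extChartAt I x₀ x₀),
      p.2 ∈ chartDomain I x₀ ∧ p.2 ∈ interior (extChartAt I x₀).target :=
    (hsnd.eventually_mem
      (chartDomain_mem_nhds (extChartAt_mem_chartDomain (mem_chartNhd_self x₀)) hint)).and
      (hsnd.eventually_mem (isOpen_interior.mem_nhds hint))
  have h2 : ∀ᶠ p : ℝ × Coord n in 𝓝 (s₀, extChartAt I x₀ x₀), ∀ τ ∈ Icc (0 : ℝ) 1,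
      NearAll l (Φ.orbit s₀ x₀ (t₁ * τ)) (Φ.flowMap x₀ (p.1, t₁ * τ, p.2)) := by
    refine isCompact_Icc.eventually_forall_of_forall_eventually
      (P := fun (p : ℝ × Coord n) (τ : ℝ) => NearAll l (Φ.orbit s₀ x₀ (t₁ * τ))
        (Φ.flowMap x₀ (p.1, t₁ * τ, p.2))) fun τ _ => ?_
    have h3 : ContinuousAt (fun z : (ℝ × Coord n) × ℝ => (Φ.orbit s₀ x₀ (t₁ * z.2),
        Φ.flowMap x₀ (z.1.1, t₁ * z.2, z.1.2))) ((s₀, extChartAt I x₀ x₀), τ) := by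
      refine ContinuousAt.prodMk ?_ ?_
      · exact ((Φ.continuous_orbit s₀ x₀).comp (by fun_prop)).continuousAt
      · exact ContinuousAt.comp (g := Φ.flowMap x₀)
          (f := fun z : (ℝ × Coord n) × ℝ => (z.1.1, t₁ * z.2, z.1.2))
          (Φ.contMDiffAt_flowMap x₀ _ _ hint).continuousAt (by fun_prop)
    have h4 : NearAll l (Φ.orbit s₀ x₀ (t₁ * τ))
        (Φ.flowMap x₀ (s₀, t₁ * τ, extChartAt I x₀ x₀)) := by
      rw [flowMap_center]
      exact nearAll_self l _
    have h5 := (isOpen_nearAll l).mem_nhds (x := (Φ.orbit s₀ x₀ (t₁ * τ),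
      Φ.flowMap x₀ (s₀, t₁ * τ, extChartAt I x₀ x₀))) h4
    exact h3 h5
  exact (h1.and h2).mono fun p hp => ⟨hp.1.1, hp.1.2, hp.2⟩

/-- The time argument of the Hamiltonian is frozen at `c.2.1`; in the application `w` has no time
component. Separating the occurrences of `θ` in the parameter and in the point gives a function of
two variables, and the derivative along its diagonal is the sum of the two partial derivatives. -/
theorem hasDerivAt_ham_flowMap (m : M) (c w : ℝ × ℝ × Coord n) (θ : ℝ)
    (hθ : (c + θ • w).2.2 ∈ interior (extChartAt I m).target) :
    HasDerivAt (fun θ : ℝ => Φ.ham (c + θ • w).1 c.2.1 (Φ.flowMap m (c + θ • w)))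
      (w.1 * Φ.hamDot (c + θ • w).1 c.2.1 (Φ.flowMap m (c + θ • w)) +
        coordDifferential I (Φ.ham (c + θ • w).1 c.2.1) (Φ.flowMap m (c + θ • w))
          (coordDeriv I (Φ.flowMap m) (c + θ • w) w)) θ := by
  set κ : ℝ → ℝ × ℝ × Coord n := fun θ => c + θ • w
  have hκ : ∀ θ, HasDerivAt κ w θ := fun θ => by
    have := ((hasDerivAt_id θ).smul_const w).const_add c
    rw [one_smul] at this
    exact this
  have hu : ContMDiffAt 𝓘(ℝ, ℝ × ℝ × Coord n) I ∞ (Φ.flowMap m) (κ θ) :=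
    Φ.contMDiffAt_flowMap m _ _ hθ
  set F : ℝ × ℝ → ℝ := fun a => Φ.ham (κ a.1).1 c.2.1 (Φ.flowMap m (κ a.2))
  have hF : ContMDiffAt 𝓘(ℝ, ℝ × ℝ) 𝓘(ℝ, ℝ) ∞ F (θ, θ) := by
    have h1 : ContDiff ℝ ∞ (fun a : ℝ × ℝ => ((κ a.1).1, c.2.1)) := by fun_prop
    have h2 : ContDiff ℝ ∞ (fun a : ℝ × ℝ => κ a.2) := by fun_prop
    have h3 : ContMDiffAt 𝓘(ℝ, ℝ × ℝ) I ∞ (fun a : ℝ × ℝ => Φ.flowMap m (κ a.2)) (θ, θ) :=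
      ContMDiffAt.comp (θ, θ) (g := Φ.flowMap m) (f := fun a : ℝ × ℝ => κ a.2) hu
        h2.contMDiff.contMDiffAt
    exact ContMDiffAt.comp (θ, θ) (g := fun p : (ℝ × ℝ) × M => Φ.ham p.1.1 p.1.2 p.2)
      (Φ.smooth _) (h1.contMDiff.contMDiffAt.prodMk h3)
  have hFd : HasFDerivAt F (fderiv ℝ F (θ, θ)) (θ, θ) :=
    (hF.contDiffAt.differentiableAt (by simp)).hasFDerivAt
  have e1 : fderiv ℝ F (θ, θ) (1, 0) = w.1 * Φ.hamDot (κ θ).1 c.2.1 (Φ.flowMap m (κ θ)) := by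
    have h4 : HasDerivAt (fun a : ℝ => (a, θ)) ((1 : ℝ), (0 : ℝ)) θ :=
      (hasDerivAt_id θ).prodMk (hasDerivAt_const θ θ)
    have h5 := HasFDerivAt.comp_hasDerivAt θ (f := fun a : ℝ => (a, θ)) hFd h4
    have h6 : HasDerivAt (fun a => (κ a).1) w.1 θ := by
      simpa using (hκ θ).hasFDerivAt.fst.hasDerivAt
    have h7 := (Φ.hasDerivAt_ham (κ θ).1 c.2.1 (Φ.flowMap m (κ θ))).comp θ h6
    rw [mul_comm]
    exact h5.unique h7
  have e2 : fderiv ℝ F (θ, θ) (0, 1) = coordDifferential I (Φ.ham (κ θ).1 c.2.1)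
      (Φ.flowMap m (κ θ)) (coordDeriv I (Φ.flowMap m) (κ θ) w) := by
    have h4 : HasDerivAt (fun a : ℝ => (θ, a)) ((0 : ℝ), (1 : ℝ)) θ :=
      (hasDerivAt_const θ θ).prodMk (hasDerivAt_id θ)
    have h5 := HasFDerivAt.comp_hasDerivAt θ (f := fun a : ℝ => (θ, a)) hFd h4
    exact h5.unique (hasDerivAt_comp_coordDeriv (contMDiff_slice Φ.smooth (κ θ).1 c.2.1) hu (hκ θ))
  have h8 : HasDerivAt (fun a : ℝ => (a, a)) ((1 : ℝ), (1 : ℝ)) θ :=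
    (hasDerivAt_id θ).prodMk (hasDerivAt_id θ)
  have h9 := HasFDerivAt.comp_hasDerivAt θ (f := fun a : ℝ => (a, a)) hFd h8
  rw [show ((1 : ℝ), (1 : ℝ)) = (1, 0) + (0, 1) by simp, map_add, e1, e2] at h9
  exact h9

theorem contDiffAt_flowEnd {x₀ x₁ : M} {t₁ : ℝ} {p : ℝ × Coord n}
    (hp : p.2 ∈ interior (extChartAt I x₀).target)
    (hp₁ : Φ.flowMap x₀ (p.1, t₁, p.2) ∈ (extChartAt I x₁).source) :
    ContDiffAt ℝ ∞ (Φ.flowEnd x₀ x₁ t₁) p := by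
  have h1 : ContDiff ℝ ∞ (fun p : ℝ × Coord n => (p.1, t₁, p.2)) := by fun_prop
  have h2 : ContMDiffAt 𝓘(ℝ, ℝ × Coord n) I ∞
      (fun p : ℝ × Coord n => Φ.flowMap x₀ (p.1, t₁, p.2)) p :=
    ContMDiffAt.comp p (g := Φ.flowMap x₀) (f := fun p : ℝ × Coord n => (p.1, t₁, p.2))
      (Φ.contMDiffAt_flowMap x₀ _ _ hp) h1.contMDiff.contMDiffAt
  exact contDiffAt_extChartAt_comp h2 hp₁

theorem contDiffOn_meanDot {x₀ : M} (t₁ : ℝ) {N : Set (ℝ × Coord n)} (hN : IsOpen N)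
    (hNc : Convex ℝ N) (h : ∀ p ∈ N, p.2 ∈ interior (extChartAt I x₀).target) :
    ContDiffOn ℝ ∞ (Φ.meanDot x₀ t₁) N := by
  refine contDiffOn_integral_Icc_zero_one hNc hN.uniqueDiffOn
    (Φ := fun τ p => Φ.hamDot p.1 (t₁ * τ) (Φ.flowMap x₀ (p.1, t₁ * τ, p.2))) fun z hz => ?_
  have h1 : ContDiff ℝ ∞ (fun z : ℝ × ℝ × Coord n => (z.2.1, t₁ * z.1, z.2.2)) := by fun_prop
  exact (ContDiffAt.comp z (f := fun z : ℝ × ℝ × Coord n => (z.2.1, t₁ * z.1, z.2.2))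
    (Φ.contDiffAt_comp_flowMap Φ.contMDiff_hamDot x₀ (h z.2 hz.2)) h1.contDiffAt).contDiffWithinAt

section

variable {l : List (DeformationStep I M)} {s₀ t₁ : ℝ} {x₀ x₁ : M}
  (hl : Covers l ((fun τ => Φ.orbit s₀ x₀ (t₁ * τ)) '' Icc 0 1)) (hl₀ : LeadsAt l x₀)
  (hl₁ : LeadsAt l x₁) (hx₁ : Φ.orbit s₀ x₀ t₁ = x₁)
  {N : Set (ℝ × Coord n)} (hN : IsOpen N) (hNc : Convex ℝ N)
  (hNa : ∀ p ∈ N, Φ.Admissible l s₀ x₀ t₁ p)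

include hNa hl₁ hx₁

omit [IsManifold I ∞ M] [T2Space M] in
-- The nearness condition at `τ = 1` asks the first effective step, centred at `x₁`, to have the end
-- point in its chart. A constant curve suffices because only the position matters.
theorem flowEnd_mem {p : ℝ × Coord n} (hp : p ∈ N) :
    Φ.flowMap x₀ (p.1, t₁, p.2) ∈ chartNhd I x₁ := by
  have h1 := (hNa p hp).2.2 1 (right_mem_Icc.2 zero_le_one)
  rw [mul_one, hx₁] at h1
  exact (Ω.deformationForm_of_leadsAt hl₁ (γ := fun _ => Φ.flowMap x₀ (p.1, t₁, p.2)) (t := 0)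
    continuousAt_const h1).2

include hN hNc

theorem contDiffOn_variation : ContDiffOn ℝ ∞ (Φ.variation x₀ x₁ t₁) N := by
  have h1 : ContDiffOn ℝ ∞ (fun p : ℝ × Coord n => Ω.primitive x₀ p.2) N := fun p hp =>
    (((Ω.contDiffOn_primitive x₀).contDiffAt
      (chartDomain_mem_nhds (hNa p hp).1 (hNa p hp).2.1)).comp p
      contDiffAt_snd).contDiffWithinAt
  have h2 : ContDiffOn ℝ ∞ (Φ.flowEnd x₀ x₁ t₁) N := fun p hp =>
    (Φ.contDiffAt_flowEnd (hNa p hp).2.1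
      (chartNhd_subset_source _ (Φ.flowEnd_mem hl₁ hx₁ hNa hp))).contDiffWithinAt
  have h3 : ContDiffOn ℝ ∞ (fun p => Ω.primitive x₁ (Φ.flowEnd x₀ x₁ t₁ p)) N :=
    (Ω.contDiffOn_primitive x₁).comp h2 fun p hp =>
      extChartAt_mem_chartDomain (Φ.flowEnd_mem hl₁ hx₁ hNa hp)
  have h4 : ContDiffOn ℝ ∞ (fderiv ℝ (Φ.flowEnd x₀ x₁ t₁)) N :=
    h2.fderiv_of_isOpen hN (by simp)
  have h5 := Φ.contDiffOn_meanDot t₁ hN hNc fun p hp => (hNa p hp).2.1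
  exact ((h1.clm_comp contDiffOn_const).sub (h3.clm_comp h4)).sub
    ((contDiffOn_const.mul h5).smul contDiffOn_const)

include hl hl₀

set_option maxHeartbeats 1000000 in
-- Stokes' theorem compares the square `U` formed by the orbits with data `p + θ • v` at times `t₁
-- τ` with the square `U₀` of the fixed orbit. Since `U₀` does not depend on `θ`, it has no area.
-- The sides `τ = 0, 1` give the primitives at `x₀` and `x₁`, the sides `θ = 0, 1` the deformation
-- integrals in the relative actions. By Hamilton's equation the density of `U` is `-t₁ dH(∂_θ U)`,
-- that is, `-t₁` times the `θ`-derivative of `H` along `U` without the contribution of `∂_s H`.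
theorem relAction_sub (hx₀ : x₀ ∈ I.interior M) {p v : ℝ × Coord n} (hv : ∀ θ ∈ Icc (0 : ℝ) 1, p + θ • v ∈ N) :
    Φ.relAction l s₀ x₀ t₁ (p + v) - Φ.relAction l s₀ x₀ t₁ p =
      ∫ θ in (0 : ℝ)..1, Φ.variation x₀ x₁ t₁ (p + θ • v) v := by
  set a : ℝ × ℝ × Coord n := (v.1, 0, v.2)
  set κ' : ℝ × ℝ →L[ℝ] ℝ × ℝ × Coord n :=
    (ContinuousLinearMap.fst ℝ ℝ ℝ).smulRight a +
      (ContinuousLinearMap.snd ℝ ℝ ℝ).smulRight (0, t₁, 0)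
  set κ : ℝ × ℝ → ℝ × ℝ × Coord n := fun q => (p.1, 0, p.2) + κ' q
  have hκ : ∀ q, HasFDerivAt κ κ' q := fun q => κ'.hasFDerivAt.const_add _
  have hκv : ∀ q : ℝ × ℝ, κ q = ((p + q.1 • v).1, t₁ * q.2, (p + q.1 • v).2) := by
    intro q
    simp [κ, κ', a, mul_comm]
  set U : ℝ × ℝ → M := fun q => Φ.flowMap x₀ (κ q)
  set U₀ : ℝ × ℝ → M := fun q => Φ.orbit s₀ x₀ (t₁ * q.2)
  have hκi : ∀ q ∈ unitSquare, (κ q).2.2 ∈ interior (extChartAt I x₀).target := by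
    intro q hq
    rw [hκv]
    exact (hNa _ (hv q.1 hq.1)).2.1
  have hκd : ContDiff ℝ ∞ κ := by fun_prop
  have hflow : ∀ q ∈ unitSquare, ContMDiffAt 𝓘(ℝ, ℝ × ℝ × Coord n) I ∞ (Φ.flowMap x₀) (κ q) :=
    fun q hq => Φ.contMDiffAt_flowMap x₀ _ _ (hκi q hq)
  have hU : ∀ q ∈ unitSquare, ContMDiffAt 𝓘(ℝ, ℝ × ℝ) I ∞ U q := fun q hq =>
    ContMDiffAt.comp q (g := Φ.flowMap x₀) (hflow q hq) hκd.contMDiff.contMDiffAt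
  have hx₀i : extChartAt I x₀ x₀ ∈ interior (extChartAt I x₀).target :=
    extChartAt_mem_interior_target hx₀ (mem_extChartAt_source x₀)
  have hU₀ : ∀ q ∈ unitSquare, ContMDiffAt 𝓘(ℝ, ℝ × ℝ) I ∞ U₀ q := by
    intro q hq
    have h1 : ContDiff ℝ ∞ (fun q : ℝ × ℝ => (s₀, t₁ * q.2, extChartAt I x₀ x₀)) := by fun_prop
    have h2 := ContMDiffAt.comp q (g := Φ.flowMap x₀)
      (Φ.contMDiffAt_flowMap x₀ s₀ (t₁ * q.2) hx₀i) h1.contMDiff.contMDiffAt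
    refine h2.congr_of_eventuallyEq (Filter.Eventually.of_forall fun q => ?_)
    exact (Φ.flowMap_center _ _ _).symm
  have h00 : (0 : ℝ) ∈ Icc (0 : ℝ) 1 := by simp
  have h11 : (1 : ℝ) ∈ Icc (0 : ℝ) 1 := by simp
  have hn : ∀ q ∈ unitSquare, NearAll l (U₀ q) (U q) := by
    intro q hq
    have := (hNa _ (hv q.1 hq.1)).2.2 q.2 hq.2
    rwa [← hκv] at this
  have hUim : U₀ '' unitSquare ⊆ (fun τ => Φ.orbit s₀ x₀ (t₁ * τ)) '' Icc 0 1 := by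
    rintro _ ⟨q, hq, rfl⟩
    exact ⟨q.2, hq.2, rfl⟩
  have hstokes := Ω.integral_density_sub hU₀ hU hn (fun x hx => hl x (hUim hx))
  have hd₀ : ∀ q, Ω.density U₀ q = 0 := by
    intro q
    have h1 : coordDeriv I U₀ q (1, 0) = 0 := by
      have h2 : HasFDerivAt (fun q : ℝ × ℝ => (s₀, t₁ * q.2, extChartAt I x₀ x₀))
          ((ContinuousLinearMap.snd ℝ ℝ ℝ).smulRight ((0 : ℝ), t₁, (0 : Coord n))) q := by
        have h3 := ((ContinuousLinearMap.snd ℝ ℝ ℝ).smulRight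
          ((0 : ℝ), t₁, (0 : Coord n))).hasFDerivAt (x := q)
        refine (h3.const_add (s₀, 0, extChartAt I x₀ x₀)).congr_of_eventuallyEq
          (Filter.Eventually.of_forall fun q => ?_)
        simp [mul_comm]
      have h3 := coordDeriv_comp (u := Φ.flowMap x₀)
        (κ := fun q : ℝ × ℝ => (s₀, t₁ * q.2, extChartAt I x₀ x₀))
        (Φ.contMDiffAt_flowMap x₀ s₀ (t₁ * q.2) hx₀i) h2 (1, 0)
      have h4 : U₀ = fun q : ℝ × ℝ => Φ.flowMap x₀ (s₀, t₁ * q.2, extChartAt I x₀ x₀) :=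
        funext fun q => (Φ.flowMap_center _ _ _).symm
      rw [h4, h3]
      simp
    rw [SymplecticForm.density, h1]
    simp
  have hdU : ∀ q ∈ unitSquare, Ω.density U q = - t₁ *
      (coordDifferential I (Φ.ham (κ q).1 (κ q).2.1) (U q)
        (coordDeriv I (Φ.flowMap x₀) (κ q) a)) := by
    intro q hq
    have e1 : coordDeriv I U q (1, 0) = coordDeriv I (Φ.flowMap x₀) (κ q) a := by
      rw [coordDeriv_comp (hflow q hq) (hκ q)]
      simp [κ']
    have e2 : coordDeriv I U q (0, 1) = t₁ • Ω.hamField (Φ.ham (κ q).1 (κ q).2.1) (U q) := by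
      rw [coordDeriv_comp (hflow q hq) (hκ q), ← Φ.coordDeriv_flowMap x₀ (hκi q hq), ← map_smul]
      simp [κ']
    rw [SymplecticForm.density, e1, e2, map_smul, Ω.bilin_swap, Ω.bilin_hamField, smul_eq_mul]
    ring
  set h : ℝ × ℝ → ℝ := fun q => Φ.ham (κ q).1 (κ q).2.1 (U q)
  set g : ℝ × ℝ → ℝ := fun q => Φ.hamDot (κ q).1 (κ q).2.1 (U q)
  have hh : ∀ q ∈ unitSquare, ContDiffAt ℝ ∞ h q := fun q hq =>
    ContDiffAt.comp q (Φ.contDiffAt_comp_flowMap Φ.smooth x₀ (hκi q hq)) hκd.contDiffAt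
  have hg : ContinuousOn g unitSquare := fun q hq =>
    (ContDiffAt.comp q (Φ.contDiffAt_comp_flowMap Φ.contMDiff_hamDot x₀ (hκi q hq))
      hκd.contDiffAt).continuousAt.continuousWithinAt
  have hhd : ∀ q ∈ unitSquare, HasFDerivAt h (fderiv ℝ h q) q := fun q hq =>
    ((hh q hq).differentiableAt (by simp)).hasFDerivAt
  have hh' : ∀ q ∈ unitSquare, Ω.density U q = - t₁ * (fderiv ℝ h q (1, 0) - v.1 * g q) := by
    intro q hq
    have h1 : ∀ θ : ℝ, κ (θ, q.2) = κ (0, q.2) + θ • a := by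
      intro θ
      refine Prod.ext ?_ (Prod.ext ?_ ?_) <;> simp [κ, κ', a]
    have h2 := Φ.hasDerivAt_ham_flowMap x₀ (κ (0, q.2)) a q.1 (by
      rw [← h1]; exact hκi q hq)
    have h3 : HasDerivAt (fun θ : ℝ => (θ, q.2)) ((1 : ℝ), (0 : ℝ)) q.1 :=
      (hasDerivAt_id _).prodMk (hasDerivAt_const _ _)
    have h4 := HasFDerivAt.comp_hasDerivAt q.1 (f := fun θ : ℝ => (θ, q.2)) (hhd q hq) h3
    have h5 : ∀ q, (κ q).2.1 = t₁ * q.2 := fun q => by rw [hκv]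
    have h6 : (h ∘ fun θ : ℝ => (θ, q.2)) = fun θ : ℝ => Φ.ham (κ (0, q.2) + θ • a).1
        (κ (0, q.2)).2.1 (Φ.flowMap x₀ (κ (0, q.2) + θ • a)) := by
      funext θ
      simp only [Function.comp_apply, h, U, ← h1, h5]
    rw [h6] at h4
    have h7 := h4.unique h2
    rw [← h1, h5] at h7
    rw [h7, hdU q hq]
    simp only [g, U, h5, a, add_sub_cancel_left]
  have hsq : MeasurableSet unitSquare := measurableSet_Icc.prod measurableSet_Icc
  have hcpt : IsCompact unitSquare := isCompact_Icc.prod isCompact_Icc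
  have hcf : ContinuousOn (fun q => fderiv ℝ h q (1, 0)) unitSquare := fun q hq =>
    (((hh q hq).fderiv_right (m := 0) (by simp)).continuousAt.clm_apply
      continuousAt_const).continuousWithinAt
  -- The fundamental theorem of calculus in the variable `θ`, as the divergence theorem for a field
  -- with second component zero.
  have hdiv := integral_divergence_prod_Icc_of_hasFDerivAt_of_le
    h (fun _ => 0) (fderiv ℝ h) (fun _ => 0) (0, 0) (1, 1) (by simp)
    (by rw [← unitSquare_eq]; exact fun q hq => (hh q hq).continuousAt.continuousWithinAt)
    continuousOn_const (fun q hq => hhd q ⟨Ioo_subset_Icc_self hq.1, Ioo_subset_Icc_self hq.2⟩)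
    (fun q _ => hasFDerivAt_const _ _)
    (by
      rw [← unitSquare_eq]
      simpa using hcf.integrableOn_compact hcpt)
  rw [← unitSquare_eq] at hdiv
  simp only [zero_apply, add_zero, intervalIntegral.integral_zero, sub_self, zero_add] at hdiv
  have hfub : ∫ q in unitSquare, g q =
      ∫ θ in (0 : ℝ)..1, Φ.meanDot x₀ t₁ (p + θ • v) := by
    rw [unitSquare, Measure.volume_eq_prod, setIntegral_prod _
      (by rw [← Measure.volume_eq_prod]; exact hg.integrableOn_compact hcpt),
      intervalIntegral.integral_of_le zero_le_one, ← integral_Icc_eq_integral_Ioc]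
    refine setIntegral_congr_fun measurableSet_Icc fun θ _ => ?_
    simp only [meanDot]
    rw [intervalIntegral.integral_of_le zero_le_one, ← integral_Icc_eq_integral_Ioc]
    refine setIntegral_congr_fun measurableSet_Icc fun τ _ => ?_
    simp only [g, U, hκv]
  have harea : ∫ q in unitSquare, Ω.density U q =
      - t₁ * (((∫ τ in (0 : ℝ)..1, h (1, τ)) - ∫ τ in (0 : ℝ)..1, h (0, τ)) -
        v.1 * ∫ θ in (0 : ℝ)..1, Φ.meanDot x₀ t₁ (p + θ • v)) := by
    rw [setIntegral_congr_fun hsq hh', integral_const_mul,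
      integral_sub (hcf.integrableOn_compact hcpt) ((hg.integrableOn_compact hcpt).const_mul _),
      integral_const_mul, hfub, hdiv]
  have hcont : ∀ θ ∈ Icc (0 : ℝ) 1, ∀ τ ∈ Icc (0 : ℝ) 1,
      ContinuousAt (fun θ => U (θ, τ)) θ := fun θ hθ τ hτ =>
    ContinuousAt.comp (g := U) (f := fun θ : ℝ => (θ, τ)) (hU (θ, τ) ⟨hθ, hτ⟩).continuousAt
      (by fun_prop)
  -- On this side `U₀` rests at `x₁`, where the list leads, so the deformation form is minus the
  -- primitive at `x₁` along the end points.
  have htop : ∀ θ ∈ Icc (0 : ℝ) 1, Ω.deformationForm l (fun t => U₀ (t, 1)) (fun t => U (t, 1)) θ =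
      - Ω.primitive x₁ (Φ.flowEnd x₀ x₁ t₁ (p + θ • v))
        (fderiv ℝ (Φ.flowEnd x₀ x₁ t₁) (p + θ • v) v) := by
    intro θ hθ
    have e1 : (fun t : ℝ => U₀ (t, 1)) = fun _ => x₁ := by
      funext t
      simp only [U₀, mul_one, hx₁]
    have e2 := hn (θ, 1) ⟨hθ, h11⟩
    rw [show U₀ (θ, 1) = x₁ from congrFun e1 θ] at e2
    rw [e1, (Ω.deformationForm_of_leadsAt hl₁ (hcont θ hθ 1 h11) e2).1,
      SymplecticForm.lineForm]
    have e3 : (extChartAt I x₁ ∘ fun t => U (t, 1)) =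
        Φ.flowEnd x₀ x₁ t₁ ∘ fun θ : ℝ => p + θ • v := by
      funext t
      simp only [Function.comp_apply, flowEnd, U, hκv, mul_one]
    have e4 : HasDerivAt (fun θ : ℝ => p + θ • v) v θ := by
      have := ((hasDerivAt_id θ).smul_const v).const_add p
      rw [one_smul] at this
      exact this
    have e5 : HasFDerivAt (Φ.flowEnd x₀ x₁ t₁) (fderiv ℝ (Φ.flowEnd x₀ x₁ t₁) (p + θ • v))
        (p + θ • v) :=
      ((Φ.contDiffAt_flowEnd (hNa _ (hv θ hθ)).2.1 (chartNhd_subset_source _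
        (Φ.flowEnd_mem hl₁ hx₁ hNa (hv θ hθ)))).differentiableAt (by simp)).hasFDerivAt
    rw [e3, (e5.comp_hasDerivAt θ e4).deriv]
    congr 2
    exact congrArg _ (congrFun e3 θ)
  have hbot : ∀ θ ∈ Icc (0 : ℝ) 1, Ω.deformationForm l (fun t => U₀ (t, 0)) (fun t => U (t, 0)) θ =
      - Ω.primitive x₀ (p + θ • v).2 v.2 := by
    intro θ hθ
    have e1 : (fun t : ℝ => U₀ (t, 0)) = fun _ => x₀ := by
      funext t
      simp only [U₀, mul_zero, Φ.orbit_zero]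
    have e2 := hn (θ, 0) ⟨hθ, h00⟩
    rw [show U₀ (θ, 0) = x₀ from congrFun e1 θ] at e2
    rw [e1, (Ω.deformationForm_of_leadsAt hl₀ (hcont θ hθ 0 h00) e2).1,
      SymplecticForm.lineForm]
    have e4 : HasDerivAt (fun θ : ℝ => (p + θ • v).2) v.2 θ := by
      have := ((hasDerivAt_id θ).smul_const v.2).const_add p.2
      rw [one_smul] at this
      exact this
    have e3 : (extChartAt I x₀ ∘ fun t => U (t, 0)) =ᶠ[𝓝 θ] fun θ : ℝ => (p + θ • v).2 := by
      have e6 := e4.continuousAt.eventually_mem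
        (mem_interior_iff_mem_nhds.1 (hNa _ (hv θ hθ)).2.1)
      filter_upwards [e6] with t ht
      simp only [Function.comp_apply, U, hκv, mul_zero, flowMap, Φ.orbit_zero]
      exact (extChartAt I x₀).right_inv ht
    rw [e3.deriv_eq, e4.deriv]
    congr 2
    exact congrArg _ e3.self_of_nhds
  have hfin : ∀ θ : ℝ, Φ.variation x₀ x₁ t₁ (p + θ • v) v =
      Ω.primitive x₀ (p + θ • v).2 v.2 - Ω.primitive x₁ (Φ.flowEnd x₀ x₁ t₁ (p + θ • v))
        (fderiv ℝ (Φ.flowEnd x₀ x₁ t₁) (p + θ • v) v) -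
        t₁ * v.1 * Φ.meanDot x₀ t₁ (p + θ • v) := by
    intro θ
    change _ - _ - t₁ * Φ.meanDot x₀ t₁ (p + θ • v) * v.1 = _
    rw [mul_right_comm]
    rfl
  have hconts := (Ω.integral_density_moves l hU₀ hU hn).2
  have hint : ∀ {f : ℝ → ℝ}, ContinuousOn f (Icc 0 1) → IntervalIntegrable f volume 0 1 := by
    intro f hf
    exact ContinuousOn.intervalIntegrable (by rwa [uIcc_of_le zero_le_one])
  have hmc : ContinuousOn (fun θ : ℝ => t₁ * v.1 * Φ.meanDot x₀ t₁ (p + θ • v)) (Icc 0 1) :=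
    continuousOn_const.mul (((Φ.contDiffOn_meanDot t₁ hN hNc
      fun p hp => (hNa p hp).2.1).continuousOn).comp (f := fun θ : ℝ => p + θ • v) (by fun_prop) hv)
  have hvar : ∫ θ in (0 : ℝ)..1, Φ.variation x₀ x₁ t₁ (p + θ • v) v =
      (∫ θ in (0 : ℝ)..1, Ω.deformationForm l (fun t => U₀ (t, 1)) (fun t => U (t, 1)) θ) -
      (∫ θ in (0 : ℝ)..1, Ω.deformationForm l (fun t => U₀ (t, 0)) (fun t => U (t, 0)) θ) -
      t₁ * v.1 * ∫ θ in (0 : ℝ)..1, Φ.meanDot x₀ t₁ (p + θ • v) := by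
    rw [← intervalIntegral.integral_const_mul,
      ← intervalIntegral.integral_sub (hint (hconts 1 h11).2) (hint (hconts 0 h00).2),
      ← intervalIntegral.integral_sub ((hint (hconts 1 h11).2).sub (hint (hconts 0 h00).2))
        (hint hmc)]
    refine intervalIntegral.integral_congr fun θ hθ => ?_
    rw [uIcc_of_le zero_le_one] at hθ
    rw [hfin, htop θ hθ, hbot θ hθ]
    ring
  have hr1 : Φ.relAction l s₀ x₀ t₁ (p + v) = (∫ τ in (0 : ℝ)..1,
      Ω.deformationForm l (fun t => U₀ (1, t)) (fun t => U (1, t)) τ) -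
      t₁ * ∫ τ in (0 : ℝ)..1, h (1, τ) := by
    simp only [relAction, U₀, U, h, hκv, one_smul]
  have hr0 : Φ.relAction l s₀ x₀ t₁ p = (∫ τ in (0 : ℝ)..1,
      Ω.deformationForm l (fun t => U₀ (0, t)) (fun t => U (0, t)) τ) -
      t₁ * ∫ τ in (0 : ℝ)..1, h (0, τ) := by
    simp only [relAction, U₀, U, h, hκv, zero_smul, add_zero]
  rw [hr1, hr0, hvar]
  simp only [hd₀, integral_zero, harea, boundaryIntegral] at hstokes
  linarith

theorem hasFDerivAt_relAction (hx₀ : x₀ ∈ I.interior M) {p : ℝ × Coord n} (hp : p ∈ N) :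
    HasFDerivAt (Φ.relAction l s₀ x₀ t₁) (Φ.variation x₀ x₁ t₁ p) p :=
  hasFDerivAt_of_sub_eq_integral hN (Φ.contDiffOn_variation hl₁ hx₁ hN hNc hNa).continuousOn
    (fun _ _ _ hv => Φ.relAction_sub hl hl₀ hl₁ hx₁ hN hNc hNa hx₀ hv) hp

end

end FlowFamily

end HamiltonianSpectrum

/-! ### Consequences of the symmetry of second derivatives: symplectic flows and `orbitDot`. -/

namespace HamiltonianSpectrum

variable {n : ℕ} {H : Type*} [TopologicalSpace H]
  {I : ModelWithCorners ℝ (Coord n) H}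
  {M : Type*} [TopologicalSpace M] [ChartedSpace H M]

variable [IsManifold I ∞ M]

/-- The coordinate expressions of a symplectic form in different charts. -/
theorem SymplecticForm.bilinChart_eq_bilinChart (Ω : SymplecticForm I M) {m m' : M} {y : Coord n}
    (hy : y ∈ interior (extChartAt I m).target)
    (hy' : (extChartAt I m).symm y ∈ (extChartAt I m').source) (v w : Coord n) :
    Ω.bilinChart m y v w = Ω.bilinChart m' (extChartAt I m' ((extChartAt I m).symm y))
      (fderiv ℝ (extChartAt I m' ∘ (extChartAt I m).symm) y v)
      (fderiv ℝ (extChartAt I m' ∘ (extChartAt I m).symm) y w) := by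
  have hd : MDifferentiableAt 𝓘(ℝ, Coord n) I (extChartAt I m).symm y :=
    (contMDiffAt_extChartAt_symm hy).mdifferentiableAt (by simp)
  have h1 := Ω.bilin_coordDeriv m hd ((extChartAt I m).map_target (interior_subset hy)) v w
  rw [Ω.bilin_coordDeriv m' hd hy' v w] at h1
  have h2 : (extChartAt I m ∘ (extChartAt I m).symm) =ᶠ[𝓝 y] id := by
    filter_upwards [mem_interior_iff_mem_nhds.1 hy] with z hz
    exact (extChartAt I m).right_inv hz
  rw [h1, h2.fderiv_eq, fderiv_id, (extChartAt I m).right_inv (interior_subset hy)]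
  rfl

variable [T2Space M]

namespace FlowFamily

variable {Ω : SymplecticForm I M} (Φ : FlowFamily Ω)

theorem exists_ball_admissible (l : List (DeformationStep I M)) (s₀ : ℝ) {x₀ : M}
    (hx₀ : x₀ ∈ I.interior M) (t₁ : ℝ) :
    ∃ r > 0, ∀ p ∈ Metric.ball (s₀, extChartAt I x₀ x₀) r, Φ.Admissible l s₀ x₀ t₁ p :=
  Metric.eventually_nhds_iff_ball.1 (Φ.eventually_admissible l s₀ hx₀ t₁)

/-- For fixed `s₀` the relative action is a potential for the primitive at `x₀` minus the pull-back
under the flow of the primitive at `x₁`. Symmetry of its second derivative says that this difference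
is closed, and the exterior derivatives of the two terms are the form and its pull-back. -/
theorem bilinChart_flow_center (s₀ t₁ : ℝ) {x₀ : M} (hx₀ : x₀ ∈ I.interior M) (v w : Coord n) :
    Ω.bilinChart (Φ.orbit s₀ x₀ t₁)
      (extChartAt I (Φ.orbit s₀ x₀ t₁) (Φ.orbit s₀ x₀ t₁))
      (fderiv ℝ (fun y => Φ.flowEnd x₀ (Φ.orbit s₀ x₀ t₁) t₁ (s₀, y)) (extChartAt I x₀ x₀) v)
      (fderiv ℝ (fun y => Φ.flowEnd x₀ (Φ.orbit s₀ x₀ t₁) t₁ (s₀, y)) (extChartAt I x₀ x₀) w) =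
    Ω.bilinChart x₀ (extChartAt I x₀ x₀) v w := by
  set x₁ := Φ.orbit s₀ x₀ t₁ with hx₁
  set y₀ := extChartAt I x₀ x₀
  set Ψ : Coord n → Coord n := fun y => Φ.flowEnd x₀ x₁ t₁ (s₀, y)
  obtain ⟨l, hl, hl₀, hl₁⟩ := exists_deformation (I := I)
    (C := (fun τ => Φ.orbit s₀ x₀ (t₁ * τ)) '' Icc 0 1)
    (isCompact_Icc.image ((Φ.continuous_orbit s₀ x₀).comp (by fun_prop))) x₀ x₁
  obtain ⟨r, hr, hNa⟩ := Φ.exists_ball_admissible l s₀ hx₀ t₁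
  set N := Metric.ball (s₀, y₀) r
  have hN : IsOpen N := Metric.isOpen_ball
  have hNc : Convex ℝ N := convex_ball _ _
  have hp₀ : (s₀, y₀) ∈ N := Metric.mem_ball_self hr
  have hj : ∀ y : Coord n, HasFDerivAt (fun y : Coord n => (s₀, y))
      (ContinuousLinearMap.inr ℝ ℝ (Coord n)) y := fun y => hasFDerivAt_prodMk_right s₀ y
  have hjc : Continuous (fun y : Coord n => (s₀, y)) := by fun_prop
  have hyN : ∀ᶠ y in 𝓝 y₀, (s₀, y) ∈ N :=
    hjc.continuousAt.eventually_mem (hN.mem_nhds hp₀)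
  have hend : ∀ y, (s₀, y) ∈ N → ContDiffAt ℝ ∞ (Φ.flowEnd x₀ x₁ t₁) (s₀, y) := fun y hy =>
    Φ.contDiffAt_flowEnd (hNa _ hy).2.1 (chartNhd_subset_source _
      (Φ.flowEnd_mem hl₁ hx₁.symm hNa hy))
  have hΨ : ∀ y, (s₀, y) ∈ N → ContDiffAt ℝ ∞ Ψ y := fun y hy =>
    ContDiffAt.comp y (g := Φ.flowEnd x₀ x₁ t₁) (f := fun y : Coord n => (s₀, y)) (hend y hy)
      (contDiffAt_const.prodMk contDiffAt_id)
  have hΨd : ∀ y, (s₀, y) ∈ N → fderiv ℝ Ψ y =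
      (fderiv ℝ (Φ.flowEnd x₀ x₁ t₁) (s₀, y)).comp (ContinuousLinearMap.inr ℝ ℝ (Coord n)) :=
    fun y hy => (((hend y hy).differentiableAt (by simp)).hasFDerivAt.comp y (hj y)).fderiv
  set f' : Coord n → Coord n →L[ℝ] ℝ := fun y =>
    (Ω.primitive x₀ (id y)).comp (fderiv ℝ id y) - (Ω.primitive x₁ (Ψ y)).comp (fderiv ℝ Ψ y)
  have hf : ∀ᶠ y in 𝓝 y₀, HasFDerivAt (fun y => Φ.relAction l s₀ x₀ t₁ (s₀, y)) (f' y) y := by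
    filter_upwards [hyN] with y hy
    refine ((Φ.hasFDerivAt_relAction hl hl₀ hl₁ hx₁.symm hN hNc hNa hx₀ hy).comp y
      (hj y)).congr_fderiv ?_
    ext a
    simp [f', variation, hΨd y hy, Ψ]
  have h0 := fderiv_pullback_primitive (Ω.contDiffOn_primitive x₀)
    (fun y hy v w => Ω.fderivWithin_primitive x₀ hy v w) (v := id) (p := y₀)
    contDiffAt_id (hyN.mono fun y hy => (hNa _ hy).1)
  have h1 := fderiv_pullback_primitive (Ω.contDiffOn_primitive x₁)
    (fun y hy v w => Ω.fderivWithin_primitive x₁ hy v w) (v := Ψ) (p := y₀)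
    ((hΨ y₀ hp₀).of_le (WithTop.coe_le_coe.2 le_top))
    (hyN.mono fun y hy => extChartAt_mem_chartDomain (Φ.flowEnd_mem hl₁ hx₁.symm hNa hy))
  have hd0 := h0.1.differentiableAt (by simp)
  have hd1 := h1.1.differentiableAt (by simp)
  have hsymm := second_derivative_symmetric_of_eventually hf (hd0.hasFDerivAt.sub hd1.hasFDerivAt)
    v w
  have e0 := h0.2 v w
  have e1 := h1.2 v w
  simp only [fderiv_id, ContinuousLinearMap.id_apply, id_eq, sub_apply] at e0 e1 hsymm
  have hΨ₀ : Ψ y₀ = extChartAt I x₁ x₁ := by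
    simp only [Ψ, flowEnd, y₀, flowMap_center, ← hx₁]
  rw [← hΨ₀, ← e0, ← e1]
  linarith

/-- The flow preserves the symplectic form. -/
theorem bilin_coordDeriv_orbit (s t : ℝ) {m : M} {y : Coord n}
    (hy : y ∈ interior (extChartAt I m).target) (v w : Coord n) :
    Ω.bilin (Φ.orbit s ((extChartAt I m).symm y) t)
      (coordDeriv I (fun y => Φ.orbit s ((extChartAt I m).symm y) t) y v)
      (coordDeriv I (fun y => Φ.orbit s ((extChartAt I m).symm y) t) y w) =
      Ω.bilinChart m y v w := by
  set x₀ := (extChartAt I m).symm y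
  set x₁ := Φ.orbit s x₀ t
  have hx₀ : x₀ ∈ I.interior M := extChartAt_symm_mem_interior hy
  set κ := extChartAt I x₀ ∘ (extChartAt I m).symm
  have hκy : κ y = extChartAt I x₀ x₀ := rfl
  have hκ : HasFDerivAt κ (fderiv ℝ κ y) y :=
    ((contDiffAt_extChartAt_comp (contMDiffAt_extChartAt_symm hy)
      (mem_extChartAt_source x₀)).differentiableAt (by simp)).hasFDerivAt
  set u₀ : Coord n → M := fun y => Φ.orbit s ((extChartAt I x₀).symm y) t
  have hu₀ : ContMDiffAt 𝓘(ℝ, Coord n) I ∞ u₀ (κ y) := by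
    have h1 : ContDiff ℝ ∞ (fun y : Coord n => (s, t, y)) := by fun_prop
    rw [hκy]
    exact ContMDiffAt.comp _ (g := Φ.flowMap x₀) (f := fun y : Coord n => (s, t, y))
      (Φ.contMDiffAt_flowMap x₀ s t (extChartAt_mem_interior_target hx₀ (mem_extChartAt_source x₀)))
      h1.contMDiff.contMDiffAt
  have heq : (fun y => Φ.orbit s ((extChartAt I m).symm y) t) =ᶠ[𝓝 y] fun z => u₀ (κ z) := by
    have h1 : ∀ᶠ z in 𝓝 y, (extChartAt I m).symm z ∈ (extChartAt I x₀).source :=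
      (contMDiffAt_extChartAt_symm hy).continuousAt.eventually_mem
        ((isOpen_extChartAt_source x₀).mem_nhds (mem_extChartAt_source x₀))
    filter_upwards [h1] with z hz
    simp only [u₀, κ, Function.comp_apply, (extChartAt I x₀).left_inv hz]
  have hcd : ∀ a, coordDeriv I (fun y => Φ.orbit s ((extChartAt I m).symm y) t) y a =
      coordDeriv I u₀ (κ y) (fderiv ℝ κ y a) := by
    intro a
    have h1 : coordDeriv I (fun y => Φ.orbit s ((extChartAt I m).symm y) t) y =
      coordDeriv I (fun z => u₀ (κ z)) y := heq.mfderiv_eq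
    rw [h1, coordDeriv_comp hu₀ hκ]
  have hu₀y : u₀ (κ y) = x₁ := heq.self_of_nhds.symm
  have h2 := Ω.bilin_coordDeriv x₁ (hu₀.mdifferentiableAt (by simp))
    (by rw [hu₀y]; exact mem_extChartAt_source x₁) (fderiv ℝ κ y v) (fderiv ℝ κ y w)
  have h3 : (extChartAt I x₁ ∘ u₀) = fun y => Φ.flowEnd x₀ x₁ t (s, y) := rfl
  rw [hu₀y, h3, hκy] at h2
  rw [hcd, hcd, hκy, Ω.bilinChart_eq_bilinChart hy (mem_extChartAt_source x₀),
    ← Φ.bilinChart_flow_center s t hx₀]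
  exact h2

/-- The integral of the derivative of the Hamiltonian along an orbit. -/
noncomputable def orbitDot (s : ℝ) (x : M) : ℝ := ∫ t in (0 : ℝ)..1, Φ.hamDot s t (Φ.orbit s x t)

omit [IsManifold I ∞ M] [T2Space M] in
theorem meanDot_one (x₀ : M) (p : ℝ × Coord n) :
    Φ.meanDot x₀ 1 p = Φ.orbitDot p.1 ((extChartAt I x₀).symm p.2) := by
  simp only [meanDot, orbitDot, one_mul]
  rfl

section

variable {φ : M → M} (hφ : ∀ s x, Φ.orbit s x 1 = φ x)
include hφ

theorem fderiv_flowEnd {x₀ x₁ : M} {p : ℝ × Coord n}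
    (hp : p.2 ∈ interior (extChartAt I x₀).target)
    (hp₁ : φ ((extChartAt I x₀).symm p.2) ∈ (extChartAt I x₁).source) (v : ℝ × Coord n) :
    fderiv ℝ (Φ.flowEnd x₀ x₁ 1) p v =
      fderiv ℝ (fun y => extChartAt I x₁ (φ ((extChartAt I x₀).symm y))) p.2 v.2 ∧
    ContDiffAt ℝ ∞ (fun y => extChartAt I x₁ (φ ((extChartAt I x₀).symm y))) p.2 := by
  set ψ : Coord n → Coord n := fun y => extChartAt I x₁ (φ ((extChartAt I x₀).symm y))
  have h0 : ∀ p, Φ.flowEnd x₀ x₁ 1 p = ψ p.2 := fun p => by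
    simp only [flowEnd, flowMap, hφ, ψ]
  have hend : ContDiffAt ℝ ∞ (Φ.flowEnd x₀ x₁ 1) p :=
    Φ.contDiffAt_flowEnd hp (by
      rw [flowMap, hφ]
      exact hp₁)
  have hψ : ContDiffAt ℝ ∞ ψ p.2 := by
    have h2 : ψ = Φ.flowEnd x₀ x₁ 1 ∘ fun y => (p.1, y) := funext fun y => (h0 (p.1, y)).symm
    rw [h2]
    exact ContDiffAt.comp p.2 hend (contDiffAt_const.prodMk contDiffAt_id)
  refine ⟨?_, hψ⟩
  have h3 : HasFDerivAt (Φ.flowEnd x₀ x₁ 1) ((fderiv ℝ ψ p.2).comp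
      (ContinuousLinearMap.snd ℝ ℝ (Coord n))) p := by
    have h4 := HasFDerivAt.comp p (g := ψ) (hψ.differentiableAt (by simp)).hasFDerivAt
      (hasFDerivAt_snd (𝕜 := ℝ))
    have h5 : Φ.flowEnd x₀ x₁ 1 = ψ ∘ Prod.snd := funext h0
    rwa [h5]
  rw [h3.fderiv]
  rfl

/-- Since the time-one map is `φ` for every parameter, the parameter enters only through the last
term. -/
theorem variation_apply {x₀ x₁ : M} {p : ℝ × Coord n}
    (hp : p.2 ∈ interior (extChartAt I x₀).target)
    (hp₁ : φ ((extChartAt I x₀).symm p.2) ∈ (extChartAt I x₁).source) (v : ℝ × Coord n) :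
    Φ.variation x₀ x₁ 1 p v = Ω.primitive x₀ p.2 v.2 -
      Ω.primitive x₁ (extChartAt I x₁ (φ ((extChartAt I x₀).symm p.2)))
        (fderiv ℝ (fun y => extChartAt I x₁ (φ ((extChartAt I x₀).symm y))) p.2 v.2) -
      v.1 * Φ.orbitDot p.1 ((extChartAt I x₀).symm p.2) := by
  rw [← (Φ.fderiv_flowEnd hφ hp hp₁ v).1, ← hφ p.1, ← meanDot_one]
  change _ - _ - 1 * Φ.meanDot x₀ 1 p * v.1 = _
  rw [one_mul, mul_comm (Φ.meanDot x₀ 1 p) v.1]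
  rfl

variable {l : List (DeformationStep I M)} {s₀ : ℝ} {x₀ : M}

/-- If the time-one maps agree, the integral of the derivative of the Hamiltonian along the orbits
is locally constant. -/
theorem eventually_orbitDot_eq (s₀ : ℝ) {x₀ : M} (hx₀ : x₀ ∈ I.interior M) :
    ∀ᶠ x in 𝓝 x₀, Φ.orbitDot s₀ x = Φ.orbitDot s₀ x₀ := by
  set x₁ := φ x₀ with hx₁
  set y₀ := extChartAt I x₀ x₀
  obtain ⟨l, hl, hl₀, hl₁⟩ := exists_deformation (I := I)
    (C := (fun τ => Φ.orbit s₀ x₀ (1 * τ)) '' Icc 0 1)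
    (isCompact_Icc.image ((Φ.continuous_orbit s₀ x₀).comp (by fun_prop))) x₀ x₁
  obtain ⟨r, hr, hNa⟩ := Φ.exists_ball_admissible l s₀ hx₀ 1
  set N := Metric.ball (s₀, y₀) r
  have hN : IsOpen N := Metric.isOpen_ball
  have hNc : Convex ℝ N := convex_ball _ _
  have hp₀ : (s₀, y₀) ∈ N := Metric.mem_ball_self hr
  have hx₁' : Φ.orbit s₀ x₀ 1 = x₁ := hφ s₀ x₀
  have hsrc : ∀ p ∈ N, φ ((extChartAt I x₀).symm p.2) ∈ (extChartAt I x₁).source := by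
    intro p hp
    have := chartNhd_subset_source _ (Φ.flowEnd_mem hl₁ hx₁' hNa hp)
    rwa [flowMap, hφ] at this
  have hG := Φ.contDiffOn_meanDot 1 hN hNc fun p hp => (hNa p hp).2.1
  have hGd : ∀ p ∈ N, HasFDerivAt (Φ.meanDot x₀ 1) (fderiv ℝ (Φ.meanDot x₀ 1) p) p := fun p hp =>
    ((hG.contDiffAt (hN.mem_nhds hp)).differentiableAt (by simp)).hasFDerivAt
  have hV := Φ.contDiffOn_variation hl₁ hx₁' hN hNc hNa
  have hVd : ∀ p ∈ N, HasFDerivAt (Φ.variation x₀ x₁ 1) (fderiv ℝ (Φ.variation x₀ x₁ 1) p) p :=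
    fun p hp => ((hV.contDiffAt (hN.mem_nhds hp)).differentiableAt (by simp)).hasFDerivAt
  -- In the symmetric second derivative of the relative action, the `s`-derivative of the spatial
  -- component vanishes because that component does not contain `s`. So the spatial derivative of
  -- the `s`-component, which is `-meanDot`, vanishes too.
  have hzero : ∀ p ∈ N, ∀ w : Coord n, fderiv ℝ (Φ.meanDot x₀ 1) p (0, w) = 0 := by
    intro p hp w
    have hsymm := second_derivative_symmetric_of_eventually
      (f := Φ.relAction l s₀ x₀ 1) (x := p)
      (Filter.eventually_of_mem (hN.mem_nhds hp) fun q hq =>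
        Φ.hasFDerivAt_relAction hl hl₀ hl₁ hx₁' hN hNc hNa hx₀ hq) (hVd p hp) (1, 0) (0, w)
    have ha : ∀ a : ℝ × Coord n, HasFDerivAt (fun q => Φ.variation x₀ x₁ 1 q a)
        ((fderiv ℝ (Φ.variation x₀ x₁ 1) p).flip a) p := by
      intro a
      refine ((hVd p hp).clm_apply (hasFDerivAt_const a p)).congr_fderiv ?_
      ext <;> simp
    have h1 : fderiv ℝ (Φ.variation x₀ x₁ 1) p (1, 0) (0, w) = 0 := by
      have h2 : HasDerivAt (fun s : ℝ => (s, p.2)) ((1 : ℝ), (0 : Coord n)) p.1 :=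
        (hasDerivAt_id _).prodMk (hasDerivAt_const _ _)
      have h3 := HasFDerivAt.comp_hasDerivAt p.1 (f := fun s : ℝ => (s, p.2)) (ha (0, w)) h2
      have h4 : ((fun q => Φ.variation x₀ x₁ 1 q (0, w)) ∘ fun s : ℝ => (s, p.2)) =
          fun _ => Φ.variation x₀ x₁ 1 p (0, w) := by
        funext s
        rw [Function.comp_apply, Φ.variation_apply hφ (p := p) (hNa p hp).2.1 (hsrc p hp),
          Φ.variation_apply hφ (p := (s, p.2)) (hNa p hp).2.1 (hsrc p hp)]
        simp
      rw [h4] at h3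
      exact h3.unique (hasDerivAt_const _ _)
    have h5 : fderiv ℝ (Φ.variation x₀ x₁ 1) p (0, w) (1, 0) =
        - fderiv ℝ (Φ.meanDot x₀ 1) p (0, w) := by
      have h6 : (fun q => Φ.variation x₀ x₁ 1 q (1, 0)) =ᶠ[𝓝 p] fun q => - Φ.meanDot x₀ 1 q := by
        filter_upwards [hN.mem_nhds hp] with q hq
        rw [Φ.variation_apply hφ (hNa q hq).2.1 (hsrc q hq), meanDot_one]
        simp
      have h7 := (ha (1, 0)).unique ((hGd p hp).neg.congr_of_eventuallyEq h6)
      exact DFunLike.congr_fun h7 (0, w)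
    rw [h1, h5] at hsymm
    linarith
  set B := Metric.ball y₀ r
  have hBN : ∀ y ∈ B, (s₀, y) ∈ N := by
    intro y hy
    simpa [N, Prod.dist_eq, hr] using Metric.mem_ball.1 hy
  have hj : ∀ y : Coord n, HasFDerivAt (fun y : Coord n => (s₀, y))
      (ContinuousLinearMap.inr ℝ ℝ (Coord n)) y := fun y => hasFDerivAt_prodMk_right s₀ y
  have hcd : ∀ y ∈ B, HasFDerivAt (fun y => Φ.meanDot x₀ 1 (s₀, y)) (0 : Coord n →L[ℝ] ℝ) y := by
    intro y hy
    refine ((hGd _ (hBN y hy)).comp y (hj y)).congr_fderiv ?_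
    ext w
    exact hzero _ (hBN y hy) w
  have hconst : ∀ y ∈ B, Φ.meanDot x₀ 1 (s₀, y) = Φ.meanDot x₀ 1 (s₀, y₀) := by
    intro y hy
    have h1 := (convex_ball y₀ r).norm_image_sub_le_of_norm_hasFDerivWithin_le (C := 0)
      (fun z hz => (hcd z hz).hasFDerivWithinAt) (by simp) (Metric.mem_ball_self hr) hy
    rwa [zero_mul, norm_le_zero_iff, sub_eq_zero] at h1
  have hev : ∀ᶠ x in 𝓝 x₀, extChartAt I x₀ x ∈ B :=
    (continuousAt_extChartAt x₀).eventually_mem (Metric.ball_mem_nhds _ hr)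
  filter_upwards [hev, extChartAt_source_mem_nhds (I := I) x₀] with x hx hxs
  have h1 := hconst _ hx
  rw [meanDot_one, meanDot_one] at h1
  simpa only [y₀, (extChartAt I x₀).left_inv hxs, extChartAt_to_inv] using h1

end

end FlowFamily

end HamiltonianSpectrum

/-! ### The actions of all periodic orbits form a null set. -/

namespace HamiltonianSpectrum

variable {n : ℕ} {H : Type*} [TopologicalSpace H]
  {I : ModelWithCorners ℝ (Coord n) H}
  {M : Type*} [TopologicalSpace M] [ChartedSpace H M]

namespace FlowFamily

variable {Ω : SymplecticForm I M} (Φ : FlowFamily Ω)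

/-- A disc, in polar coordinates, which bounds a periodic orbit. -/
structure IsOrbitDisc (s : ℝ) (u : ℝ × ℝ → M) : Prop where
  smooth : ∀ p ∈ unitSquare, ContMDiffAt 𝓘(ℝ, ℝ × ℝ) I ∞ u p
  center : ∀ τ, u (0, τ) = u (0, 0)
  periodic : ∀ r, u (r, 1) = u (r, 0)
  boundary : ∀ τ, u (1, τ) = Φ.orbit s (u (1, 0)) τ

/-- The action of a periodic orbit with a disc. -/
noncomputable def discAction (s : ℝ) (u : ℝ × ℝ → M) : ℝ :=
  - (∫ p in unitSquare, Ω.density u p) - ∫ t in (0 : ℝ)..1, Φ.ham s t (u (1, t))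

theorem continuous_of_isOrbitDisc {s : ℝ} {u : ℝ × ℝ → M} (hu : Φ.IsOrbitDisc s u) :
    ContinuousOn u unitSquare := fun p hp => (hu.smooth p hp).continuousAt.continuousWithinAt

variable [IsManifold I ∞ M]

/-- Of the four sides of the square in polar coordinates, the one at radius zero contributes nothing
because both discs are constant there, and the two radial ones cancel by periodicity. -/
theorem integral_density_sub_of_isOrbitDisc {s₀ s : ℝ} {u₀ u : ℝ × ℝ → M}
    (hu₀ : Φ.IsOrbitDisc s₀ u₀) (hu : Φ.IsOrbitDisc s u) {l : List (DeformationStep I M)}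
    (hl : Covers l (u₀ '' unitSquare)) (hn : ∀ p ∈ unitSquare, NearAll l (u₀ p) (u p)) :
    (∫ p in unitSquare, Ω.density u₀ p) - (∫ p in unitSquare, Ω.density u p) =
      ∫ τ in (0 : ℝ)..1, Ω.deformationForm l (Φ.orbit s₀ (u₀ (1, 0))) (Φ.orbit s (u (1, 0))) τ := by
  rw [Ω.integral_density_sub hu₀.smooth hu.smooth hn hl, boundaryIntegral]
  have e1 : (fun t => u₀ (1, t)) = Φ.orbit s₀ (u₀ (1, 0)) := funext hu₀.boundary
  have e2 : (fun t => u (1, t)) = Φ.orbit s (u (1, 0)) := funext hu.boundary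
  have e3 : (fun t => u₀ (0, t)) = fun _ => u₀ (0, 0) := funext hu₀.center
  have e4 : (fun t => u (0, t)) = fun _ => u (0, 0) := funext hu.center
  have e5 : (fun t => u₀ (t, 1)) = fun t => u₀ (t, 0) := funext hu₀.periodic
  have e6 : (fun t => u (t, 1)) = fun t => u (t, 0) := funext hu.periodic
  rw [e1, e2, e3, e4, e5, e6]
  simp only [Ω.deformationForm_const_const, intervalIntegral.integral_zero, sub_zero]
  ring

variable [T2Space M] {φ : M → M} (hφ : ∀ s x, Φ.orbit s x 1 = φ x)

/-- Orbits from points outside the interior are constant, since the Hamiltonian vanishes near these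
points. So the boundary term of the comparison is zero, as is the integral of the Hamiltonian, and
all nearby discs of this kind have one and the same action. -/
theorem exists_null_of_boundary {s₀ : ℝ} {u₀ : ℝ × ℝ → M} (hu₀ : Φ.IsOrbitDisc s₀ u₀)
    (hx₀ : u₀ (1, 0) ∉ I.interior M) :
    ∃ (S : Set ℝ) (l : List (DeformationStep I M)), volume S = 0 ∧
      ∀ s u, Φ.IsOrbitDisc s u → u (1, 0) ∉ I.interior M →
        (∀ p ∈ unitSquare, NearAll l (u₀ p) (u p)) → Φ.discAction s u ∈ S := by
  obtain ⟨l, hl, -, -⟩ := exists_deformation (I := I) (C := u₀ '' unitSquare)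
    ((isCompact_Icc.prod isCompact_Icc).image_of_continuousOn (Φ.continuous_of_isOrbitDisc hu₀))
    (u₀ (1, 0)) (u₀ (1, 0))
  refine ⟨{- ∫ p in unitSquare, Ω.density u₀ p}, l, by simp, fun s u hu hx hn => ?_⟩
  have hc : ∀ {s x}, x ∉ I.interior M → Φ.orbit s x = fun _ => x := fun hx => funext fun t =>
    Φ.orbit_eq_self _ t (Φ.eventually_ham_eq_zero _ hx)
  have h1 := Φ.integral_density_sub_of_isOrbitDisc hu₀ hu hl hn
  rw [hc hx₀, hc hx] at h1
  simp only [Ω.deformationForm_const_const, intervalIntegral.integral_zero] at h1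
  have h2 : ∀ t, Φ.ham s t (u (1, t)) = 0 := by
    intro t
    rw [hu.boundary, hc hx]
    exact (Φ.eventually_ham_eq_zero s hx t).self_of_nhds
  rw [mem_singleton_iff, discAction]
  simp only [h2, intervalIntegral.integral_zero]
  linarith

include hφ

/-- The actions of the nearby discs are critical values of a single smooth function `g` of the
initial point in a chart; the hypothesis `hG` is what makes `g` independent of the parameter. -/
theorem exists_null_of_interior (hG : ∀ s, ∀ x ∈ I.interior M, Φ.orbitDot s x = 0)
    {s₀ : ℝ} {u₀ : ℝ × ℝ → M} (hu₀ : Φ.IsOrbitDisc s₀ u₀)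
    (hx₀ : u₀ (1, 0) ∈ I.interior M) :
    ∃ (S : Set ℝ) (l : List (DeformationStep I M)), volume S = 0 ∧
      ∃ V ∈ 𝓝 (s₀, u₀ (1, 0)), ∀ s u, Φ.IsOrbitDisc s u → (s, u (1, 0)) ∈ V →
        (∀ p ∈ unitSquare, NearAll l (u₀ p) (u p)) → Φ.discAction s u ∈ S := by
  set x₀ := u₀ (1, 0)
  set χ := extChartAt I x₀
  set y₀ := χ x₀
  have hfix : ∀ {s u}, Φ.IsOrbitDisc s u → φ (u (1, 0)) = u (1, 0) := by
    intro s u hu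
    rw [← hφ s, ← hu.boundary, hu.periodic]
  obtain ⟨l, hl, hl₀, -⟩ := exists_deformation (I := I) (C := u₀ '' unitSquare)
    ((isCompact_Icc.prod isCompact_Icc).image_of_continuousOn (Φ.continuous_of_isOrbitDisc hu₀))
    x₀ x₀
  have hl' : Covers l ((fun τ => Φ.orbit s₀ x₀ (1 * τ)) '' Icc 0 1) := by
    intro x hx
    obtain ⟨τ, hτ, rfl⟩ := hx
    refine hl _ ⟨(1, τ), ⟨by simp, hτ⟩, ?_⟩
    change _ = Φ.orbit s₀ x₀ (1 * τ)
    rw [one_mul]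
    exact hu₀.boundary τ
  obtain ⟨r, hr, hNa⟩ := Φ.exists_ball_admissible l s₀ hx₀ 1
  set N := Metric.ball (s₀, y₀) r
  have hN : IsOpen N := Metric.isOpen_ball
  have hNc : Convex ℝ N := convex_ball _ _
  have hx₁ : Φ.orbit s₀ x₀ 1 = x₀ := by rw [hφ, hfix hu₀]
  have hsrc : ∀ p ∈ N, φ (χ.symm p.2) ∈ χ.source := by
    intro p hp
    have := chartNhd_subset_source _ (Φ.flowEnd_mem hl₀ hx₁ hNa hp)
    rwa [flowMap, hφ] at this
  have hd : ∀ p ∈ N, HasFDerivAt (Φ.relAction l s₀ x₀ 1) (Φ.variation x₀ x₀ 1 p) p := fun p hp =>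
    Φ.hasFDerivAt_relAction hl' hl₀ hl₀ hx₁ hN hNc hNa hx₀ hp
  set B := Metric.ball y₀ r
  have hBN : ∀ y ∈ B, (s₀, y) ∈ N := by
    intro y hy
    simpa [N, Prod.dist_eq, hr] using Metric.mem_ball.1 hy
  set ψ : Coord n → Coord n := fun y => χ (φ (χ.symm y))
  have hψ : ∀ y ∈ B, ContDiffAt ℝ ∞ ψ y := fun y hy =>
    (Φ.fderiv_flowEnd hφ (hNa _ (hBN y hy)).2.1 (hsrc _ (hBN y hy)) 0).2
  have hprim : ∀ y ∈ B, ContDiffAt ℝ ∞ (Ω.primitive x₀) y := fun y hy =>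
    (Ω.contDiffOn_primitive x₀).contDiffAt
      (chartDomain_mem_nhds (hNa _ (hBN y hy)).1 (hNa _ (hBN y hy)).2.1)
  have hj : ∀ y : Coord n, HasFDerivAt (fun y : Coord n => (s₀, y))
      (ContinuousLinearMap.inr ℝ ℝ (Coord n)) y := fun y => hasFDerivAt_prodMk_right s₀ y
  set α : Coord n → ℝ := fun y => Φ.relAction l s₀ x₀ 1 (s₀, y)
  have hα : ∀ y ∈ B, HasFDerivAt α ((Φ.variation x₀ x₀ 1 (s₀, y)).comp
      (ContinuousLinearMap.inr ℝ ℝ (Coord n))) y := fun y hy => (hd _ (hBN y hy)).comp y (hj y)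
  have hαs : ContDiffOn ℝ ∞ α B := by
    rw [contDiffOn_infty_iff_fderiv_of_isOpen Metric.isOpen_ball]
    refine ⟨fun y hy => (hα y hy).differentiableAt.differentiableWithinAt, ?_⟩
    have h1 : ContDiffOn ℝ ∞ (fun y => (Φ.variation x₀ x₀ 1 (s₀, y)).comp
        (ContinuousLinearMap.inr ℝ ℝ (Coord n))) B :=
      ((Φ.contDiffOn_variation hl₀ hx₁ hN hNc hNa).comp
        (f := fun y : Coord n => (s₀, y)) (contDiffOn_const.prodMk contDiffOn_id)
        fun y hy => hBN y hy).clm_comp contDiffOn_const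
    exact h1.congr fun y hy => (hα y hy).fderiv
  -- At a fixed point `y` of `ψ` the differential of `α` is the primitive at `y` applied to `id -
  -- dψ`, in general not zero, since neighbouring orbits do not close up. The last term has the
  -- opposite differential there and the value zero, so it makes `y` critical without changing the
  -- action.
  set g : Coord n → ℝ := fun y => - (∫ p in unitSquare, Ω.density u₀ p) + α y +
    Ω.primitive x₀ y (ψ y - y)
  have hg : ContDiffOn ℝ ∞ g B := by
    refine (contDiffOn_const.add hαs).add ?_
    exact ContDiffOn.clm_apply (fun y hy => (hprim y hy).contDiffWithinAt)
      fun y hy => ((hψ y hy).sub contDiffAt_id).contDiffWithinAt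
  have hcrit : ∀ y ∈ B, ψ y = y → fderiv ℝ g y = 0 := by
    intro y hy hyf
    have h1 := ((hα y hy).const_add (- (∫ p in unitSquare, Ω.density u₀ p))).add
      (((hprim y hy).differentiableAt (by simp)).hasFDerivAt.clm_apply
        (((hψ y hy).differentiableAt (by simp)).hasFDerivAt.sub (hasFDerivAt_id y)))
    have h2 : HasFDerivAt g (((Φ.variation x₀ x₀ 1 (s₀, y)).comp
        (ContinuousLinearMap.inr ℝ ℝ (Coord n))) + ((Ω.primitive x₀ y).comp
        (fderiv ℝ ψ y - ContinuousLinearMap.id ℝ (Coord n)) +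
        (fderiv ℝ (Ω.primitive x₀) y).flip (ψ y - y))) y := h1
    rw [hyf, sub_self, map_zero, add_zero] at h2
    rw [h2.fderiv]
    ext w
    have h3 : Φ.variation x₀ x₀ 1 (s₀, y) ((0 : ℝ), w) =
        Ω.primitive x₀ y w - Ω.primitive x₀ y (fderiv ℝ ψ y w) := by
      have h4 := Φ.variation_apply hφ (hNa _ (hBN y hy)).2.1 (hsrc _ (hBN y hy)) ((0 : ℝ), w)
      change _ = _ - Ω.primitive x₀ (ψ y) (fderiv ℝ ψ y w) - 0 * _ at h4
      rw [hyf] at h4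
      rw [h4, zero_mul, sub_zero]
    change Φ.variation x₀ x₀ 1 (s₀, y) ((0 : ℝ), w) +
      Ω.primitive x₀ y (fderiv ℝ ψ y w - w) = 0
    rw [h3, map_sub]
    ring
  refine ⟨g '' {y ∈ B | fderiv ℝ g y = 0}, l,
    volume_image_critical_eq_zero _ rfl _ _ Metric.isOpen_ball hg, ?_⟩
  have hV : ∀ᶠ q : ℝ × M in 𝓝 (s₀, x₀), (q.1, χ q.2) ∈ N ∧ q.2 ∈ χ.source := by
    have h1 : ContinuousAt (fun q : ℝ × M => (q.1, χ q.2)) (s₀, x₀) :=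
      continuousAt_fst.prodMk (ContinuousAt.comp (g := χ) (f := Prod.snd)
        (continuousAt_extChartAt x₀) continuousAt_snd)
    have h2 : Filter.Tendsto Prod.snd (𝓝 (s₀, x₀)) (𝓝 x₀) := continuousAt_snd
    exact (h1.eventually_mem (hN.mem_nhds (Metric.mem_ball_self hr))).and
      (h2.eventually_mem (extChartAt_source_mem_nhds x₀))
  refine ⟨_, hV, fun s u hu hsu hn => ?_⟩
  obtain ⟨hsN, hsx⟩ := hsu
  set x := u (1, 0)
  set y := χ x
  have hyx : χ.symm y = x := χ.left_inv hsx
  have hyB : y ∈ B := by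
    have := Metric.mem_ball.1 hsN
    rw [Prod.dist_eq, max_lt_iff] at this
    exact this.2
  have hyf : ψ y = y := by
    simp only [ψ, hyx]
    rw [hfix hu]
  refine ⟨y, ⟨hyB, hcrit y hyB hyf⟩, ?_⟩
  have hint : ∀ s', (s', y) ∈ N → x ∈ I.interior M := fun s' hs' => by
    rw [← hyx]; exact extChartAt_symm_mem_interior (hNa _ hs').2.1
  -- The derivative in the parameter is `-orbitDot`, which is zero.
  have hconst : Φ.relAction l s₀ x₀ 1 (s, y) = α y := by
    have hsB : ∀ s' ∈ Metric.ball s₀ r, (s', y) ∈ N := fun s' hs' => by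
      rw [Metric.mem_ball, Prod.dist_eq, max_lt_iff]
      exact ⟨hs', hyB⟩
    have hsd : ∀ s' ∈ Metric.ball s₀ r, HasDerivWithinAt (fun s' => Φ.relAction l s₀ x₀ 1 (s', y))
        0 (Metric.ball s₀ r) s' := by
      intro s' hs'
      have h2 : HasDerivAt (fun s : ℝ => (s, y)) ((1 : ℝ), (0 : Coord n)) s' :=
        (hasDerivAt_id _).prodMk (hasDerivAt_const _ _)
      have h3 := HasFDerivAt.comp_hasDerivAt s' (f := fun s : ℝ => (s, y)) (hd _ (hsB s' hs')) h2
      rw [Φ.variation_apply hφ (hNa _ (hsB s' hs')).2.1 (hsrc _ (hsB s' hs')), hyx,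
        hG s' x (hint s' (hsB s' hs'))] at h3
      simp only [map_zero, mul_zero, sub_zero] at h3
      exact h3.hasDerivWithinAt
    have hs : s ∈ Metric.ball s₀ r := by
      have := Metric.mem_ball.1 hsN
      rw [Prod.dist_eq, max_lt_iff] at this
      exact this.1
    have h1 := (convex_ball s₀ r).norm_image_sub_le_of_norm_hasDerivWithin_le (C := 0)
      hsd (by simp) (Metric.mem_ball_self hr) hs
    rwa [zero_mul, norm_le_zero_iff, sub_eq_zero] at h1
  have h1 := Φ.integral_density_sub_of_isOrbitDisc hu₀ hu hl hn
  have h2 : Φ.relAction l s₀ x₀ 1 (s, y) =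
      (∫ τ in (0 : ℝ)..1, Ω.deformationForm l (Φ.orbit s₀ x₀) (Φ.orbit s x) τ) -
      ∫ τ in (0 : ℝ)..1, Φ.ham s τ (u (1, τ)) := by
    have e : ∀ τ, Φ.flowMap x₀ (s, τ, y) = Φ.orbit s x τ := fun τ => by
      change Φ.orbit s (χ.symm y) τ = _
      rw [hyx]
    have e3 : ∀ τ, u (1, τ) = Φ.orbit s x τ := hu.boundary
    simp only [relAction, one_mul, e, e3]
  simp only [g]
  rw [hyf, sub_self, map_zero, ← hconst, h2, discAction]
  linarith

/-- If the integrals of the derivative of the Hamiltonian along the orbits vanish, the union of the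
action spectra is a null set. -/
theorem volume_discAction_eq_zero [SecondCountableTopology M]
    (hG : ∀ s, ∀ x ∈ I.interior M, Φ.orbitDot s x = 0) :
    volume {a | ∃ s u, Φ.IsOrbitDisc s u ∧ a = Φ.discAction s u} = 0 := by
  let T := {q : ℝ × (ℝ × ℝ → M) // Φ.IsOrbitDisc q.1 q.2}
  let ι : T → ℝ × C(unitSquare, M) := fun q =>
    (q.1.1, ⟨unitSquare.domRestrict q.1.2, (Φ.continuous_of_isOrbitDisc q.2).domRestrict⟩)
  -- Pairs of a parameter and a disc carry the topology of uniform convergence on the square. It is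
  -- second countable, and nearness to a given disc is an open condition, so the local null sets can
  -- be combined.
  let _ : TopologicalSpace T := TopologicalSpace.induced ι inferInstance
  have hι : Continuous ι := continuous_induced_dom
  have hc : IsCompact unitSquare := isCompact_Icc.prod isCompact_Icc
  have : CompactSpace unitSquare := isCompact_iff_compactSpace.1 hc
  have : SecondCountableTopology T := TopologicalSpace.secondCountableTopology_induced T _ ι
  have h10 : ((1 : ℝ), (0 : ℝ)) ∈ unitSquare := by simp [unitSquare]
  have hnear : ∀ (q : T) (l : List (DeformationStep I M)),
      ∀ᶠ q' : T in 𝓝 q, ∀ p ∈ unitSquare, NearAll l (q.1.2 p) (q'.1.2 p) := by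
    intro q l
    have h1 : Continuous fun z : T × unitSquare => ((ι q).2 z.2, (ι z.1).2 z.2) := by fun_prop
    have h2 : ∀ᶠ q' : T in 𝓝 q, ∀ p : unitSquare, p ∈ univ →
        NearAll l ((ι q).2 p) ((ι q').2 p) :=
      isCompact_univ.eventually_forall_of_forall_eventually fun p _ =>
        (h1.continuousAt (x := (q, p))).eventually_mem
          ((isOpen_nearAll l).mem_nhds (nearAll_self l _))
    exact h2.mono fun q' hq' p hp => hq' ⟨p, hp⟩ (mem_univ _)
  have hbase : Continuous fun q : T => (q.1.1, q.1.2 (1, 0)) := by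
    have h1 : Continuous fun f : C(unitSquare, M) => f ⟨(1, 0), h10⟩ := by fun_prop
    exact (continuous_fst.comp hι).prodMk (h1.comp (continuous_snd.comp hι))
  let f : T → ℝ := fun q => Φ.discAction q.1.1 q.1.2
  let A : Set T := {q | q.1.2 (1, 0) ∈ I.interior M}
  have hA : volume (f '' A) = 0 := by
    refine volume_image_eq_zero_of_locally fun q hq => ?_
    obtain ⟨S, l, hS, V, hV, h⟩ := Φ.exists_null_of_interior hφ hG q.2 hq
    have h1 := (hbase.continuousAt (x := q)).eventually_mem hV
    refine ⟨_, mem_nhdsWithin_of_mem_nhds (h1.and (hnear q l)), measure_mono_null ?_ hS⟩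
    rintro _ ⟨q', ⟨hq', -⟩, rfl⟩
    exact h _ _ q'.2 hq'.1 hq'.2
  have hA' : volume (f '' Aᶜ) = 0 := by
    refine volume_image_eq_zero_of_locally fun q hq => ?_
    obtain ⟨S, l, hS, h⟩ := Φ.exists_null_of_boundary q.2 hq
    refine ⟨_, mem_nhdsWithin_of_mem_nhds (hnear q l), measure_mono_null ?_ hS⟩
    rintro _ ⟨q', ⟨hq', hq''⟩, rfl⟩
    exact h _ _ q'.2 hq'' hq'
  refine measure_mono_null ?_ (measure_union_null hA hA')
  rintro _ ⟨s, u, hu, rfl⟩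
  rw [← image_union, union_compl_self, image_univ]
  exact ⟨⟨(s, u), hu⟩, rfl⟩

end FlowFamily

end HamiltonianSpectrum

/-! ### Vanishing of `orbitDot` on open manifolds. -/

namespace HamiltonianSpectrum

variable {n : ℕ} {H : Type*} [TopologicalSpace H]
  {I : ModelWithCorners ℝ (Coord n) H}
  {M : Type*} [TopologicalSpace M] [ChartedSpace H M]

variable [IsManifold I ∞ M]

namespace FlowFamily

variable {Ω : SymplecticForm I M} (Φ : FlowFamily Ω)

omit [IsManifold I ∞ M] in
theorem hamDot_eq_zero_of_eventually {s t : ℝ} {x : M} (h : ∀ᶠ s' in 𝓝 s, Φ.ham s' t x = 0) :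
    Φ.hamDot s t x = 0 := by
  rw [hamDot, Filter.EventuallyEq.deriv_eq (f := fun _ => (0 : ℝ)) h, deriv_const]

theorem continuous_hamDot : Continuous fun p : (ℝ × ℝ) × M => Φ.hamDot p.1.1 p.1.2 p.2 :=
  Φ.contMDiff_hamDot.continuous

variable [T2Space M]

theorem orbitDot_eq_of_ham_eq_zero {s : ℝ} {x : M} (h : ∀ t, ∀ᶠ y in 𝓝 x, Φ.ham s t y = 0) :
    Φ.orbitDot s x = ∫ t in (0 : ℝ)..1, Φ.hamDot s t x := by
  simp only [orbitDot, Φ.orbit_eq_self s _ h]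

theorem orbitDot_eq_zero_of_notMem_interior (s : ℝ) {x : M} (hx : x ∉ I.interior M) :
    Φ.orbitDot s x = 0 := by
  rw [Φ.orbitDot_eq_of_ham_eq_zero (Φ.eventually_ham_eq_zero s hx)]
  have h : ∀ t, Φ.hamDot s t x = 0 := fun t => Φ.hamDot_eq_zero_of_eventually
    (Filter.Eventually.of_forall fun s' => (Φ.eventually_ham_eq_zero s' hx t).self_of_nhds)
  simp only [h, intervalIntegral.integral_zero]

theorem continuousAt_orbit (s t : ℝ) {x : M} (hx : x ∈ I.interior M) :
    ContinuousAt (fun p : ℝ × ℝ × M => Φ.orbit p.1 p.2.2 p.2.1) (s, t, x) := by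
  have h1 : ContinuousAt (Φ.flowMap x) (s, t, extChartAt I x x) :=
    (Φ.contMDiffAt_flowMap x s t
      (extChartAt_mem_interior_target hx (mem_extChartAt_source x))).continuousAt
  have h2 : ContinuousAt (fun p : ℝ × ℝ × M => (p.1, p.2.1, extChartAt I x p.2.2)) (s, t, x) := by
    have h3 : ContinuousAt (fun p : ℝ × ℝ × M => p.2.2) (s, t, x) :=
      (continuous_snd.comp continuous_snd).continuousAt
    exact continuousAt_fst.prodMk ((continuous_fst.comp continuous_snd).continuousAt.prodMk
      (ContinuousAt.comp (g := extChartAt I x) (continuousAt_extChartAt x) h3))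
  have h4 : ContinuousAt (fun p : ℝ × ℝ × M => Φ.flowMap x (p.1, p.2.1, extChartAt I x p.2.2))
      (s, t, x) := ContinuousAt.comp (g := Φ.flowMap x) h1 h2
  refine h4.congr ?_
  have h5 : Filter.Tendsto (fun p : ℝ × ℝ × M => p.2.2) (𝓝 (s, t, x)) (𝓝 x) :=
    (continuous_snd.comp continuous_snd).continuousAt
  filter_upwards [h5.eventually_mem (extChartAt_source_mem_nhds (I := I) x)] with p hp
  change Φ.orbit p.1 ((extChartAt I x).symm (extChartAt I x p.2.2)) p.2.1 = _
  rw [(extChartAt I x).left_inv hp]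

theorem continuous_orbitDot {x : M} (hx : x ∈ I.interior M) :
    Continuous fun s => Φ.orbitDot s x := by
  refine intervalIntegral.continuous_parametric_intervalIntegral_of_continuous' ?_ 0 1
  have h1 : Continuous fun p : ℝ × ℝ => Φ.orbit p.1 x p.2 :=
    continuous_iff_continuousAt.2 fun p =>
      ContinuousAt.comp (g := fun p : ℝ × ℝ × M => Φ.orbit p.1 p.2.2 p.2.1)
        (f := fun p : ℝ × ℝ => (p.1, p.2, x)) (Φ.continuousAt_orbit p.1 p.2 hx)
        (by fun_prop)
  exact Φ.continuous_hamDot.comp (continuous_id.prodMk h1)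

variable {φ : M → M} (hφ : ∀ s x, Φ.orbit s x 1 = φ x)
include hφ

/-- Near such a point the orbits rest, so `orbitDot` is the time integral of `hamDot` at the point
itself and is continuous up to the boundary. In a ball of the chart it is constant on the interior
of the model domain, a convex set on which the interior case applies, and this set is dense. -/
theorem eventually_orbitDot_eq_of_notMem_interior (s : ℝ) {p : M} (hp : p ∉ I.interior M) :
    ∀ᶠ x in 𝓝 p, Φ.orbitDot s x = Φ.orbitDot s p := by
  obtain ⟨K, hK, hKi, h0⟩ := Φ.support s
  have hU : ∀ x ∉ K, ∀ t, ∀ᶠ y in 𝓝 x, Φ.ham s t y = 0 := fun x hx t => by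
    filter_upwards [hK.isOpen_compl.mem_nhds hx] with y hy using h0 t y hy
  have hpK : p ∉ K := fun h => hp (hKi h)
  set χ := extChartAt I p
  have h1 : χ.symm ⁻¹' Kᶜ ∈ 𝓝 (χ p) := (continuousAt_extChartAt_symm p).preimage_mem_nhds <| by
    rw [χ.left_inv (mem_extChartAt_source p)]
    exact hK.isOpen_compl.mem_nhds hpK
  obtain ⟨ε, hε, hb⟩ := Metric.mem_nhds_iff.1
    (Filter.inter_mem h1 (Metric.ball_mem_nhds (χ p) (chartRadius_pos (I := I) p)))
  set B := Metric.ball (χ p) ε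
  have hBt : B ∩ range I ⊆ χ.target := fun y hy => chartDomain_subset p ⟨(hb hy.1).2, hy.2⟩
  set g : Coord n → ℝ := fun y => ∫ t in (0 : ℝ)..1, Φ.hamDot s t (χ.symm y)
  have hg : ∀ x ∉ K, Φ.orbitDot s x = ∫ t in (0 : ℝ)..1, Φ.hamDot s t x := fun x hx =>
    Φ.orbitDot_eq_of_ham_eq_zero (hU x hx)
  have hgB : ∀ y ∈ B, g y = Φ.orbitDot s (χ.symm y) := fun y hy => (hg _ (hb hy).1).symm
  have hgc : ContinuousOn g (B ∩ range I) := by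
    rw [continuousOn_iff_continuous_domRestrict]
    refine intervalIntegral.continuous_parametric_intervalIntegral_of_continuous' (X := ↑(B ∩ range I))
      (f := fun y t => Φ.hamDot s t (χ.symm y)) ?_ 0 1
    have h2 : Continuous fun y : ↑(B ∩ range I) => χ.symm y :=
      ((continuousOn_extChartAt_symm p).mono hBt).domRestrict
    have h3 : Continuous fun q : ↑(B ∩ range I) × ℝ => ((s, q.2), χ.symm q.1) :=
      (continuous_const.prodMk continuous_snd).prodMk (h2.comp continuous_fst)
    exact Φ.continuous_hamDot.comp h3
  have hd : ∀ y ∈ B ∩ interior (range I), HasFDerivWithinAt g (0 : Coord n →L[ℝ] ℝ)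
      (B ∩ interior (range I)) y := by
    intro y hy
    have hyt : y ∈ interior χ.target := by
      have h2 : B ∩ interior (range I) ⊆ χ.target := fun z hz => hBt ⟨hz.1, interior_subset hz.2⟩
      exact interior_maximal h2 (Metric.isOpen_ball.inter isOpen_interior) hy
    have h2 : ContinuousAt χ.symm y := (contMDiffAt_extChartAt_symm hyt).continuousAt
    have h3 := h2.eventually (Φ.eventually_orbitDot_eq hφ s (extChartAt_symm_mem_interior hyt))
    refine HasFDerivAt.hasFDerivWithinAt ?_
    refine (hasFDerivAt_const (g y) y).congr_of_eventuallyEq ?_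
    filter_upwards [h3, Metric.isOpen_ball.mem_nhds hy.1] with z hz hzB
    rw [hgB z hzB, hgB y hy.1, hz]
  have hconv : Convex ℝ (B ∩ interior (range I)) :=
    (convex_ball _ _).inter I.convex_range.interior
  have hcl : B ∩ range I ⊆ closure (B ∩ interior (range I)) := fun y hy =>
    Metric.isOpen_ball.inter_closure ⟨hy.1, I.range_subset_closure_interior hy.2⟩
  have hpB : χ p ∈ B ∩ range I :=
    ⟨Metric.mem_ball_self hε, extChartAt_target_subset_range p (mem_extChartAt_target p)⟩
  obtain ⟨y₀, hy₀⟩ : (B ∩ interior (range I)).Nonempty := closure_nonempty_iff.1 ⟨_, hcl hpB⟩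
  have heq : EqOn g (fun _ => g y₀) (B ∩ interior (range I)) := by
    intro y hy
    have := hconv.norm_image_sub_le_of_norm_hasFDerivWithin_le (C := 0) hd (by simp) hy₀ hy
    rwa [zero_mul, norm_le_zero_iff, sub_eq_zero] at this
  have heq' := heq.of_subset_closure hgc continuousOn_const
    (inter_subset_inter_right _ interior_subset) hcl
  have hcont : ContinuousAt χ p := continuousAt_extChartAt p
  filter_upwards [hcont.eventually_mem (Metric.isOpen_ball.mem_nhds hpB.1),
    extChartAt_source_mem_nhds (I := I) p] with x hx hxs
  have hx' : χ x ∈ B ∩ range I := ⟨hx, extChartAt_target_subset_range p (χ.map_source hxs)⟩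
  have h5 := hgB _ hx'.1
  have h6 := hgB _ hpB.1
  rw [χ.left_inv hxs] at h5
  rw [χ.left_inv (mem_extChartAt_source p)] at h6
  rw [← h5, ← h6, heq' hx', heq' hpB]

theorem orbitDot_eq_orbitDot [PreconnectedSpace M] (s : ℝ) (x y : M) :
    Φ.orbitDot s x = Φ.orbitDot s y := by
  have h : IsLocallyConstant (Φ.orbitDot s) := (IsLocallyConstant.iff_eventually_eq _).2 fun x => by
    by_cases hx : x ∈ I.interior M
    · exact Φ.eventually_orbitDot_eq hφ s hx
    · exact Φ.eventually_orbitDot_eq_of_notMem_interior hφ s hx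
  exact h.apply_eq_of_isPreconnected isPreconnected_univ trivial trivial

theorem orbitDot_eq_zero_of_boundary [PreconnectedSpace M] (hb : I.interior M ≠ univ) (s : ℝ)
    (x : M) : Φ.orbitDot s x = 0 := by
  obtain ⟨y, hy⟩ := (ne_univ_iff_exists_notMem _).1 hb
  rw [Φ.orbitDot_eq_orbitDot hφ s x y, Φ.orbitDot_eq_zero_of_notMem_interior s hy]

/-- The compact supports need not be bounded uniformly in `s`. The parameters whose Hamiltonian is
supported in the `j`-th set of an exhaustion form a closed set `A j`, and these cover the line, so
by Baire the union of their interiors is dense. There `orbitDot` vanishes, and continuity in `s`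
gives the rest. -/
theorem orbitDot_eq_zero_of_noncompact [PreconnectedSpace M] [SecondCountableTopology M]
    [NoncompactSpace M] (hK : ∀ s, ∃ K : Set M, IsCompact K ∧ ∀ t, ∀ x ∉ K, Φ.ham s t x = 0)
    (s : ℝ) (x : M) : Φ.orbitDot s x = 0 := by
  by_cases hb : I.interior M = univ
  swap
  · exact Φ.orbitDot_eq_zero_of_boundary hφ hb s x
  have : LocallyCompactSpace M := Manifold.locallyCompact_of_finiteDimensional I
  have E : CompactExhaustion M := default
  set A : ℕ → Set ℝ := fun j => {s | ∀ t, ∀ x ∉ E j, Φ.ham s t x = 0}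
  have hA : ∀ j, IsClosed (A j) := by
    intro j
    simp only [A, ofPred_forall]
    refine isClosed_iInter fun t => isClosed_iInter fun x => isClosed_iInter fun _ => ?_
    have : Continuous fun s => Φ.ham s t x := Φ.smooth.continuous.comp
      ((continuous_id.prodMk continuous_const).prodMk continuous_const)
    exact isClosed_eq this continuous_const
  have hAU : ⋃ j, A j = univ := by
    refine eq_univ_of_forall fun s => ?_
    obtain ⟨K, hKc, hK0⟩ := hK s
    obtain ⟨j, hj⟩ := E.exists_superset_of_isCompact hKc
    exact mem_iUnion.2 ⟨j, fun t x hx => hK0 t x fun h => hx (hj h)⟩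
  have hden := dense_iUnion_interior_of_closed hA hAU
  have hz : EqOn (fun s => Φ.orbitDot s x) (fun _ => 0) (⋃ j, interior (A j)) := by
    intro s hs
    obtain ⟨j, hj⟩ := mem_iUnion.1 hs
    -- By noncompactness there is a point outside the common support of all nearby parameters; it
    -- rests, and the derivative in the parameter vanishes there.
    obtain ⟨y, hy⟩ := (ne_univ_iff_exists_notMem _).1 (E.isCompact j).ne_univ
    have hyn := (E.isCompact j).isClosed.isOpen_compl.mem_nhds hy
    have h1 : ∀ t, Φ.hamDot s t y = 0 := fun t => Φ.hamDot_eq_zero_of_eventually <| by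
      filter_upwards [mem_interior_iff_mem_nhds.1 hj] with s' hs' using hs' t y hy
    change Φ.orbitDot s x = 0
    rw [Φ.orbitDot_eq_orbitDot hφ s x y, Φ.orbitDot_eq_of_ham_eq_zero]
    · simp only [h1, intervalIntegral.integral_zero]
    · intro t
      filter_upwards [hyn] with z hz using interior_subset hj t z hz
  exact congrFun ((Φ.continuous_orbitDot (hb ▸ mem_univ x)).ext_on hden continuous_const hz) s

end FlowFamily

end HamiltonianSpectrum

/-! ### The Liouville measure. -/

/-- Join `A` to the identity by a segment. If `(1 - τ) A + τ` kills `v`, then `τ |v|² = 0`, because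
`v ⬝ A v = 0` by antisymmetry. So the determinant vanishes nowhere on the segment and has the sign
it has at the identity. -/
theorem Matrix.det_pos_of_transpose_eq_neg {ι : Type*} [Fintype ι] [DecidableEq ι]
    {A : Matrix ι ι ℝ} (hA : A.transpose = -A) (h : A.det ≠ 0) : 0 < A.det := by
  by_contra! hneg
  have hc : ContinuousOn (fun τ : ℝ => ((1 - τ) • A + τ • (1 : Matrix ι ι ℝ)).det) (Icc 0 1) :=
    Continuous.continuousOn (Continuous.matrix_det (by fun_prop))
  obtain ⟨τ, hτ, h0⟩ := intermediate_value_Icc zero_le_one hc (show (0 : ℝ) ∈ _ by simp [hneg])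
  obtain ⟨v, hv, hv0⟩ := Matrix.exists_mulVec_eq_zero_iff.2 h0
  have hvA : v ⬝ᵥ A.mulVec v = 0 := by
    have h1 : v ⬝ᵥ A.mulVec v = A.transpose.mulVec v ⬝ᵥ v := by
      rw [Matrix.mulVec_transpose, Matrix.dotProduct_mulVec]
    rw [hA, Matrix.neg_mulVec, neg_dotProduct, dotProduct_comm (A.mulVec v)] at h1
    linarith
  have h2 : (1 - τ) * (v ⬝ᵥ A.mulVec v) + τ * (v ⬝ᵥ v) = 0 := by
    have h3 := congrArg (fun w => v ⬝ᵥ w) hv0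
    simpa only [Matrix.add_mulVec, Matrix.smul_mulVec, Matrix.one_mulVec, dotProduct_add,
      dotProduct_smul, dotProduct_zero, smul_eq_mul] using h3
  rw [hvA, mul_zero, zero_add] at h2
  rcases mul_eq_zero.1 h2 with h2 | h2
  · rw [h2] at h0
    simp only [sub_zero, one_smul, zero_smul, add_zero] at h0
    exact h h0
  · exact hv (dotProduct_self_eq_zero.1 h2)

namespace HamiltonianSpectrum

/-- The Gram matrix of a bilinear form. -/
noncomputable def gramMatrix {n : ℕ} (β : Coord n →L[ℝ] Coord n →L[ℝ] ℝ) :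
    Matrix (Fin (2 * n)) (Fin (2 * n)) ℝ :=
  Matrix.of fun i j => β (EuclideanSpace.single i 1) (EuclideanSpace.single j 1)

theorem gramMatrix_eq_toMatrix {n : ℕ} (β : Coord n →L[ℝ] Coord n →L[ℝ] ℝ) :
    gramMatrix β = LinearMap.BilinForm.toMatrix
      (EuclideanSpace.basisFun (Fin (2 * n)) ℝ).toBasis β.toLinearMap₁₂ := by
  ext i j
  rw [LinearMap.BilinForm.toMatrix_apply]
  simp [gramMatrix]

theorem det_gramMatrix_of_comp {n : ℕ} {β β' : Coord n →L[ℝ] Coord n →L[ℝ] ℝ}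
    {L : Coord n →L[ℝ] Coord n} (h : ∀ v w, β' (L v) (L w) = β v w) :
    (gramMatrix β).det = L.det ^ 2 * (gramMatrix β').det := by
  have h1 : β.toLinearMap₁₂ = LinearMap.BilinForm.comp β'.toLinearMap₁₂ (L : Coord n →ₗ[ℝ] Coord n)
      (L : Coord n →ₗ[ℝ] Coord n) := by
    ext v w
    exact (h v w).symm
  rw [gramMatrix_eq_toMatrix, gramMatrix_eq_toMatrix, h1,
    LinearMap.BilinForm.toMatrix_comp (EuclideanSpace.basisFun (Fin (2 * n)) ℝ).toBasis, Matrix.det_mul,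
    Matrix.det_mul, Matrix.det_transpose, LinearMap.det_toMatrix, ContinuousLinearMap.det]
  ring

theorem det_gramMatrix_pos {n : ℕ} {β : Coord n →L[ℝ] Coord n →L[ℝ] ℝ}
    (hs : ∀ v w, β v w = - β w v) (hn : ∀ v, (∀ w, β v w = 0) → v = 0) :
    0 < (gramMatrix β).det := by
  refine Matrix.det_pos_of_transpose_eq_neg (Matrix.ext fun i j => hs _ _) ?_
  rw [gramMatrix_eq_toMatrix]
  exact (LinearMap.BilinForm.nondegenerate_iff_det_ne_zero _).1
    (LinearMap.BilinForm.Nondegenerate.ofSeparatingLeft hn)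

variable {n : ℕ} {H : Type*} [TopologicalSpace H]
  {I : ModelWithCorners ℝ (Coord n) H}
  {M : Type*} [TopologicalSpace M] [ChartedSpace H M]

namespace SymplecticForm

variable (Ω : SymplecticForm I M)

/-- The density of the Liouville measure in a chart. -/
noncomputable def liouvilleDensity (m : M) (y : Coord n) : ℝ :=
  √(gramMatrix (Ω.bilinChart m y)).det

/-- The Liouville measure of a chart. -/
noncomputable def chartMeasure [MeasurableSpace M] (m : M) : Measure M :=
  (((volume : Measure (Coord n)).restrict (extChartAt I m).target).withDensity
    (fun y => ENNReal.ofReal (Ω.liouvilleDensity m y))).map (extChartAt I m).symm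

theorem liouville_eq_iSup [MeasurableSpace M] : Ω.liouville = ⨆ m, Ω.chartMeasure m := by
  have h : ∀ m y, Ω.liouvilleDensity m y = Real.sqrt
      (Matrix.of (fun i j : Fin (2 * n) => formInChart I Ω.form m y
        ![EuclideanSpace.single i (1 : ℝ), EuclideanSpace.single j (1 : ℝ)])).det := by
    intro m y
    rw [liouvilleDensity]
    congr 2
    ext i j
    exact alternatingToBilin_apply (E := Coord n) (formInChart I Ω.form m y) _ _
  simp only [chartMeasure, h]
  rfl

variable [IsManifold I ∞ M]

theorem liouvilleDensity_pos {m : M} {y : Coord n} (hy : y ∈ (extChartAt I m).target) :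
    0 < Ω.liouvilleDensity m y :=
  Real.sqrt_pos.2 (det_gramMatrix_pos (fun v w => Ω.bilinChart_swap m y v w)
    fun _ hv => Ω.bilinChart_nondegenerate m hy hv)

omit [IsManifold I ∞ M] in
theorem continuousOn_liouvilleDensity (m : M) :
    ContinuousOn (Ω.liouvilleDensity m) (extChartAt I m).target := by
  have h1 : ContinuousOn (Ω.bilinChart m) (extChartAt I m).target :=
    (Ω.contDiffOn_bilinChart m).continuousOn
  have h2 : Continuous fun β : Coord n →L[ℝ] Coord n →L[ℝ] ℝ => (gramMatrix β).det := by
    refine Continuous.matrix_det (continuous_matrix fun i j => ?_)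
    change Continuous fun β : Coord n →L[ℝ] Coord n →L[ℝ] ℝ =>
      β (EuclideanSpace.single i 1) (EuclideanSpace.single j 1)
    fun_prop
  exact Real.continuous_sqrt.comp_continuousOn (h2.comp_continuousOn h1)

theorem isOpen_target_of_interior_eq_univ (hb : I.interior M = univ) (m : M) :
    IsOpen (extChartAt I m).target := by
  rw [← interior_eq_iff_isOpen]
  refine interior_subset.antisymm fun y hy => ?_
  have := extChartAt_mem_interior_target (I := I) (m := m) (hb ▸ mem_univ _)
    ((extChartAt I m).map_target hy)
  rwa [(extChartAt I m).right_inv hy] at this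

variable [MeasurableSpace M] [BorelSpace M]

omit [IsManifold I ∞ M] in
theorem measurableSet_extChartAt_image {m : M} (ht : IsOpen (extChartAt I m).target)
    {B : Set M} (hB : MeasurableSet B) :
    MeasurableSet (extChartAt I m '' ((extChartAt I m).source ∩ B)) := by
  rw [PartialEquiv.image_source_inter_eq']
  have h1 : Measurable ((extChartAt I m).target.domRestrict (extChartAt I m).symm) :=
    (continuousOn_extChartAt_symm m).domRestrict.measurable
  have h2 := ht.measurableSet.subtype_image (h1 hB)
  convert h2 using 1
  ext y
  simp only [mem_inter_iff, mem_preimage, mem_image, domRestrict, Subtype.exists, exists_and_left,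
    exists_prop, exists_eq_right_right]
  exact and_comm

omit [IsManifold I ∞ M] in
theorem chartMeasure_apply {m : M} (ht : IsOpen (extChartAt I m).target)
    {B : Set M} (hB : MeasurableSet B) :
    Ω.chartMeasure m B = ∫⁻ y in extChartAt I m '' ((extChartAt I m).source ∩ B),
      ENNReal.ofReal (Ω.liouvilleDensity m y) := by
  have h1 : AEMeasurable (extChartAt I m).symm (volume.restrict (extChartAt I m).target) :=
    (continuousOn_extChartAt_symm m).aemeasurable ht.measurableSet
  rw [chartMeasure, Measure.map_apply_of_aemeasurable
    (h1.mono_ac (withDensity_absolutelyContinuous _ _)) hB, withDensity_apply',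
    Measure.restrict_restrict' ht.measurableSet, PartialEquiv.image_source_inter_eq', inter_comm]

omit [IsManifold I ∞ M] in
theorem chartMeasure_inter_source {m : M} (ht : IsOpen (extChartAt I m).target)
    {B : Set M} (hB : MeasurableSet B) :
    Ω.chartMeasure m (B ∩ (extChartAt I m).source) = Ω.chartMeasure m B := by
  rw [Ω.chartMeasure_apply ht (hB.inter (isOpen_extChartAt_source m).measurableSet),
    Ω.chartMeasure_apply ht hB, inter_comm B, ← inter_assoc, inter_self]

/-- A symplectic map preserves the measures of the charts. -/
theorem chartMeasure_image {T : M → M} {m m' : M} {B : Set M}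
    (ht : IsOpen (extChartAt I m).target) (ht' : IsOpen (extChartAt I m').target)
    (hB : MeasurableSet B) (hTB : MeasurableSet (T '' B)) (hm : B ⊆ (extChartAt I m).source)
    (hm' : T '' B ⊆ (extChartAt I m').source) (hinj : InjOn T B)
    (hd : ∀ y ∈ extChartAt I m '' B,
      MDifferentiableAt 𝓘(ℝ, Coord n) I (T ∘ (extChartAt I m).symm) y)
    (hω : ∀ y ∈ extChartAt I m '' B, ∀ v w, Ω.bilin (T ((extChartAt I m).symm y))
      (coordDeriv I (T ∘ (extChartAt I m).symm) y v)
      (coordDeriv I (T ∘ (extChartAt I m).symm) y w) = Ω.bilinChart m y v w) :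
    Ω.chartMeasure m' (T '' B) = Ω.chartMeasure m B := by
  have : IsManifold I 1 M := IsManifold.of_le (n := ∞) (by simp)
  set χ := extChartAt I m
  set χ' := extChartAt I m'
  set g : Coord n → Coord n := χ' ∘ (T ∘ χ.symm)
  have hgB : ∀ x ∈ B, g (χ x) = χ' (T x) := fun x hx => by
    change χ' (T (χ.symm (χ x))) = _
    rw [χ.left_inv (hm hx)]
  have hTs : ∀ y ∈ χ '' B, T (χ.symm y) ∈ χ'.source := by
    rintro _ ⟨x, hx, rfl⟩
    rw [χ.left_inv (hm hx)]
    exact hm' ⟨x, hx, rfl⟩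
  have e1 : χ.source ∩ B = B := inter_eq_right.2 hm
  have e2 : χ'.source ∩ T '' B = T '' B := inter_eq_right.2 hm'
  have hBm : MeasurableSet (χ '' B) := by
    have := measurableSet_extChartAt_image ht hB
    rwa [e1] at this
  rw [Ω.chartMeasure_apply ht hB, Ω.chartMeasure_apply ht' hTB, e1, e2]
  have e3 : χ' '' (T '' B) = g '' (χ '' B) := by
    rw [image_image, image_image]
    exact image_congr fun x hx => (hgB x hx).symm
  have hgd : ∀ y ∈ χ '' B, HasFDerivWithinAt g (fderiv ℝ g y) (χ '' B) y := by
    intro y hy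
    have h1 : MDifferentiableAt I 𝓘(ℝ, Coord n) χ' ((T ∘ χ.symm) y) :=
      mdifferentiableAt_extChartAt (by rw [← extChartAt_source I]; exact hTs y hy)
    have h2 : MDifferentiableAt 𝓘(ℝ, Coord n) 𝓘(ℝ, Coord n) g y := h1.comp y (hd y hy)
    exact h2.differentiableAt.hasFDerivAt.hasFDerivWithinAt
  have hgi : InjOn g (χ '' B) := by
    rintro _ ⟨x, hx, rfl⟩ _ ⟨x', hx', rfl⟩ h
    rw [hgB x hx, hgB x' hx'] at h
    rw [hinj hx hx' (χ'.injOn (hm' ⟨x, hx, rfl⟩) (hm' ⟨x', hx', rfl⟩) h)]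
  rw [e3, lintegral_image_eq_lintegral_abs_det_fderiv_mul volume hBm hgd hgi]
  refine setLIntegral_congr_fun hBm fun y hy => ?_
  have h3 : ∀ v w, Ω.bilinChart m' (g y) (fderiv ℝ g y v) (fderiv ℝ g y w) =
      Ω.bilinChart m y v w := fun v w =>
    (Ω.bilin_coordDeriv m' (hd y hy) (hTs y hy) v w).symm.trans (hω y hy v w)
  -- The Gram determinant changes by the square of the Jacobian determinant, so its root, the
  -- density, changes by the absolute value, as in the change of variables formula.
  have h4 := det_gramMatrix_of_comp h3
  change ENNReal.ofReal |(fderiv ℝ g y).det| * ENNReal.ofReal (Ω.liouvilleDensity m' (g y)) =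
    ENNReal.ofReal (Ω.liouvilleDensity m y)
  rw [← ENNReal.ofReal_mul (abs_nonneg _), liouvilleDensity, liouvilleDensity, h4,
    Real.sqrt_mul (sq_nonneg _), Real.sqrt_sq_eq_abs]

variable (hb : I.interior M = univ)
include hb

theorem chartMeasure_eq_chartMeasure {m m' : M} {B : Set M} (hB : MeasurableSet B)
    (hm : B ⊆ (extChartAt I m).source) (hm' : B ⊆ (extChartAt I m').source) :
    Ω.chartMeasure m' B = Ω.chartMeasure m B := by
  have ht := isOpen_target_of_interior_eq_univ (I := I) hb m
  have ht' := isOpen_target_of_interior_eq_univ (I := I) hb m'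
  have hd : ∀ y ∈ extChartAt I m '' B,
      MDifferentiableAt 𝓘(ℝ, Coord n) I (extChartAt I m).symm y := by
    rintro _ ⟨x, hx, rfl⟩
    exact (contMDiffAt_extChartAt_symm (extChartAt_mem_interior_target (hb ▸ mem_univ _)
      (hm hx))).mdifferentiableAt (by simp)
  have h := Ω.chartMeasure_image (T := id) ht ht' hB (by rwa [image_id]) hm (by rwa [image_id])
    (injOn_id _) hd ?_
  · rwa [image_id] at h
  · rintro y hy v w
    have hyt : y ∈ (extChartAt I m).target := by
      obtain ⟨x, hx, rfl⟩ := hy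
      exact (extChartAt I m).map_source (hm hx)
    have h1 := Ω.bilin_coordDeriv m (hd y hy) ((extChartAt I m).map_target hyt) v w
    have h2 : (extChartAt I m ∘ (extChartAt I m).symm) =ᶠ[𝓝 y] id := by
      filter_upwards [ht.mem_nhds hyt] with z hz
      exact (extChartAt I m).right_inv hz
    rw [h2.fderiv_eq, fderiv_id, (extChartAt I m).right_inv hyt] at h1
    exact h1

/-- A supremum of measures is not computed set by set. The measure of the chart at `m`, plus the
supremum restricted to the complement of this chart, is an upper bound of all chart measures,
because they agree on overlaps; the added part is zero on `B`. -/
theorem liouville_apply {m : M} {B : Set M} (hB : MeasurableSet B)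
    (hm : B ⊆ (extChartAt I m).source) : Ω.liouville B = Ω.chartMeasure m B := by
  have ht := fun m => isOpen_target_of_interior_eq_univ (I := I) (M := M) hb m
  have hs := fun m : M => (isOpen_extChartAt_source (I := I) m).measurableSet
  rw [liouville_eq_iSup]
  refine le_antisymm ?_ (le_iSup (f := Ω.chartMeasure) m B)
  set S := (extChartAt I m).source
  have h1 : ⨆ m', Ω.chartMeasure m' ≤
      Ω.chartMeasure m + (⨆ m', Ω.chartMeasure m').restrict Sᶜ := by
    refine iSup_le fun m' => ?_
    rw [← Measure.restrict_add_restrict_compl (μ := Ω.chartMeasure m') (hs m)]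
    refine add_le_add (Measure.le_iff.2 fun A hA => ?_)
      (Measure.restrict_mono_measure (le_iSup Ω.chartMeasure m') _)
    rw [Measure.restrict_apply hA, ← Ω.chartMeasure_inter_source (ht m') (hA.inter (hs m)),
      Ω.chartMeasure_eq_chartMeasure hb ((hA.inter (hs m)).inter (hs m'))
        (fun x hx => hx.1.2) (fun x hx => hx.2)]
    exact measure_mono fun x hx => hx.1.1
  refine (h1 B).trans ?_
  rw [Measure.add_apply, Measure.restrict_apply hB,
    (disjoint_compl_right_iff_subset.2 hm).inter_eq, measure_empty, add_zero]

theorem isLocallyFiniteMeasure_liouville : IsLocallyFiniteMeasure Ω.liouville := by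
  refine ⟨fun x => ?_⟩
  have ht := isOpen_target_of_interior_eq_univ (I := I) hb x
  obtain ⟨ε, hε, hsub⟩ := Metric.nhds_basis_closedBall.mem_iff.1
    (ht.mem_nhds (mem_extChartAt_target x))
  set U := (extChartAt I x).source ∩ extChartAt I x ⁻¹' Metric.ball (extChartAt I x x) ε
  have hU : IsOpen U := isOpen_extChartAt_preimage' x Metric.isOpen_ball
  refine ⟨U, hU.mem_nhds ⟨mem_extChartAt_source x, Metric.mem_ball_self hε⟩, ?_⟩
  rw [Ω.liouville_apply hb hU.measurableSet inter_subset_left,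
    Ω.chartMeasure_apply ht hU.measurableSet]
  have h1 : IntegrableOn (Ω.liouvilleDensity x) (Metric.closedBall (extChartAt I x x) ε) :=
    ((Ω.continuousOn_liouvilleDensity x).mono hsub).integrableOn_compact
      (isCompact_closedBall _ _)
  refine (lintegral_mono_set ?_).trans_lt h1.lintegral_lt_top
  rintro _ ⟨z, hz, rfl⟩
  exact Metric.ball_subset_closedBall hz.2.2

theorem liouville_ne_zero [Nonempty M] : Ω.liouville ≠ 0 := by
  intro h
  obtain ⟨m⟩ := ‹Nonempty M›
  have ht := isOpen_target_of_interior_eq_univ (I := I) hb m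
  have h1 := Ω.liouville_apply hb (isOpen_extChartAt_source m).measurableSet
    (subset_refl (extChartAt I m).source)
  rw [h, Measure.coe_zero, Pi.zero_apply, Ω.chartMeasure_apply ht
    (isOpen_extChartAt_source m).measurableSet, inter_self, (extChartAt I m).image_source_eq_target,
    eq_comm, lintegral_eq_zero_iff' ((Ω.continuousOn_liouvilleDensity m).aemeasurable
      ht.measurableSet).ennreal_ofReal] at h1
  have h2 : ∀ᵐ y ∂(volume.restrict (extChartAt I m).target), False := by
    filter_upwards [h1, ae_restrict_mem ht.measurableSet] with y hy hyt
    exact (ENNReal.ofReal_pos.2 (Ω.liouvilleDensity_pos hyt)).ne' hy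
  rw [Filter.eventually_false_iff_eq_bot, ae_eq_bot, Measure.restrict_eq_zero] at h2
  exact (ht.measure_pos volume ⟨_, mem_extChartAt_target m⟩).ne' h2

end SymplecticForm

end HamiltonianSpectrum

/-! ### Liouville's theorem and the vanishing of `orbitDot` on closed manifolds. -/

namespace HamiltonianSpectrum

variable {n : ℕ} {H : Type*} [TopologicalSpace H]
  {I : ModelWithCorners ℝ (Coord n) H}
  {M : Type*} [TopologicalSpace M] [ChartedSpace H M] [IsManifold I ∞ M] [T2Space M]

namespace FlowFamily

variable {Ω : SymplecticForm I M} (Φ : FlowFamily Ω)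

theorem injective_orbit (s t : ℝ) : Function.Injective fun x => Φ.orbit s x t := by
  intro x y h
  have h1 := (Φ.isFullOrbit s x).eq Φ.smooth (Φ.isFullOrbit s y) h
  rw [← Φ.orbit_zero s x, h1, Φ.orbit_zero]

theorem mdifferentiableAt_orbit (s t : ℝ) {m : M} {y : Coord n}
    (hy : y ∈ interior (extChartAt I m).target) :
    MDifferentiableAt 𝓘(ℝ, Coord n) I (fun y => Φ.orbit s ((extChartAt I m).symm y) t) y := by
  have h1 : ContMDiff 𝓘(ℝ, Coord n) 𝓘(ℝ, ℝ × ℝ × Coord n) ∞ (fun y : Coord n => (s, t, y)) :=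
    (contDiff_const.prodMk (contDiff_const.prodMk contDiff_id)).contMDiff
  exact ((Φ.contMDiffAt_flowMap m s t hy).comp (g := Φ.flowMap m) y h1.contMDiffAt).mdifferentiableAt
    (by simp)

variable [MeasurableSpace M] [BorelSpace M] [SecondCountableTopology M] [CompactSpace M]
  (hb : I.interior M = univ)
include hb

omit [SecondCountableTopology M] in
theorem measurableEmbedding_orbit (s t : ℝ) : MeasurableEmbedding fun x => Φ.orbit s x t := by
  have h : Continuous fun x => Φ.orbit s x t := continuous_iff_continuousAt.2 fun x =>
    ContinuousAt.comp (g := fun p : ℝ × ℝ × M => Φ.orbit p.1 p.2.2 p.2.1)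
      (f := fun x => (s, t, x)) (Φ.continuousAt_orbit s t (hb ▸ mem_univ x)) (by fun_prop)
  exact (h.isClosedEmbedding (Φ.injective_orbit s t)).measurableEmbedding

/-- Liouville's theorem. -/
theorem measurePreserving_orbit (s t : ℝ) :
    MeasurePreserving (fun x => Φ.orbit s x t) Ω.liouville Ω.liouville := by
  set T : M → M := fun x => Φ.orbit s x t
  have hT := Φ.measurableEmbedding_orbit hb s t
  have hTc : Continuous T := continuous_iff_continuousAt.2 fun x =>
    ContinuousAt.comp (g := fun p : ℝ × ℝ × M => Φ.orbit p.1 p.2.2 p.2.1)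
      (f := fun x => (s, t, x)) (Φ.continuousAt_orbit s t (hb ▸ mem_univ x)) (by fun_prop)
  have := Ω.isLocallyFiniteMeasure_liouville hb
  set U : M → Set M := fun x => (extChartAt I x).source ∩ T ⁻¹' (extChartAt I (T x)).source
  have hUo : ∀ x, IsOpen (U x) := fun x =>
    (isOpen_extChartAt_source x).inter ((isOpen_extChartAt_source (T x)).preimage hTc)
  obtain ⟨S, hS, hSU⟩ := TopologicalSpace.countable_cover_nhds (f := U) fun x =>
    (hUo x).mem_nhds ⟨mem_extChartAt_source x, mem_extChartAt_source (T x)⟩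
  -- Equality of measures is local: on each set `U x` of a countable cover, `T` maps one chart into
  -- another and is symplectic.
  have hcomap : Ω.liouville.comap T = Ω.liouville := by
    refine Measure.ext_of_biUnion_eq_univ hS hSU fun x _ => Measure.ext fun A hA => ?_
    have hB := hA.inter (hUo x).measurableSet
    set B := A ∩ U x
    have hBm : B ⊆ (extChartAt I x).source := fun z hz => hz.2.1
    have hBm' : T '' B ⊆ (extChartAt I (T x)).source := by
      rintro _ ⟨z, hz, rfl⟩
      exact hz.2.2
    have hTB := hT.measurableSet_image' hB
    rw [Measure.restrict_apply hA, Measure.restrict_apply hA, hT.comap_apply,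
      Ω.liouville_apply hb hTB hBm', Ω.liouville_apply hb hB hBm]
    have hint : ∀ y ∈ extChartAt I x '' B, y ∈ interior (extChartAt I x).target := by
      rintro _ ⟨z, hz, rfl⟩
      exact extChartAt_mem_interior_target (hb ▸ mem_univ z) (hBm hz)
    exact Ω.chartMeasure_image (T := T)
      (SymplecticForm.isOpen_target_of_interior_eq_univ hb x)
      (SymplecticForm.isOpen_target_of_interior_eq_univ hb _) hB hTB hBm hBm'
      hT.injective.injOn (fun y hy => Φ.mdifferentiableAt_orbit s t (hint y hy))
      fun y hy v w => Φ.bilin_coordDeriv_orbit s t (hint y hy) v w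
  have hrange : MeasurableSet (range T) := hT.measurableSet_range
  -- Surjectivity of `T` is not needed: the total mass is finite and the range has full mass.
  have h1 : Ω.liouville (range T) = Ω.liouville univ := by
    rw [← image_univ, ← hT.comap_apply, hcomap]
  have h2 : ∀ᵐ x ∂Ω.liouville, x ∈ range T := by
    rw [ae_iff]
    change Ω.liouville (range T)ᶜ = 0
    rw [measure_compl hrange (measure_ne_top _ _), h1, tsub_self]
  refine ⟨hT.measurable, ?_⟩
  have h3 := hT.map_comap Ω.liouville
  rw [hcomap, Measure.restrict_eq_self_of_ae_mem h2] at h3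
  exact h3

theorem integral_hamDot_eq_zero (h0 : ∀ s t, ∫ x, Φ.ham s t x ∂Ω.liouville = 0) (s t : ℝ) :
    ∫ x, Φ.hamDot s t x ∂Ω.liouville = 0 := by
  have := Ω.isLocallyFiniteMeasure_liouville hb
  have hc : Continuous fun p : ℝ × M => Φ.hamDot p.1 t p.2 :=
    Φ.continuous_hamDot.comp (f := fun p : ℝ × M => ((p.1, t), p.2)) (by fun_prop)
  have hh : ∀ s, Continuous fun x : M => Φ.ham s t x := fun s =>
    Φ.smooth.continuous.comp (f := fun x : M => ((s, t), x)) (by fun_prop)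
  obtain ⟨C, hC⟩ := ((isCompact_Icc (a := s - 1) (b := s + 1)).prod
    (isCompact_univ (X := M))).exists_bound_of_continuousOn hc.continuousOn
  obtain ⟨C', hC'⟩ := (isCompact_univ (X := M)).exists_bound_of_continuousOn (hh s).continuousOn
  have h1 := hasDerivAt_integral_of_dominated_loc_of_deriv_le (μ := Ω.liouville)
    (F := fun s x => Φ.ham s t x) (F' := fun s x => Φ.hamDot s t x) (x₀ := s) (bound := fun _ => C)
    (s := Icc (s - 1) (s + 1)) (Icc_mem_nhds (by linarith) (by linarith))
    (Filter.Eventually.of_forall fun s => (hh s).aestronglyMeasurable)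
    (Integrable.of_bound (hh s).aestronglyMeasurable C'
      (Filter.Eventually.of_forall fun x => hC' x trivial))
    (hc.comp (f := fun x : M => (s, x)) (by fun_prop)).aestronglyMeasurable
    (Filter.Eventually.of_forall fun x s' hs' => hC (s', x) ⟨hs', trivial⟩)
    (integrable_const _)
    (Filter.Eventually.of_forall fun x s' _ => Φ.hasDerivAt_ham s' t x)
  have h2 := h1.2
  simp only [h0] at h2
  exact h2.unique (hasDerivAt_const _ _)

/-- By Fubini it suffices to integrate over `M` at each time. The flow preserves the measure, so the
integral is that of `hamDot s t`, which is the derivative in `s` of a vanishing mean. -/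
theorem integral_orbitDot_eq_zero (h0 : ∀ s t, ∫ x, Φ.ham s t x ∂Ω.liouville = 0) (s : ℝ) :
    ∫ x, Φ.orbitDot s x ∂Ω.liouville = 0 := by
  have := Ω.isLocallyFiniteMeasure_liouville hb
  set f : M → ℝ → ℝ := fun x t => Φ.hamDot s t (Φ.orbit s x t)
  have hc : Continuous (Function.uncurry f) := by
    have h1 : Continuous fun p : M × ℝ => Φ.orbit s p.1 p.2 :=
      continuous_iff_continuousAt.2 fun p =>
        ContinuousAt.comp (g := fun p : ℝ × ℝ × M => Φ.orbit p.1 p.2.2 p.2.1)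
          (f := fun p : M × ℝ => (s, p.2, p.1)) (Φ.continuousAt_orbit s p.2 (hb ▸ mem_univ p.1))
          (by fun_prop)
    exact Φ.continuous_hamDot.comp (f := fun p : M × ℝ => ((s, p.2), Φ.orbit s p.1 p.2))
      ((continuous_const.prodMk continuous_snd).prodMk h1)
  obtain ⟨C, hC⟩ := ((isCompact_univ (X := M)).prod
    (isCompact_Icc (a := (0 : ℝ)) (b := 1))).exists_bound_of_continuousOn hc.continuousOn
  have hint : Integrable (Function.uncurry f)
      (Ω.liouville.prod (volume.restrict (Ioc (0 : ℝ) 1))) := by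
    refine Integrable.of_bound hc.aestronglyMeasurable C ?_
    have h2 : Ω.liouville.prod (volume.restrict (Ioc (0 : ℝ) 1)) =
        (Ω.liouville.prod volume).restrict (univ ×ˢ Ioc (0 : ℝ) 1) := by
      rw [← Measure.prod_restrict, Measure.restrict_univ]
    rw [h2]
    filter_upwards [ae_restrict_mem (MeasurableSet.univ.prod measurableSet_Ioc)] with p hp
    exact hC p ⟨trivial, Ioc_subset_Icc_self hp.2⟩
  simp only [orbitDot, intervalIntegral.integral_of_le zero_le_one]
  rw [integral_integral_swap hint]
  have h3 : ∀ t, ∫ x, f x t ∂Ω.liouville = 0 := fun t => by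
    rw [(Φ.measurePreserving_orbit hb s t).integral_comp (Φ.measurableEmbedding_orbit hb s t)
      (fun x => Φ.hamDot s t x), Φ.integral_hamDot_eq_zero hb h0]
  simp only [h3, integral_zero]

/-- A constant with integral zero against a finite nonzero measure is zero. -/
theorem orbitDot_eq_zero_of_compact [PreconnectedSpace M] {φ : M → M}
    (hφ : ∀ s x, Φ.orbit s x 1 = φ x)
    (h0 : ∀ s t, ∫ x, Φ.ham s t x ∂Ω.liouville = 0) (s : ℝ) (x : M) : Φ.orbitDot s x = 0 := by
  have := Ω.isLocallyFiniteMeasure_liouville hb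
  have : Nonempty M := ⟨x⟩
  have h1 := Φ.integral_orbitDot_eq_zero hb h0 s
  simp only [fun y => Φ.orbitDot_eq_orbitDot hφ s y x, integral_const, smul_eq_mul] at h1
  refine (mul_eq_zero.1 h1).resolve_left ?_
  rw [measureReal_def]
  refine ENNReal.toReal_ne_zero.2 ?_
  exact ⟨fun h => Ω.liouville_ne_zero hb (Measure.measure_univ_eq_zero.1 h), measure_ne_top _ _⟩

end FlowFamily

end HamiltonianSpectrum

/-! ### Reparametrization of parameter, time and discs by `ramp`. -/

/-- A smooth map from the line to the unit interval, which is an increasing bijection of the unit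
interval. -/
noncomputable def ramp (t : ℝ) : ℝ := (1 - Real.cos (Real.pi * t)) / 2

/-- The derivative of `ramp`. -/
noncomputable def rampDeriv (t : ℝ) : ℝ := Real.pi * Real.sin (Real.pi * t) / 2

theorem ramp_zero : ramp 0 = 0 := by simp [ramp]

theorem ramp_one : ramp 1 = 1 := by
  rw [ramp, mul_one, Real.cos_pi]
  norm_num

theorem ramp_mem_Icc (t : ℝ) : ramp t ∈ Icc (0 : ℝ) 1 :=
  ⟨by rw [ramp]; linarith [Real.cos_le_one (Real.pi * t)],
    by rw [ramp]; linarith [Real.neg_one_le_cos (Real.pi * t)]⟩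

theorem contDiff_ramp : ContDiff ℝ ∞ ramp :=
  (contDiff_const.sub (Real.contDiff_cos.comp (contDiff_const.mul contDiff_id))).div_const 2

theorem contDiff_rampDeriv : ContDiff ℝ ∞ rampDeriv :=
  (contDiff_const.mul (Real.contDiff_sin.comp (contDiff_const.mul contDiff_id))).div_const 2

theorem hasDerivAt_ramp (t : ℝ) : HasDerivAt ramp (rampDeriv t) t := by
  have h := (((hasDerivAt_id t).const_mul Real.pi).cos.const_sub 1).div_const 2
  refine h.congr_deriv ?_
  change -(-Real.sin (Real.pi * t) * (Real.pi * 1)) / 2 = Real.pi * Real.sin (Real.pi * t) / 2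
  ring

theorem rampDeriv_nonneg {t : ℝ} (ht : t ∈ Icc (0 : ℝ) 1) : 0 ≤ rampDeriv t :=
  div_nonneg (mul_nonneg Real.pi_pos.le (Real.sin_nonneg_of_nonneg_of_le_pi
    (mul_nonneg Real.pi_pos.le ht.1) (mul_le_of_le_one_right Real.pi_pos.le ht.2))) zero_le_two

theorem injOn_ramp : InjOn ramp (Icc 0 1) := by
  intro s hs t ht h
  have h1 : ∀ {t : ℝ}, t ∈ Icc (0 : ℝ) 1 → Real.pi * t ∈ Icc 0 Real.pi := fun ht =>
    ⟨mul_nonneg Real.pi_pos.le ht.1, mul_le_of_le_one_right Real.pi_pos.le ht.2⟩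
  have h2 : Real.cos (Real.pi * s) = Real.cos (Real.pi * t) := by
    simp only [ramp] at h
    linarith
  exact mul_left_cancel₀ Real.pi_ne_zero (Real.injOn_cos (h1 hs) (h1 ht) h2)

theorem image_ramp : ramp '' Icc 0 1 = Icc 0 1 := by
  have h1 : ramp '' Icc 0 1 ⊆ Icc 0 1 := image_subset_iff.2 fun t _ => ramp_mem_Icc t
  refine h1.antisymm ?_
  have h := intermediate_value_Icc zero_le_one contDiff_ramp.continuous.continuousOn
  rwa [ramp_zero, ramp_one] at h

namespace HamiltonianSpectrum

/-- The derivative of the product of two ramps. -/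
noncomputable def rampDeriv₂ (p : ℝ × ℝ) : ℝ × ℝ →L[ℝ] ℝ × ℝ :=
  (rampDeriv p.1 • ContinuousLinearMap.id ℝ ℝ).prodMap (rampDeriv p.2 • ContinuousLinearMap.id ℝ ℝ)

theorem hasFDerivAt_ramp₂ (p : ℝ × ℝ) : HasFDerivAt (Prod.map ramp ramp) (rampDeriv₂ p) p := by
  have h : ∀ t, HasFDerivAt ramp (rampDeriv t • ContinuousLinearMap.id ℝ ℝ) t := fun t => by
    refine (hasDerivAt_ramp t).hasFDerivAt.congr_fderiv ?_
    ext
    simp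
  exact HasFDerivAt.prodMap p (h p.1) (h p.2)

theorem det_rampDeriv₂ (p : ℝ × ℝ) : (rampDeriv₂ p).det = rampDeriv p.1 * rampDeriv p.2 := by
  have h := LinearMap.det_prodMap (R := ℝ) (rampDeriv p.1 • LinearMap.id : ℝ →ₗ[ℝ] ℝ)
    (rampDeriv p.2 • LinearMap.id : ℝ →ₗ[ℝ] ℝ)
  rw [LinearMap.det_ring, LinearMap.det_ring] at h
  simp only [LinearMap.smul_apply, LinearMap.id_apply, smul_eq_mul, mul_one] at h
  exact h

theorem ramp₂_mem_unitSquare (p : ℝ × ℝ) : Prod.map ramp ramp p ∈ unitSquare :=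
  ⟨ramp_mem_Icc _, ramp_mem_Icc _⟩

theorem image_ramp₂ : Prod.map ramp ramp '' unitSquare = unitSquare := by
  rw [unitSquare, prodMap_image_prod, image_ramp]

theorem injOn_ramp₂ : InjOn (Prod.map ramp ramp) unitSquare := fun _ hp _ hq h =>
  Prod.ext (injOn_ramp hp.1 hq.1 (congrArg Prod.fst h))
    (injOn_ramp hp.2 hq.2 (congrArg Prod.snd h))

theorem contDiff_ramp₂ : ContDiff ℝ ∞ (Prod.map ramp ramp) := contDiff_ramp.prodMap contDiff_ramp

variable {n : ℕ} {H : Type*} [TopologicalSpace H]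
  {I : ModelWithCorners ℝ (Coord n) H}
  {M : Type*} [TopologicalSpace M] [ChartedSpace H M]

/-- The derivative of a disc in polar coordinates, in terms of the preferred coordinates at each
point. -/
noncomputable def squareDeriv (I : ModelWithCorners ℝ (Coord n) H) (u : ℝ × ℝ → M) (p : ℝ × ℝ) :
    ℝ × ℝ →L[ℝ] Coord n :=
  mfderivWithin 𝓘(ℝ, ℝ × ℝ) I u unitSquare p

theorem SymplecticForm.area_eq (Ω : SymplecticForm I M) (u : ℝ × ℝ → M) :
    Ω.area u = ∫ p in unitSquare, Ω.bilin (u p) (squareDeriv I u p (1, 0))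
      (squareDeriv I u p (0, 1)) := by
  simp only [SymplecticForm.bilin_apply]
  rfl

theorem coordDeriv_comp_ramp₂ {u : ℝ × ℝ → M}
    (hu : ContMDiffOn 𝓘(ℝ, ℝ × ℝ) I ∞ u unitSquare) (p : ℝ × ℝ) :
    coordDeriv I (u ∘ Prod.map ramp ramp) p =
      (squareDeriv I u (Prod.map ramp ramp p)).comp (rampDeriv₂ p) := by
  have h1 : HasMFDerivWithinAt 𝓘(ℝ, ℝ × ℝ) I u unitSquare (Prod.map ramp ramp p)
      (squareDeriv I u (Prod.map ramp ramp p)) :=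
    ((hu _ (ramp₂_mem_unitSquare p)).mdifferentiableWithinAt (by simp)).hasMFDerivWithinAt
  have h2 : HasMFDerivAt 𝓘(ℝ, ℝ × ℝ) 𝓘(ℝ, ℝ × ℝ) (Prod.map ramp ramp) p (rampDeriv₂ p) :=
    (hasFDerivAt_ramp₂ p).hasMFDerivAt
  have h3 := HasMFDerivWithinAt.comp (s := univ) p h1 h2.hasMFDerivWithinAt
    fun q _ => ramp₂_mem_unitSquare q
  exact (hasMFDerivWithinAt_univ.1 h3).mfderiv

theorem SymplecticForm.density_comp_ramp₂ (Ω : SymplecticForm I M) {u : ℝ × ℝ → M}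
    (hu : ContMDiffOn 𝓘(ℝ, ℝ × ℝ) I ∞ u unitSquare) (p : ℝ × ℝ) :
    Ω.density (u ∘ Prod.map ramp ramp) p = (rampDeriv p.1 * rampDeriv p.2) *
      Ω.bilin (u (Prod.map ramp ramp p)) (squareDeriv I u (Prod.map ramp ramp p) (1, 0))
        (squareDeriv I u (Prod.map ramp ramp p) (0, 1)) := by
  have h1 : rampDeriv₂ p (1, 0) = rampDeriv p.1 • ((1 : ℝ), (0 : ℝ)) := by simp [rampDeriv₂]
  have h2 : rampDeriv₂ p (0, 1) = rampDeriv p.2 • ((0 : ℝ), (1 : ℝ)) := by simp [rampDeriv₂]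
  rw [density, coordDeriv_comp_ramp₂ hu, ContinuousLinearMap.comp_apply,
    ContinuousLinearMap.comp_apply, h1, h2, map_smul, map_smul, map_smul, map_smul, smul_apply,
    smul_eq_mul, smul_eq_mul, Function.comp_apply]
  ring

/-- The symplectic area is invariant under reparametrization. -/
theorem SymplecticForm.integral_density_comp_ramp₂ (Ω : SymplecticForm I M) {u : ℝ × ℝ → M}
    (hu : ContMDiffOn 𝓘(ℝ, ℝ × ℝ) I ∞ u unitSquare) :
    ∫ p in unitSquare, Ω.density (u ∘ Prod.map ramp ramp) p = Ω.area u := by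
  have hQ : MeasurableSet unitSquare := measurableSet_Icc.prod measurableSet_Icc
  have h := integral_image_eq_integral_abs_det_fderiv_smul volume hQ
    (fun p _ => (hasFDerivAt_ramp₂ p).hasFDerivWithinAt) injOn_ramp₂
    (fun p => Ω.bilin (u p) (squareDeriv I u p (1, 0)) (squareDeriv I u p (0, 1)))
  rw [image_ramp₂] at h
  rw [Ω.area_eq, h]
  refine setIntegral_congr_fun hQ fun p hp => ?_
  change _ = |(rampDeriv₂ p).det| • _
  rw [Ω.density_comp_ramp₂ hu, det_rampDeriv₂, abs_of_nonneg
    (mul_nonneg (rampDeriv_nonneg hp.1) (rampDeriv_nonneg hp.2)), smul_eq_mul]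

theorem SymplecticForm.hamField_const_mul (Ω : SymplecticForm I M) {f : M → ℝ} {x : M}
    (hf : MDifferentiableAt I 𝓘(ℝ, ℝ) f x) (c : ℝ) :
    Ω.hamField (fun x => c * f x) x = c • Ω.hamField f x := by
  refine Ω.hamField_unique fun w => ?_
  rw [map_smul, smul_apply, Ω.bilin_hamField]
  have h1 : HasMFDerivAt I 𝓘(ℝ, ℝ) f x (coordDifferential I f x) := hf.hasMFDerivAt
  have h2 : HasMFDerivAt I 𝓘(ℝ, ℝ) (fun x => c * f x) x (c • coordDifferential I f x) :=
    h1.const_smul c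
  have h3 : coordDifferential I (fun x => c * f x) x = c • coordDifferential I f x := h2.mfderiv
  rw [h3]
  rfl

section Family

variable {F : ℝ → ℝ → M → ℝ} (hF : IsSmoothFamily I F)
include hF

/-- All of `ℝ` is mapped into `[0,1]`, so the family becomes smooth for all real `s` and `t`; no
one-sided derivatives at the ends of the intervals remain. -/
theorem IsSmoothFamily.contMDiff_comp_ramp : ContMDiff (𝓘(ℝ, ℝ × ℝ).prod I) 𝓘(ℝ, ℝ) ∞
    (fun p : (ℝ × ℝ) × M => F (ramp p.1.1) (ramp p.1.2) p.2) := by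
  have h1 : ContMDiff (𝓘(ℝ, ℝ × ℝ).prod I) (𝓘(ℝ, ℝ × ℝ).prod I) ∞
      (fun p : (ℝ × ℝ) × M => (Prod.map ramp ramp p.1, p.2)) :=
    (contDiff_ramp₂.contMDiff.comp contMDiff_fst).prodMk contMDiff_snd
  rw [← contMDiffOn_univ]
  exact ContMDiffOn.comp (t := unitSquare ×ˢ univ) hF h1.contMDiffOn
    fun p _ => ⟨ramp₂_mem_unitSquare p.1, trivial⟩

/-- Reparametrized orbits solve the reparametrized equation. -/
theorem IsSmoothFamily.isFullOrbit_comp_ramp {Ω : SymplecticForm I M} {s : ℝ} {z : ℝ → M}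
    (hz : Ω.IsOrbit (F (ramp s)) z) :
    Ω.IsFullOrbit (fun t x => rampDeriv t * F (ramp s) (ramp t) x) (z ∘ ramp) := by
  intro t
  have h1 : HasMFDerivWithinAt 𝓘(ℝ, ℝ) I z (Icc (0 : ℝ) 1) (ramp t)
      ((1 : ℝ →L[ℝ] ℝ).smulRight (Ω.hamField (F (ramp s) (ramp t)) (z (ramp t))) :
        ℝ →L[ℝ] Coord n) := hz _ (ramp_mem_Icc t)
  have h2 : HasMFDerivAt 𝓘(ℝ, ℝ) 𝓘(ℝ, ℝ) ramp t ((1 : ℝ →L[ℝ] ℝ).smulRight (rampDeriv t)) :=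
    (hasDerivAt_ramp t).hasFDerivAt.hasMFDerivAt
  have h3 := HasMFDerivWithinAt.comp (s := univ) t h1 h2.hasMFDerivWithinAt
    fun q _ => ramp_mem_Icc q
  have h4 : MDifferentiableAt I 𝓘(ℝ, ℝ) (F (ramp s) (ramp t)) (z (ramp t)) := by
    have h5 := contMDiff_slice (h := fun s t x => F (ramp s) (ramp t) x) hF.contMDiff_comp_ramp s t
    exact (h5 _).mdifferentiableAt (by simp)
  have h6 : ((1 : ℝ →L[ℝ] ℝ).smulRight (Ω.hamField (F (ramp s) (ramp t)) (z (ramp t))) :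
      ℝ →L[ℝ] Coord n).comp ((1 : ℝ →L[ℝ] ℝ).smulRight (rampDeriv t)) =
      ((1 : ℝ →L[ℝ] ℝ).smulRight (Ω.hamField (fun x => rampDeriv t * F (ramp s) (ramp t) x)
        ((z ∘ ramp) t)) : ℝ →L[ℝ] Coord n) := by
    rw [Function.comp_apply, Ω.hamField_const_mul h4]
    ext
    simp
  exact (hasMFDerivWithinAt_univ.1 h3).congr_mfderiv h6

theorem IsSmoothFamily.integral_comp_ramp {Ω : SymplecticForm I M} {s : ℝ} {z : ℝ → M}
    (hs : s ∈ Icc (0 : ℝ) 1) (hz : Ω.IsOrbit (F s) z) :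
    ∫ t in (0 : ℝ)..1, rampDeriv t * F s (ramp t) (z (ramp t)) = ∫ t in (0 : ℝ)..1, F s t (z t) := by
  have hzc : ContinuousOn z (Icc 0 1) := fun t ht => (hz t ht).continuousWithinAt
  have hc : ContinuousOn (fun t => F s t (z t)) (Icc 0 1) :=
    hF.continuousOn.comp (f := fun t => ((s, t), z t))
      ((continuousOn_const.prodMk continuousOn_id).prodMk hzc) fun t ht => ⟨⟨hs, ht⟩, trivial⟩
  have h := intervalIntegral.integral_deriv_smul_comp'' (a := 0) (b := 1) (f := ramp)
    (f' := rampDeriv) (g := fun t => F s t (z t)) contDiff_ramp.continuous.continuousOn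
    (fun t _ => (hasDerivAt_ramp t).hasDerivWithinAt) contDiff_rampDeriv.continuous.continuousOn
    (hc.mono (image_subset_iff.2 fun t _ => ramp_mem_Icc t))
  rw [ramp_zero, ramp_one] at h
  exact h

end Family

/-! ### The flow family of the given Hamiltonians and the end of the proof. -/

section Assembly

variable [T2Space M] [MeasurableSpace M] {Ω : SymplecticForm I M} {φ : M → M} {F : ℝ → ℝ → M → ℝ}

theorem SymplecticForm.IsNormalized.exists_support {f : ℝ → M → ℝ} (hf : Ω.IsNormalized f) :
    ∃ K : Set M, IsClosed K ∧ K ⊆ I.interior M ∧ ∀ t ∈ Icc (0 : ℝ) 1, ∀ x ∉ K, f t x = 0 := by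
  by_cases h : IsClosedManifold I M
  · refine ⟨univ, isClosed_univ, ?_, fun _ _ x hx => (hx trivial).elim⟩
    rw [← compl_empty_iff.1 (ModelWithCorners.compl_interior.trans h.2)]
  · obtain ⟨K, hK, hKi, h0⟩ := hf.2 h
    exact ⟨K, hK.isClosed, hKi, h0⟩

/-- The reparametrized family of Hamiltonians, with its orbits. -/
noncomputable def flowFamily (hF : IsSmoothFamily I F)
    (hnorm : ∀ s ∈ Icc (0 : ℝ) 1, Ω.IsNormalized (F s))
    (hgen : ∀ s ∈ Icc (0 : ℝ) 1, Ω.Generates (F s) φ) : FlowFamily Ω where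
  ham s t x := rampDeriv t * F (ramp s) (ramp t) x
  smooth := by
    have h1 : ContMDiff (𝓘(ℝ, ℝ × ℝ).prod I) 𝓘(ℝ, ℝ) ∞
        (fun p : (ℝ × ℝ) × M => rampDeriv p.1.2) :=
      (contDiff_rampDeriv.comp contDiff_snd).contMDiff.comp contMDiff_fst
    exact h1.mul hF.contMDiff_comp_ramp
  orbit s x := (hgen (ramp s) (ramp_mem_Icc s) x).choose ∘ ramp
  orbit_zero s x := by
    rw [Function.comp_apply, ramp_zero]
    exact (hgen (ramp s) (ramp_mem_Icc s) x).choose_spec.1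
  isFullOrbit s x :=
    hF.isFullOrbit_comp_ramp (hgen (ramp s) (ramp_mem_Icc s) x).choose_spec.2.2
  support s := by
    obtain ⟨K, hK, hKi, h0⟩ := (hnorm (ramp s) (ramp_mem_Icc s)).exists_support
    exact ⟨K, hK, hKi, fun t x hx => by rw [h0 _ (ramp_mem_Icc t) x hx, mul_zero]⟩

variable (hF : IsSmoothFamily I F) (hnorm : ∀ s ∈ Icc (0 : ℝ) 1, Ω.IsNormalized (F s))
  (hgen : ∀ s ∈ Icc (0 : ℝ) 1, Ω.Generates (F s) φ)

theorem flowFamily_orbit_one (s : ℝ) (x : M) : (flowFamily hF hnorm hgen).orbit s x 1 = φ x := by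
  change (hgen (ramp s) (ramp_mem_Icc s) x).choose (ramp 1) = φ x
  rw [ramp_one]
  exact (hgen (ramp s) (ramp_mem_Icc s) x).choose_spec.2.1

variable [IsManifold I ∞ M]

/-- Composing a disc with `ramp` in both polar coordinates makes it smooth on the whole plane. The
map is an orientation-preserving bijection of the square, so the area is unchanged, and the time
integral of the Hamiltonian is unchanged because the new Hamiltonian carries the factor `rampDeriv`.
-/
theorem exists_isOrbitDisc {s : ℝ} {a : ℝ} (ha : a ∈ Ω.spec (F (ramp s))) :
    ∃ u, (flowFamily hF hnorm hgen).IsOrbitDisc s u ∧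
      a = (flowFamily hF hnorm hgen).discAction s u := by
  obtain ⟨z, u, hz, hz01, hu, rfl⟩ := ha
  have h0 : (0 : ℝ) ∈ Icc (0 : ℝ) 1 := ⟨le_rfl, zero_le_one⟩
  have hbd : ∀ τ, u (Prod.map ramp ramp (1, τ)) = z (ramp τ) := fun τ => by
    rw [Prod.map_apply, ramp_one]
    exact hu.boundary _ (ramp_mem_Icc τ)
  refine ⟨u ∘ Prod.map ramp ramp, ⟨fun p _ => ?_, fun τ => ?_, fun r => ?_, fun τ => ?_⟩, ?_⟩
  · have h1 := hu.smooth.comp (s := univ) contDiff_ramp₂.contMDiff.contMDiffOn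
      fun p _ => ramp₂_mem_unitSquare p
    exact (contMDiffOn_univ.1 h1) p
  · change u (ramp 0, ramp τ) = u (ramp 0, ramp 0)
    rw [ramp_zero]
    exact hu.center _ (ramp_mem_Icc τ)
  · change u (ramp r, ramp 1) = u (ramp r, ramp 0)
    rw [ramp_zero, ramp_one]
    exact hu.periodic _ (ramp_mem_Icc r)
  · have h1 : z ∘ ramp = (flowFamily hF hnorm hgen).orbit s (z (ramp 0)) :=
      SymplecticForm.IsFullOrbit.eq (t₀ := 0) (flowFamily hF hnorm hgen).smooth
        (hF.isFullOrbit_comp_ramp hz) ((flowFamily hF hnorm hgen).isFullOrbit s (z (ramp 0)))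
        (FlowFamily.orbit_zero _ _ _).symm
    rw [Function.comp_apply, Function.comp_apply, hbd, hbd, ← h1, Function.comp_apply]
  · rw [FlowFamily.discAction, Ω.integral_density_comp_ramp₂ hu.smooth, SymplecticForm.action]
    congr 1
    rw [← hF.integral_comp_ramp (ramp_mem_Icc s) hz]
    refine intervalIntegral.integral_congr fun t _ => ?_
    change rampDeriv t * F (ramp s) (ramp t) (z (ramp t)) =
      rampDeriv t * F (ramp s) (ramp t) (u (Prod.map ramp ramp (1, t)))
    rw [hbd]

variable [SecondCountableTopology M] [ConnectedSpace M] [BorelSpace M]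

/-- Each of the cases closed, compact with boundary, and noncompact uses its own part of the
normalization. -/
theorem flowFamily_orbitDot (s : ℝ) (x : M) : (flowFamily hF hnorm hgen).orbitDot s x = 0 := by
  have hφ := flowFamily_orbit_one hF hnorm hgen
  by_cases h : IsClosedManifold I M
  · have := h.1
    have hb : I.interior M = univ :=
      compl_empty_iff.1 (ModelWithCorners.compl_interior.trans h.2)
    refine FlowFamily.orbitDot_eq_zero_of_compact _ hb hφ (fun s t => ?_) s x
    change ∫ x, rampDeriv t * F (ramp s) (ramp t) x ∂Ω.liouville = 0
    rw [integral_const_mul, (hnorm _ (ramp_mem_Icc s)).1 h _ (ramp_mem_Icc t), mul_zero]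
  · by_cases hc : CompactSpace M
    · refine FlowFamily.orbitDot_eq_zero_of_boundary _ hφ (fun hb => h ⟨hc, ?_⟩) s x
      rw [← ModelWithCorners.compl_interior, hb, compl_univ]
    · have := not_compactSpace_iff.1 hc
      refine FlowFamily.orbitDot_eq_zero_of_noncompact _ hφ (fun s => ?_) s x
      obtain ⟨K, hK, -, h0⟩ := (hnorm _ (ramp_mem_Icc s)).2 h
      exact ⟨K, hK, fun t x hx => (congrArg (rampDeriv t * ·) (h0 _ (ramp_mem_Icc t) x hx)).trans
        (mul_zero _)⟩

include hF hnorm hgen in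
/-- The union of the action spectra of a family of normalized Hamiltonians with the same time-one
map is a null set. -/
theorem volume_iUnion_spec_eq_zero : volume {a | ∃ s ∈ Icc (0 : ℝ) 1, a ∈ Ω.spec (F s)} = 0 := by
  refine measure_mono_null ?_ ((flowFamily hF hnorm hgen).volume_discAction_eq_zero
    (flowFamily_orbit_one hF hnorm hgen) fun s x _ => flowFamily_orbitDot hF hnorm hgen s x)
  rintro a ⟨s, hs, ha⟩
  obtain ⟨s', -, rfl⟩ := image_ramp.symm.subset hs
  obtain ⟨u, hu, h⟩ := exists_isOrbitDisc hF hnorm hgen ha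
  exact ⟨s', u, hu, h⟩

end Assembly

/-- The image is connected, so two different values would put an interval of positive length into a
null set. -/
theorem eq_of_volume_image_eq_zero {c : ℝ → ℝ} {S : Set ℝ} (hS : IsPreconnected S)
    (hc : ContinuousOn c S) (h0 : volume (c '' S) = 0) {s t : ℝ} (hs : s ∈ S) (ht : t ∈ S) :
    c s = c t := by
  have h1 := hS.image c hc
  have h2 : ∀ {a b}, a ∈ c '' S → b ∈ c '' S → b ≤ a := fun {a b} ha hb => by
    have h3 := measure_mono_null (h1.Icc_subset ha hb) h0
    rwa [Real.volume_Icc, ENNReal.ofReal_eq_zero, sub_nonpos] at h3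
  exact le_antisymm (h2 ⟨t, ht, rfl⟩ ⟨s, hs, rfl⟩) (h2 ⟨s, hs, rfl⟩ ⟨t, ht, rfl⟩)

end HamiltonianSpectrum

open HamiltonianSpectrum in
theorem mainTheorem2 {n : ℕ} {H : Type*} [TopologicalSpace H]
    (I : ModelWithCorners ℝ (EuclideanSpace ℝ (Fin (2 * n))) H)
    {M : Type*} [TopologicalSpace M] [ChartedSpace H M] [IsManifold I ∞ M]
    [T2Space M] [SecondCountableTopology M] [ConnectedSpace M]
    [MeasurableSpace M] [BorelSpace M]
    (Ω : SymplecticForm I M) (φ : M → M) (F : ℝ → ℝ → M → ℝ)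
    (hF : IsSmoothFamily I F)
    (hnorm : ∀ s ∈ Icc (0 : ℝ) 1, Ω.IsNormalized (F s))
    (hgen : ∀ s ∈ Icc (0 : ℝ) 1, Ω.Generates (F s) φ)
    (c : ℝ → ℝ) (hc : ContinuousOn c (Icc (0 : ℝ) 1))
    (hspec : ∀ s ∈ Icc (0 : ℝ) 1, c s ∈ Ω.spec (F s)) :
    ∃ a : ℝ, ∀ s ∈ Icc (0 : ℝ) 1, c s = a := by
  have h0 : volume (c '' Icc 0 1) = 0 := by
    refine measure_mono_null ?_ (volume_iUnion_spec_eq_zero hF hnorm hgen)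
    rintro _ ⟨s, hs, rfl⟩
    exact ⟨s, hs, hspec s hs⟩
  exact ⟨c 0, fun s hs => eq_of_volume_image_eq_zero isPreconnected_Icc hc h0 hs
    (left_mem_Icc.2 zero_le_one)⟩
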